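/- **Setting.** Three subsystems with states $x_i\in\mathbb R^{n_i}$, inputs $u_i\in\mathbb R^{q_i}$ and outputs $y_i\in\mathbb R^{p_i}$ ($i=1,2,3$) form the system $$x(k+1)=Ax(k)+Bu(k)+w(k),\qquad y(k)=Cx(k)+v(k),$$ $$A=\begin{bmatrix}A_{11}&0&A_{13}\\A_{21}&A_{22}&0\\0&A_{32}&A_{33}\end{bmatrix},\quad B=\mathrm{diag}(B_1,B_2,B_3),\quad C=\mathrm{diag}(C_1,C_2,C_3).$$ Here $x(0),w(0),w(1),\dots,v(0),v(1),\dots$ are jointly Gaussian with mean zero, $\mathbf E\,x(0)x(0)^T=P_0$, $\mathbf E\,w(k)w(l)^T=\delta_{kl}W$, $\mathbf E\,v(k)v(l)^T=\delta_{kl}V$, and $x(0)$, $w$, $v$ are mutually uncorrelated. A controller is admissible if each $u_i(k)$, $0\le k<N$, is a Borel function of the information set $\mathcal I_i(k)$, where $\mathcal I_1(k)=\{y_1(k),y_1(k-1),y_3(k-1),y(0:k-2)\}$, $\mathcal I_2(k)=\{y_2(k),y_1(k-1),y_2(k-1),y(0:k-2)\}$, $\mathcal I_3(k)=\{y_3(k),y_2(k-1),y_3(k-1),y(0:k-2)\}$.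 The cost to be minimized over admissible controllers is $$J=\mathbf E\Big\{\sum_{k=0}^{N-1}\begin{bmatrix}x(k)\\u(k)\end{bmatrix}^TQ\begin{bmatrix}x(k)\\u(k)\end{bmatrix}+x(N)^TQ_0x(N)\Big\},\qquad Q=\begin{bmatrix}Q_{xx}&Q_{xu}\\Q_{xu}^T&Q_{uu}\end{bmatrix}.$$ **LQR gain.** $S(N)=Q_0$ and, for $k=N-1,\dots,0$, $H(k)=B^TS(k+1)B+Q_{uu}$, $L(k)=-H(k)^{-1}(B^TS(k+1)A+Q_{xu}^T)$, and $S(k)=A^TS(k+1)A+Q_{xx}-(A^TS(k+1)B+Q_{xu})H(k)^{-1}(B^TS(k+1)A+Q_{xu}^T)$. **Estimators.** $P(0)=P_0$, $\widetilde Y(k)=CP(k)C^T+V$, $K(k)=AP(k)C^T\widetilde Y(k)^{-1}$, $P(k+1)=AP(k)A^T+W-K(k)CP(k)A^T$. Let $S_1=\{1,3\}$, $S_2=\{1,2\}$, $S_3=\{2,3\}$, $S_t=\{1,2,3\}$, and write $[X]_{ST}$ for the submatrix with block rows $S$ and block columns $T$ and $[A]_i$ for the $i$th block row of $A$. The matrix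 $K^{[1]}(k)$ has block row $i$ equal to $[A]_i[P(k)]_{S_tS_i}[C]_{S_iS_i}^T([C]_{S_iS_i}[P(k)]_{S_iS_i}[C]_{S_iS_i}^T+[V]_{S_iS_i})^{-1}$ in the block columns $S_i$ and zero elsewhere. The estimates are given by $\hat x(0|-1)=\hat x^{[1]}(0)=0$ and, with $\widetilde y(k)=y(k)-C\hat x(k|k-1)$, $$\hat x(k+1|k)=A\hat x(k|k-1)+Bu(k)+K(k)\widetilde y(k),\qquad \hat x^{[1]}(k+1)=A\hat x(k|k-1)+Bu(k)+K^{[1]}(k)\widetilde y(k).$$ Put $P^{[1]}(0)=P_0$, $\widetilde P(0)=0$ and, with $\Delta K=K-K^{[1]}$, $P^{[1]}(k+1)=P(k+1)+\Delta K(k)\widetilde Y(k)\Delta K(k)^T$, $\widetilde P(k+1)=\Delta K(k)\widetilde Y(k)$, and $\widetilde Y^{[1]}(k)=CP^{[1]}(k)C^T+V$. **Correction gains.** Let $F(k)$ be block diagonal, let $F^{[1]}(k)$ have zero blocks $(1,2),(2,3),(3,1)$, let $\xi_1(k)$, $\xi_2(k)$ stack their remaining entries, and let $E_1,E_2$ be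 the 0-1 matrices with $\mathrm{vec}\,F(k)=E_1\xi_1(k)$, $\mathrm{vec}\,F^{[1]}(k)=E_2\xi_2(k)$. Put $\zeta(k)=(\xi_1(k-1),\xi_2(k))$ and $E(k)=\mathrm{diag}(E_1,E_2)$ for $1\le k<N$, and $\zeta(N)=\xi_1(N-1)$. Let $\mathcal U=[\,I\;\;0\,]$ and $M_k=[\,-I\otimes L(k)B\;\;\;I\,]$, and interpret $\mathcal UE(N)$ as $E_1$. For $1\le k<N$ put $$Z_1(k)=E(k)^T\begin{bmatrix}\mathcal U\\M_k\end{bmatrix}^T\begin{bmatrix}\widetilde Y^{[1]}(k-1)\otimes H(k-1)&0\\0&\widetilde Y(k-1)\otimes H(k)\end{bmatrix}\begin{bmatrix}\mathcal U\\M_k\end{bmatrix}E(k),$$ $$Z_2(k)=E(k)^TM_k^T\big(\widetilde P(k)^TC^T\otimes H(k)\big)\,\mathcal UE(k+1),$$ $$b(k)=b_0(k)+E(k)^TM_k^T\Big[\big(\widetilde Y(k-1)\otimes H(k)\big)\mathrm{vec}\big(L(k)K^{[1]}(k-1)\big)+\big(\widetilde P(k)^T\otimes H(k)\big)\mathrm{vec}\,L(k)\Big],$$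 and $Z_1(N)=E_1^T(\widetilde Y^{[1]}(N-1)\otimes H(N-1))E_1$, $b(N)=b_0(N)$, where for $1\le k\le N$ $$b_0(k)=(\mathcal UE(k))^T\Big[\big(CP^{[1]}(k-1)\otimes H(k-1)\big)\mathrm{vec}\,L(k-1)+\big(C\widetilde P(k-1)\otimes H(k-1)\big)\mathrm{vec}\big(L(k-1)K^{[1]}(k-2)\big)\Big]$$ (the last term is absent for $k=1$). Let $R(N)=Z_1(N)$, $c(N)=b(N)$ and, for $k=N-1,\dots,1$, $R(k)=Z_1(k)-Z_2(k)R(k+1)^{-1}Z_2(k)^T$, $c(k)=b(k)-Z_2(k)R(k+1)^{-1}c(k+1)$. Then $F(k)$ ($0\le k<N$) and $F^{[1]}(k)$ ($1\le k<N$) are defined by $\zeta(1)=R(1)^{-1}c(1)$ and $\zeta(k+1)=-R(k+1)^{-1}(Z_2(k)^T\zeta(k)-c(k+1))$. **Theorem.** Assume that $V$ and $Q_{uu}$ are positive definite and that $Q_0$ and $Q$ are positive semidefinite. Let $\hat x(k)=\mathbf E\{x(k)\mid y(0:k-2)\}$. Then there is an optimal admissible controller, and an admissible controller is optimal if and only if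 almost surely, for $0\le k<N$, $$u(k)=F(k)\big(y(k)-C\hat x^{[1]}(k)\big)+F^{[1]}(k)\big(y(k-1)-C\hat x(k-1|k-2)\big)+L(k)\hat x(k),$$ where the second term is absent for $k=0$. Under the optimal controller, almost surely, $\hat x(0)=0$ and, for $1\le k\le N$, $$\hat x(k)=\hat x^{[1]}(k)-\big(BF(k-1)+K^{[1]}(k-1)\big)\big(y(k-1)-C\hat x(k-1|k-2)\big);$$ with these recursive expressions for $\hat x(k)$ the formula for $u(k)$ itself defines an optimal admissible controller. Moreover, under the optimal controller and for $0\le k\le N$: $\hat x(k|k-1)=\mathbf E\{x(k)\mid y(0:k-1)\}$; $\hat x^{[1]}_i(k)=\mathbf E\{x_i(k)\mid\mathcal I_i^{[1]}(k)\}$, where $\mathcal I^{[1]}_i(k)$ is the set of the measurements in $\mathcal I_i(k)$ taken up to time $k-1$; the matrices $P(k)$, $P^{[1]}(k)$, $\widetilde Y(k)$, $\widetilde Y^{[1]}(k)$ are the covariances of $x(k)-\hat x(k|k-1)$, $x(k)-\hat x^{[1]}(k)$, $\widetilde y(k)$ and $y(k)-C\hat x^{[1]}(k)$; and, for $k\ge1$,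 $\widetilde P(k)=\mathbf E\{(x(k)-\hat x^{[1]}(k))\,\widetilde y(k-1)^T\}$. -/

import Mathlib

open MeasureTheory ProbabilityTheory Matrix
open scoped Kronecker

noncomputable section

/-- Coordinates of a vector partitioned into three blocks of sizes `d 0`, `d 1`, `d 2`. -/
abbrev Blk (d : Fin 3 → ℕ) : Type := (i : Fin 3) × Fin (d i)

/-- `Near i j`: there is an arc `j → i`, or `j = i`. The graph is the cycle `0 → 1 → 2 → 0`
(subtraction is modulo 3). -/
abbrev Near (i j : Fin 3) : Prop := j = i ∨ j = i - 1

/-- Length of the shortest path from `j` to `i` in the cycle `0 → 1 → 2 → 0`. -/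
def delay (j i : Fin 3) : ℕ := if j = i then 0 else if j = i - 1 then 1 else 2

/-- The data of the three-player problem: block sizes `n` (states), `q` (inputs), `p` (outputs),
system matrices, noise covariances `W`, `V`, initial covariance `P0`, cost matrices, horizon. -/
structure ThreePlayer (n q p : Fin 3 → ℕ) where
  A : Matrix (Blk n) (Blk n) ℝ
  A_sparse : ∀ r s : Blk n, ¬ Near r.1 s.1 → A r s = 0
  Bi : ∀ i, Matrix (Fin (n i)) (Fin (q i)) ℝ
  Ci : ∀ i, Matrix (Fin (p i)) (Fin (n i)) ℝ
  W : Matrix (Blk n) (Blk n) ℝ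
  V : Matrix (Blk p) (Blk p) ℝ
  P0 : Matrix (Blk n) (Blk n) ℝ
  Q : Matrix (Blk n ⊕ Blk q) (Blk n ⊕ Blk q) ℝ
  Q0 : Matrix (Blk n) (Blk n) ℝ
  N : ℕ

/-- `M` is the matrix `E{X Yᵀ}`. -/
def HasCov {Ω ι κ : Type*} [MeasurableSpace Ω] (μ : Measure Ω)
    (X : Ω → ι → ℝ) (Y : Ω → κ → ℝ) (M : Matrix ι κ ℝ) : Prop :=
  ∀ r s, Integrable (fun ω => X ω r * Y ω s) μ ∧ ∫ ω, X ω r * Y ω s ∂μ = M r s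

/-- The output coordinates in `y(0:k-d)`. -/
def outputsUpTo (p : Fin 3 → ℕ) (d k : ℕ) : Set (ℕ × Blk p) := {a | a.1 + d ≤ k}

/-- The information set `I_i(k)`: the outputs of player `j` up to time `k - delay j i`. -/
def info (p : Fin 3 → ℕ) (i : Fin 3) (k : ℕ) : Set (ℕ × Blk p) := {a | a.1 + delay a.2.1 i ≤ k}

/-- The part of `I_i(k)` that was measured up to time `k - 1`. -/
def infoPast (p : Fin 3 → ℕ) (i : Fin 3) (k : ℕ) : Set (ℕ × Blk p) :=
  info p i k ∩ outputsUpTo p 1 k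

/-- The tuple of the output coordinates in `I`. -/
def observe {Ω : Type*} {p : Fin 3 → ℕ} (I : Set (ℕ × Blk p)) (y : ℕ → Ω → Blk p → ℝ) :
    Ω → I → ℝ := fun ω a => y a.1.1 ω a.1.2

/-- The σ-algebra generated by the output coordinates in `I`. -/
@[reducible] def sigmaOf {Ω : Type*} {p : Fin 3 → ℕ} (I : Set (ℕ × Blk p)) (y : ℕ → Ω → Blk p → ℝ) :
    MeasurableSpace Ω := MeasurableSpace.comap (observe I y) MeasurableSpace.pi

namespace ThreePlayer

variable {n q p : Fin 3 → ℕ} (S : ThreePlayer n q p)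

def B : Matrix (Blk n) (Blk q) ℝ := Matrix.blockDiagonal' S.Bi

def C : Matrix (Blk p) (Blk n) ℝ := Matrix.blockDiagonal' S.Ci

def Qxx : Matrix (Blk n) (Blk n) ℝ := S.Q.toBlocks₁₁

def Qxu : Matrix (Blk n) (Blk q) ℝ := S.Q.toBlocks₁₂

def Quu : Matrix (Blk q) (Blk q) ℝ := S.Q.toBlocks₂₂

/-! ### The control problem -/

/-- All coordinates of `x(0)`, `w(k)`, `v(k)` as one real-valued process. -/
def primitive {Ω : Type*} (x0 : Ω → Blk n → ℝ) (w : ℕ → Ω → Blk n → ℝ) (v : ℕ → Ω → Blk p → ℝ) :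
    Blk n ⊕ (ℕ × Blk n) ⊕ (ℕ × Blk p) → Ω → ℝ
  | .inl r, ω => x0 ω r
  | .inr (.inl a), ω => w a.1 ω a.2
  | .inr (.inr a), ω => v a.1 ω a.2

/-- `x(0)`, `w`, `v` are jointly Gaussian with mean zero, `x(0)` has covariance `P0`, and `w`, `v`
are white with covariances `W`, `V`, uncorrelated with each other and with `x(0)`. -/
structure IsNoise {Ω : Type*} [MeasurableSpace Ω] (μ : Measure Ω) (x0 : Ω → Blk n → ℝ)
    (w : ℕ → Ω → Blk n → ℝ) (v : ℕ → Ω → Blk p → ℝ) : Prop where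
  measurable_x0 : Measurable x0
  measurable_w : ∀ k, Measurable (w k)
  measurable_v : ∀ k, Measurable (v k)
  gaussian : IsGaussianProcess (primitive x0 w v) μ
  mean_zero : ∀ a, ∫ ω, primitive x0 w v a ω ∂μ = 0
  cov_x0 : HasCov μ x0 x0 S.P0
  cov_w : ∀ k l, HasCov μ (w k) (w l) (if k = l then S.W else 0)
  cov_v : ∀ k l, HasCov μ (v k) (v l) (if k = l then S.V else 0)
  cov_wv : ∀ k l, HasCov μ (w k) (v l) 0
  cov_x0w : ∀ k, HasCov μ x0 (w k) 0
  cov_x0v : ∀ k, HasCov μ x0 (v k) 0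

/-- `(x, u, y)` is a run of the system under some admissible controller: each `u_i(k)`, `k < N`,
is a Borel measurable function of the information set `I_i(k)`. -/
structure IsControlled {Ω : Type*} (x0 : Ω → Blk n → ℝ) (w : ℕ → Ω → Blk n → ℝ)
    (v : ℕ → Ω → Blk p → ℝ) (x : ℕ → Ω → Blk n → ℝ) (u : ℕ → Ω → Blk q → ℝ)
    (y : ℕ → Ω → Blk p → ℝ) : Prop where
  start : ∀ ω, x 0 ω = x0 ω
  step : ∀ k ω, x (k + 1) ω = S.A *ᵥ x k ω + S.B *ᵥ u k ω + w k ω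
  output : ∀ k ω, y k ω = S.C *ᵥ x k ω + v k ω
  control : ∀ k < S.N, ∀ i, ∃ f : (info p i k → ℝ) → Fin (q i) → ℝ, Measurable f ∧
    ∀ ω a, u k ω ⟨i, a⟩ = f (observe (info p i k) y ω) a

/-- The finite-horizon cost `J`, the expectation of a nonnegative random variable (`Q` and `Q0`
are positive semidefinite), with value in `[0, ∞]`. -/
def cost {Ω : Type*} [MeasurableSpace Ω] (μ : Measure Ω) (x : ℕ → Ω → Blk n → ℝ)
    (u : ℕ → Ω → Blk q → ℝ) : ENNReal :=
  ∫⁻ ω, ENNReal.ofReal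
    ((∑ k ∈ Finset.range S.N,
        Sum.elim (x k ω) (u k ω) ⬝ᵥ S.Q *ᵥ Sum.elim (x k ω) (u k ω))
      + x S.N ω ⬝ᵥ S.Q0 *ᵥ x S.N ω) ∂μ

/-- The cost of the run `(x, u)` is minimal among all runs under admissible controllers. -/
def IsOptimal {Ω : Type*} [MeasurableSpace Ω] (μ : Measure Ω) (x0 : Ω → Blk n → ℝ)
    (w : ℕ → Ω → Blk n → ℝ) (v : ℕ → Ω → Blk p → ℝ) (x : ℕ → Ω → Blk n → ℝ)
    (u : ℕ → Ω → Blk q → ℝ) : Prop :=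
  ∀ x' u' y', S.IsControlled x0 w v x' u' y' → S.cost μ x u ≤ S.cost μ x' u'

/-! ### The LQR gain -/

/-- The Riccati matrices `S(k)`, `k ≤ N`, with `S(N) = Q0`. -/
def Ric (k : ℕ) : Matrix (Blk n) (Blk n) ℝ :=
  if k < S.N then
    S.Aᵀ * Ric (k + 1) * S.A + S.Qxx
      - (S.Aᵀ * Ric (k + 1) * S.B + S.Qxu) * (S.Bᵀ * Ric (k + 1) * S.B + S.Quu)⁻¹
        * (S.Bᵀ * Ric (k + 1) * S.A + S.Qxuᵀ)
  else S.Q0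
termination_by S.N - k

def H (k : ℕ) : Matrix (Blk q) (Blk q) ℝ := S.Bᵀ * S.Ric (k + 1) * S.B + S.Quu

def L (k : ℕ) : Matrix (Blk q) (Blk n) ℝ :=
  -((S.H k)⁻¹ * (S.Bᵀ * S.Ric (k + 1) * S.A + S.Qxuᵀ))

/-! ### The estimator gains and covariances -/

/-- Covariance `P(k)` of the one-step prediction error. -/
def P : ℕ → Matrix (Blk n) (Blk n) ℝ
  | 0 => S.P0
  | k + 1 => S.A * P k * S.Aᵀ + S.W
      - S.A * P k * S.Cᵀ * (S.C * P k * S.Cᵀ + S.V)⁻¹ * S.C * P k * S.Aᵀ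

/-- The Kalman gain `K(k)`. -/
def K (k : ℕ) : Matrix (Blk n) (Blk p) ℝ :=
  S.A * S.P k * S.Cᵀ * (S.C * S.P k * S.Cᵀ + S.V)⁻¹

/-- Covariance of the innovation. -/
def Yt (k : ℕ) : Matrix (Blk p) (Blk p) ℝ := S.C * S.P k * S.Cᵀ + S.V

/-- The indices in the blocks `S_i = {i, i - 1}`. -/
abbrev NearIdx (d : Fin 3 → ℕ) (i : Fin 3) : Type := {a : Blk d // Near i a.1}

/-- The nonzero blocks of the `i`th block row of `K1`:
`[A]_i [P]_{S_t S_i} [C]_{S_i S_i}ᵀ ([C]_{S_i S_i} [P]_{S_i S_i} [C]_{S_i S_i}ᵀ + [V]_{S_i S_i})⁻¹`. -/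
def K1row (k : ℕ) (i : Fin 3) : Matrix (Fin (n i)) (NearIdx p i) ℝ :=
  let CS : Matrix (NearIdx p i) (NearIdx n i) ℝ := S.C.submatrix Subtype.val Subtype.val
  let PS : Matrix (NearIdx n i) (NearIdx n i) ℝ := (S.P k).submatrix Subtype.val Subtype.val
  let VS : Matrix (NearIdx p i) (NearIdx p i) ℝ := S.V.submatrix Subtype.val Subtype.val
  let Ai : Matrix (Fin (n i)) (Blk n) ℝ := S.A.submatrix (fun r => ⟨i, r⟩) id
  let PtS : Matrix (Blk n) (NearIdx n i) ℝ := (S.P k).submatrix id Subtype.val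
  Ai * PtS * CSᵀ * (CS * PS * CSᵀ + VS)⁻¹

/-- The sparse estimator gain `K^{[1]}(k)`. -/
def K1 (k : ℕ) : Matrix (Blk n) (Blk p) ℝ :=
  Matrix.of fun r s => if h : Near r.1 s.1 then S.K1row k r.1 r.2 ⟨s, h⟩ else 0

/-- Covariance `P^{[1]}(k)` of the error of the local estimate. -/
def P1 : ℕ → Matrix (Blk n) (Blk n) ℝ
  | 0 => S.P0
  | k + 1 => S.P (k + 1) + (S.K k - S.K1 k) * S.Yt k * (S.K k - S.K1 k)ᵀ

/-- Covariance of the local innovation. -/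
def Y1t (k : ℕ) : Matrix (Blk p) (Blk p) ℝ := S.C * S.P1 k * S.Cᵀ + S.V

/-- Covariance of the local estimation error at time `k` with the innovation at time `k - 1`
(which is absent for `k = 0`). -/
def Pt : ℕ → Matrix (Blk n) (Blk p) ℝ
  | 0 => 0
  | k + 1 => (S.K k - S.K1 k) * S.Yt k

/-! ### The gain recursion -/

/-- The index set of `vec M` for a `Blk q × Blk p` matrix `M`. -/
abbrev VecIdx (q p : Fin 3 → ℕ) : Type := Blk p × Blk q

/-- The entries of the diagonal blocks: the index set of `ξ₁`. -/
abbrev Idx1 (q p : Fin 3 → ℕ) : Type := {a : VecIdx q p // a.1.1 = a.2.1}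

/-- The entries of the blocks `(i, j)` with `Near i j`: the index set of `ξ₂`. -/
abbrev Idx2 (q p : Fin 3 → ℕ) : Type := {a : VecIdx q p // Near a.2.1 a.1.1}

/-- `E₁ ξ₁ = vec F` for the block diagonal matrix `F` with nonzero entries `ξ₁`. -/
def E1 (q p : Fin 3 → ℕ) : Matrix (VecIdx q p) (Idx1 q p) ℝ :=
  Matrix.of fun a b => if a = b.1 then 1 else 0

/-- `E₂ ξ₂ = vec F1` for the sparse matrix `F1` with nonzero entries `ξ₂`. -/
def E2 (q p : Fin 3 → ℕ) : Matrix (VecIdx q p) (Idx2 q p) ℝ :=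
  Matrix.of fun a b => if a = b.1 then 1 else 0

/-- The index set of `ζ(k) = (ξ₁(k-1), ξ₂(k))`, `1 ≤ k < N`, and of `ζ(N) = ξ₁(N-1)`: the second
summand is empty for `k = N`. -/
abbrev ZIdx (k : ℕ) : Type := Idx1 q p ⊕ {_b : Idx2 q p // k < S.N}

/-- `diag(E₁, E₂)` for `k < N`, and `E₁` padded by zero rows for `k = N`. -/
def E (k : ℕ) : Matrix (VecIdx q p ⊕ VecIdx q p) (S.ZIdx k) ℝ :=
  Matrix.fromBlocks (E1 q p) 0 0 ((E2 q p).submatrix id Subtype.val)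

/-- The block row `[I 0]`. -/
def rowI (q p : Fin 3 → ℕ) : Matrix (VecIdx q p) (VecIdx q p ⊕ VecIdx q p) ℝ :=
  Matrix.fromCols 1 0

/-- The block row `[-I ⊗ L(k)B  I]`. -/
def rowM (k : ℕ) : Matrix (VecIdx q p) (VecIdx q p ⊕ VecIdx q p) ℝ :=
  Matrix.fromCols (-((1 : Matrix (Blk p) (Blk p) ℝ) ⊗ₖ (S.L k * S.B))) 1

/-- `Z₁(k)`, `1 ≤ k ≤ N`. -/
def Z1 (k : ℕ) : Matrix (S.ZIdx k) (S.ZIdx k) ℝ :=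
  if k < S.N then
    (S.E k)ᵀ * (Matrix.fromRows (rowI q p) (S.rowM k))ᵀ
      * Matrix.fromBlocks (S.Y1t (k - 1) ⊗ₖ S.H (k - 1)) 0 0 (S.Yt (k - 1) ⊗ₖ S.H k)
      * Matrix.fromRows (rowI q p) (S.rowM k) * S.E k
  else
    (S.E k)ᵀ * (rowI q p)ᵀ * (S.Y1t (k - 1) ⊗ₖ S.H (k - 1)) * rowI q p * S.E k

/-- `Z₂(k)`, `1 ≤ k < N`. -/
def Z2 (k : ℕ) : Matrix (S.ZIdx k) (S.ZIdx (k + 1)) ℝ :=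
  (S.E k)ᵀ * (S.rowM k)ᵀ * (((S.Pt k)ᵀ * S.Cᵀ) ⊗ₖ S.H k) * rowI q p * S.E (k + 1)

/-- `b(k)`, `1 ≤ k ≤ N`. For `k = 1` the term with `Pt (k - 1)` vanishes. -/
def b (k : ℕ) : S.ZIdx k → ℝ :=
  ((S.E k)ᵀ * (rowI q p)ᵀ) *ᵥ
    (((S.C * S.P1 (k - 1)) ⊗ₖ S.H (k - 1)) *ᵥ (S.L (k - 1)).vec
      + ((S.C * S.Pt (k - 1)) ⊗ₖ S.H (k - 1)) *ᵥ (S.L (k - 1) * S.K1 (k - 2)).vec)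
  + if k < S.N then
      ((S.E k)ᵀ * (S.rowM k)ᵀ) *ᵥ
        ((S.Yt (k - 1) ⊗ₖ S.H k) *ᵥ (S.L k * S.K1 (k - 1)).vec
          + ((S.Pt k)ᵀ ⊗ₖ S.H k) *ᵥ (S.L k).vec)
    else 0

/-- `R(k)`, `1 ≤ k ≤ N`, with `R(N) = Z₁(N)`. -/
def R (k : ℕ) : Matrix (S.ZIdx k) (S.ZIdx k) ℝ :=
  if k < S.N then S.Z1 k - S.Z2 k * (R (k + 1))⁻¹ * (S.Z2 k)ᵀ else S.Z1 k
termination_by S.N - k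

/-- `c(k)`, `1 ≤ k ≤ N`, with `c(N) = b(N)`. -/
def c (k : ℕ) : S.ZIdx k → ℝ :=
  if k < S.N then S.b k - (S.Z2 k * (S.R (k + 1))⁻¹) *ᵥ c (k + 1) else S.b k
termination_by S.N - k

/-- `ζ(k)`, `1 ≤ k ≤ N` (the value at `0` is not used). -/
def zeta : (k : ℕ) → S.ZIdx k → ℝ
  | 0 => 0
  | 1 => (S.R 1)⁻¹ *ᵥ S.c 1
  | k + 2 => -((S.R (k + 2))⁻¹ *ᵥ ((S.Z2 (k + 1))ᵀ *ᵥ zeta (k + 1) - S.c (k + 2)))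

/-- The gain `F(k)`, `0 ≤ k < N`: `vec F(k) = E₁ ξ₁(k)`, the first part of `E ζ(k+1)`. -/
def F (k : ℕ) : Matrix (Blk q) (Blk p) ℝ :=
  Matrix.of fun r s => (S.E (k + 1) *ᵥ S.zeta (k + 1)) (.inl (s, r))

/-- The gain `F^{[1]}(k)`, `1 ≤ k < N`: `vec F1(k) = E₂ ξ₂(k)`, the second part of `E ζ(k)`. -/
def F1 (k : ℕ) : Matrix (Blk q) (Blk p) ℝ :=
  Matrix.of fun r s => (S.E k *ᵥ S.zeta k) (.inr (s, r))

/-! ### The estimator iterations, driven by inputs and outputs -/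

variable {Ω : Type*} (u : ℕ → Ω → Blk q → ℝ) (y : ℕ → Ω → Blk p → ℝ)

/-- The one-step prediction `x̂(k|k-1)`. -/
def xPred : ℕ → Ω → Blk n → ℝ
  | 0, _ => 0
  | k + 1, ω => S.A *ᵥ xPred k ω + S.B *ᵥ u k ω + S.K k *ᵥ (y k ω - S.C *ᵥ xPred k ω)

/-- The innovation `y(k) - C x̂(k|k-1)`. -/
def innov (k : ℕ) (ω : Ω) : Blk p → ℝ := y k ω - S.C *ᵥ S.xPred u y k ω

/-- The previous innovation `y(k-1) - C x̂(k-1|k-2)`, absent (zero) for `k = 0`. -/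
def prevInnov : ℕ → Ω → Blk p → ℝ
  | 0, _ => 0
  | k + 1, ω => S.innov u y k ω

/-- The local estimate `x̂^{[1]}(k)`. -/
def xLoc : ℕ → Ω → Blk n → ℝ
  | 0, _ => 0
  | k + 1, ω => S.A *ᵥ S.xPred u y k ω + S.B *ᵥ u k ω + S.K1 k *ᵥ S.innov u y k ω

/-- The local innovation `y(k) - C x̂^{[1]}(k)`. -/
def innovLoc (k : ℕ) (ω : Ω) : Blk p → ℝ := y k ω - S.C *ᵥ S.xLoc u y k ω

/-- The recursive expression for the two-step estimate `x̂(k)` (zero for `k = 0`). -/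
def xTwo : ℕ → Ω → Blk n → ℝ
  | 0, _ => 0
  | k + 1, ω => S.xLoc u y (k + 1) ω - (S.B * S.F k + S.K1 k) *ᵥ S.innov u y k ω

end ThreePlayer

end

/-! All runs share the same estimation errors. Inputs enter the state and the estimates alike, so
the prediction error, the innovations and the local errors are fixed linear functions of the noise
(`IsRun.x_eq_xPred_add`, `IsRun.x_eq_xLoc_add`). Hence the proposed law, evaluated along any run,
differs from `L x` by a fixed Gaussian vector, the `gap` (`IsRun.law_sub_eq_gap`), and the optimal
run can be written down from the noise as `u = L x + gap`.

Let δx, δu be the deviations of another run from this one. The cost is a convex quadratic, so the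
point is that its first variation vanishes. By completion of squares (`stage_completion`), the cross
term is the sum of E gap(k)ᵀ H(k) (δu(k) - L(k) δx(k)), plus terms in w(k) that vanish because w(k)
is independent of the uncontrolled outputs up to k. Since gap(k+1) is orthogonal to functions of
these outputs up to k-1, and δx(k) is one, only the part B δu(k) of δx(k+1) counts. Regrouping
leaves the sum of E costate(k)ᵀ δu(k), with costate(k) = H(k) gap(k) - (L(k+1)B)ᵀ H(k+1) gap(k+1),
the last term being absent at the final stage.

Information travels as fast as the dynamics (partial nestedness). So δu_i(k) is a Borel function of
the outputs of the uncontrolled system in I_i(k) (`IsControlled.sigmaOf_info_le_free`). Those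
outputs are linear in three groups: the innovations up to k-2, the innovations of the near players
at k-1, and the own local innovation at k (`observe_info_free_mem`). Player i's costate is
uncorrelated with the first group because innovations are white, and with the other two by the block
tridiagonal equations that ζ solves (`H_mul_gapPrev_apply`, `H_mul_gapLoc_apply`). Gaussianity turns
this into orthogonality to all Borel functions. The elimination that produces ζ is legitimate
because all pivots R(k) are positive definite (`R_posDef_and_le`).

What remains is the excess cost, the sum of E (δu - L δx)ᵀ H (δu - L δx)
(`IsNoise.integral_pathCost_eq`). It is nonnegative. If it is zero, then δu = L δx almost surely,
and δx(0) = 0 forces both deviations to vanish step by step, which gives uniqueness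
(`IsNoise.isOptimal_iff`). -/

section RealMatrices

/-! ### Real quadratic forms and Schur complements. -/

variable {α β γ : Type*} [Fintype α] [Fintype β] [Fintype γ]

theorem dotProduct_transpose_mulVec' (M : Matrix α β ℝ) (a : β → ℝ) (b : α → ℝ) :
    a ⬝ᵥ Mᵀ *ᵥ b = (M *ᵥ a) ⬝ᵥ b := by
  rw [dotProduct_mulVec, vecMul_transpose]

omit [Fintype α] in
theorem Matrix.PosSemidef.transpose_eq {M : Matrix α α ℝ} (hM : M.PosSemidef) : Mᵀ = M := by
  simpa [conjTranspose_eq_transpose_of_trivial] using hM.isHermitian.eq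

omit [Fintype α] in
theorem Matrix.PosDef.transpose_eq {M : Matrix α α ℝ} (hM : M.PosDef) : Mᵀ = M :=
  hM.posSemidef.transpose_eq

theorem Matrix.PosSemidef.dotProduct_nonneg {M : Matrix α α ℝ} (hM : M.PosSemidef) (x : α → ℝ) :
    0 ≤ x ⬝ᵥ M *ᵥ x := by
  simpa using hM.dotProduct_mulVec_nonneg x

theorem Matrix.PosDef.dotProduct_pos {M : Matrix α α ℝ} (hM : M.PosDef) {x : α → ℝ} (hx : x ≠ 0) :
    0 < x ⬝ᵥ M *ᵥ x := by
  simpa using hM.dotProduct_mulVec_pos hx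

theorem Matrix.PosSemidef.of_transpose_eq {M : Matrix α α ℝ} (hs : Mᵀ = M)
    (h : ∀ x, 0 ≤ x ⬝ᵥ M *ᵥ x) : M.PosSemidef :=
  .of_dotProduct_mulVec_nonneg (by
    rw [IsHermitian, conjTranspose_eq_transpose_of_trivial, hs]) (by simpa using h)

theorem Matrix.PosDef.of_transpose_eq {M : Matrix α α ℝ} (hs : Mᵀ = M)
    (h : ∀ x ≠ 0, 0 < x ⬝ᵥ M *ᵥ x) : M.PosDef :=
  .of_dotProduct_mulVec_pos (by
    rw [IsHermitian, conjTranspose_eq_transpose_of_trivial, hs])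
    (fun x hx => by simpa using h x hx)

theorem Matrix.PosSemidef.mul_mul_transpose {M : Matrix α α ℝ} (hM : M.PosSemidef)
    (T : Matrix β α ℝ) : (T * M * Tᵀ).PosSemidef := by
  simpa [conjTranspose_eq_transpose_of_trivial] using hM.mul_mul_conjTranspose_same T

theorem Matrix.PosDef.inv_mul_cancel [DecidableEq α] {M : Matrix α α ℝ} (hM : M.PosDef) :
    M⁻¹ * M = 1 :=
  nonsing_inv_mul _ ((Matrix.isUnit_iff_isUnit_det _).1 hM.isUnit)

theorem Matrix.PosDef.mul_inv_cancel [DecidableEq α] {M : Matrix α α ℝ} (hM : M.PosDef) :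
    M * M⁻¹ = 1 :=
  mul_nonsing_inv _ ((Matrix.isUnit_iff_isUnit_det _).1 hM.isUnit)

theorem Matrix.PosDef.mulVec_inv_mulVec [DecidableEq α] {M : Matrix α α ℝ} (hM : M.PosDef)
    (x : α → ℝ) : M *ᵥ (M⁻¹ *ᵥ x) = x := by
  rw [mulVec_mulVec, hM.mul_inv_cancel, one_mulVec]

theorem Matrix.PosDef.transpose_inv [DecidableEq α] {M : Matrix α α ℝ} (hM : M.PosDef) :
    (M⁻¹)ᵀ = M⁻¹ := by
  rw [transpose_nonsing_inv, hM.transpose_eq]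

/-- The elimination of the last variable `z` from a quadratic form with the coupling `Mᵀ Y T U`
leaves a form that is at least the one with the Schur complement of the lower bound of `R`. -/
theorem schur_elimination_le [DecidableEq β] {R : Matrix β β ℝ} (hR : R.PosDef)
    (U : Matrix γ β ℝ) (M : Matrix γ α ℝ) (T Y Y0 : Matrix γ γ ℝ) (hY : Y.PosDef)
    (hle : ∀ z, (U *ᵥ z) ⬝ᵥ (Y0 + Tᵀ * Y * T) *ᵥ (U *ᵥ z) ≤ z ⬝ᵥ R *ᵥ z) (ζ : α → ℝ) :
    ∃ f, (M *ᵥ ζ + T *ᵥ f) ⬝ᵥ Y *ᵥ (M *ᵥ ζ + T *ᵥ f) + f ⬝ᵥ Y0 *ᵥ f ≤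
      ζ ⬝ᵥ (Mᵀ * Y * M - (Mᵀ * (Y * T) * U) * R⁻¹ * (Mᵀ * (Y * T) * U)ᵀ) *ᵥ ζ := by
  set m := M *ᵥ ζ with hm
  set a : β → ℝ := (Mᵀ * (Y * T) * U)ᵀ *ᵥ ζ with ha
  -- This is the minimizer of zᵀRz + 2aᵀz, with minimum -aᵀR⁻¹a. Expanding the left side at f = Uz
  -- produces this form with Y0 + TᵀYT in place of R, which `hle` bounds.
  set z := -(R⁻¹ *ᵥ a) with hz
  refine ⟨U *ᵥ z, ?_⟩
  have h1 : z ⬝ᵥ R *ᵥ z = a ⬝ᵥ R⁻¹ *ᵥ a := by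
    rw [hz, mulVec_neg, hR.mulVec_inv_mulVec, neg_dotProduct_neg, dotProduct_comm]
  have h2 : m ⬝ᵥ Y *ᵥ (T *ᵥ (U *ᵥ z)) = -(a ⬝ᵥ R⁻¹ *ᵥ a) := by
    have : m ⬝ᵥ Y *ᵥ (T *ᵥ (U *ᵥ z)) = a ⬝ᵥ z := by
      rw [ha, dotProduct_comm _ z, dotProduct_transpose_mulVec', dotProduct_comm _ ζ, hm,
        ← dotProduct_transpose_mulVec']
      simp only [mulVec_mulVec, Matrix.mul_assoc]
    rw [this, hz, dotProduct_neg]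
  have h3 : (T *ᵥ (U *ᵥ z)) ⬝ᵥ Y *ᵥ m = m ⬝ᵥ Y *ᵥ (T *ᵥ (U *ᵥ z)) := by
    conv_lhs => rw [dotProduct_comm, ← hY.transpose_eq, ← dotProduct_transpose_mulVec', transpose_transpose]
  have h4 := hle z
  rw [h1, add_mulVec, dotProduct_add, Matrix.mul_assoc, ← mulVec_mulVec,
    dotProduct_transpose_mulVec', ← mulVec_mulVec] at h4
  have h5 : ζ ⬝ᵥ (Mᵀ * Y * M - (Mᵀ * (Y * T) * U) * R⁻¹ * (Mᵀ * (Y * T) * U)ᵀ) *ᵥ ζ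
      = m ⬝ᵥ Y *ᵥ m - a ⬝ᵥ R⁻¹ *ᵥ a := by
    rw [sub_mulVec, dotProduct_sub]
    congr 1
    · rw [hm, ← dotProduct_transpose_mulVec']
      simp only [mulVec_mulVec, Matrix.mul_assoc]
    · conv_rhs => rw [ha, ← dotProduct_transpose_mulVec', transpose_transpose]
      simp only [mulVec_mulVec, Matrix.mul_assoc]
  rw [h5]
  simp only [mulVec_add, dotProduct_add, add_dotProduct]
  rw [h3, h2]
  linarith

end RealMatrices

/-! ### The Riccati recursion and completion of squares. -/

namespace ThreePlayer

variable {n q p : Fin 3 → ℕ} (S : ThreePlayer n q p)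

theorem Q_eq_fromBlocks (hQ : S.Q.PosSemidef) : S.Q = fromBlocks S.Qxx S.Qxu S.Qxuᵀ S.Quu := by
  conv_lhs => rw [← fromBlocks_toBlocks S.Q]
  have := hQ.transpose_eq
  congr 1
  ext i j
  exact congrFun (congrFun this.symm (.inr i)) (.inl j)

theorem H_posDef_of_ric (hQuu : S.Quu.PosDef) {k : ℕ} (h : (S.Ric (k + 1)).PosSemidef) :
    (S.H k).PosDef := by
  have := h.mul_mul_transpose S.Bᵀ
  rw [transpose_transpose] at this
  rw [H]
  exact hQuu.posSemidef_add this

/-- The Riccati step is the Schur complement of `H k` in the positive semidefinite matrix Q + [A B]ᵀ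
S(k+1) [A B]. -/
theorem ric_posSemidef (hQ0 : S.Q0.PosSemidef) (hQ : S.Q.PosSemidef) (hQuu : S.Quu.PosDef)
    (k : ℕ) : (S.Ric k).PosSemidef := by
  by_cases hk : k < S.N
  · have ih := ric_posSemidef hQ0 hQ hQuu (k + 1)
    have hH := S.H_posDef_of_ric hQuu ih
    have hM : (S.Q + fromRows S.Aᵀ S.Bᵀ * S.Ric (k + 1) * (fromRows S.Aᵀ S.Bᵀ)ᵀ).PosSemidef :=
      hQ.add (ih.mul_mul_transpose _)
    have heq : S.Q + fromRows S.Aᵀ S.Bᵀ * S.Ric (k + 1) * (fromRows S.Aᵀ S.Bᵀ)ᵀ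
        = fromBlocks (S.Aᵀ * S.Ric (k + 1) * S.A + S.Qxx) (S.Aᵀ * S.Ric (k + 1) * S.B + S.Qxu)
          (S.Aᵀ * S.Ric (k + 1) * S.B + S.Qxu)ᴴ (S.H k) := by
      rw [S.Q_eq_fromBlocks hQ, transpose_fromRows, fromRows_mul, fromRows_mul_fromCols,
        fromBlocks_add, conjTranspose_eq_transpose_of_trivial]
      simp only [transpose_add, transpose_mul, transpose_transpose, ih.transpose_eq, H,
        Matrix.mul_assoc, add_comm]
    rw [heq] at hM
    let := hH.isUnit.invertible
    have h2 := (PosDef.fromBlocks₂₂ _ _ hH).1 hM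
    have h3 : S.Ric k = S.Aᵀ * S.Ric (k + 1) * S.A + S.Qxx -
        (S.Aᵀ * S.Ric (k + 1) * S.B + S.Qxu) * (S.H k)⁻¹ *
          (S.Aᵀ * S.Ric (k + 1) * S.B + S.Qxu)ᴴ := by
      rw [Ric, if_pos hk, conjTranspose_eq_transpose_of_trivial]
      simp only [transpose_add, transpose_mul, transpose_transpose, ih.transpose_eq, H,
        Matrix.mul_assoc]
    rw [h3]
    exact h2
  · rw [Ric, if_neg hk]
    exact hQ0
termination_by S.N - k

theorem H_posDef (hQ0 : S.Q0.PosSemidef) (hQ : S.Q.PosSemidef) (hQuu : S.Quu.PosDef) (k : ℕ) :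
    (S.H k).PosDef :=
  S.H_posDef_of_ric hQuu (S.ric_posSemidef hQ0 hQ hQuu _)

/-- Completion of squares, for the bilinear form of the stage cost. -/
theorem stage_completion (hQ0 : S.Q0.PosSemidef) (hQ : S.Q.PosSemidef) (hQuu : S.Quu.PosDef)
    {k : ℕ} (hk : k < S.N) (x x' : Blk n → ℝ) (u u' : Blk q → ℝ) :
    Sum.elim x u ⬝ᵥ S.Q *ᵥ Sum.elim x' u'
        + (S.A *ᵥ x + S.B *ᵥ u) ⬝ᵥ S.Ric (k + 1) *ᵥ (S.A *ᵥ x' + S.B *ᵥ u')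
      = x ⬝ᵥ S.Ric k *ᵥ x' + (u - S.L k *ᵥ x) ⬝ᵥ S.H k *ᵥ (u' - S.L k *ᵥ x') := by
  have hH := S.H_posDef hQ0 hQ hQuu k
  have hR := (S.ric_posSemidef hQ0 hQ hQuu (k + 1)).transpose_eq
  set G := S.Bᵀ * S.Ric (k + 1) * S.A + S.Qxuᵀ with hG
  have hGt : Gᵀ = S.Aᵀ * S.Ric (k + 1) * S.B + S.Qxu := by
    rw [hG]
    simp only [transpose_add, transpose_mul, transpose_transpose, hR, Matrix.mul_assoc]
  have hL : S.L k = -((S.H k)⁻¹ * G) := rfl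
  have hRic : S.Ric k = S.Aᵀ * S.Ric (k + 1) * S.A + S.Qxx - Gᵀ * (S.H k)⁻¹ * G := by
    rw [hGt, Ric, if_pos hk]; rfl
  have hHL : S.H k * S.L k = -G := by
    rw [hL, Matrix.mul_neg, ← Matrix.mul_assoc, hH.mul_inv_cancel, Matrix.one_mul]
  have hLH : (S.L k)ᵀ * S.H k = -Gᵀ := by
    rw [← hH.transpose_eq, ← transpose_mul, hHL, transpose_neg]
  have e1 : (u - S.L k *ᵥ x) ⬝ᵥ S.H k *ᵥ (u' - S.L k *ᵥ x')
      = u ⬝ᵥ S.H k *ᵥ u' + u ⬝ᵥ G *ᵥ x' + x ⬝ᵥ Gᵀ *ᵥ u' + x ⬝ᵥ (Gᵀ * (S.H k)⁻¹ * G) *ᵥ x' := by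
    have h1 : (S.L k *ᵥ x) ⬝ᵥ S.H k *ᵥ u' = -(x ⬝ᵥ Gᵀ *ᵥ u') := by
      rw [← dotProduct_transpose_mulVec', mulVec_mulVec, hLH, neg_mulVec, dotProduct_neg]
    have h2 : (S.L k *ᵥ x) ⬝ᵥ S.H k *ᵥ (S.L k *ᵥ x') = x ⬝ᵥ (Gᵀ * (S.H k)⁻¹ * G) *ᵥ x' := by
      rw [← dotProduct_transpose_mulVec', mulVec_mulVec, mulVec_mulVec, hLH, hL, Matrix.neg_mul,
        Matrix.mul_neg, neg_neg, Matrix.mul_assoc]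
    have h3 : u ⬝ᵥ S.H k *ᵥ (S.L k *ᵥ x') = -(u ⬝ᵥ G *ᵥ x') := by
      rw [mulVec_mulVec, hHL, neg_mulVec, dotProduct_neg]
    simp only [mulVec_sub, dotProduct_sub, sub_dotProduct, h1, h2, h3]
    ring
  rw [e1, hRic, hGt, hG, S.Q_eq_fromBlocks hQ, fromBlocks_mulVec, sumElim_dotProduct_sumElim]
  simp only [H, add_mulVec, sub_mulVec, dotProduct_add, dotProduct_sub, add_dotProduct, mulVec_add,
    Sum.elim_comp_inl, Sum.elim_comp_inr, Matrix.mul_assoc, ← mulVec_mulVec,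
    dotProduct_transpose_mulVec']
  ring

end ThreePlayer

/-! ### The gain recursion: sparsity and positive definite pivots. -/

namespace ThreePlayer

variable {n q p : Fin 3 → ℕ} (S : ThreePlayer n q p)

theorem kronecker_transpose {α β γ δ : Type*} (M : Matrix α β ℝ) (M' : Matrix γ δ ℝ) :
    (M ⊗ₖ M')ᵀ = Mᵀ ⊗ₖ M'ᵀ :=
  (kroneckerMap_transpose _ _ _).symm

theorem E1_transpose_mulVec (a : VecIdx q p → ℝ) (b : Idx1 q p) :
    ((E1 q p)ᵀ *ᵥ a) b = a b.1 := by
  simp [E1, mulVec, dotProduct]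

theorem E2_transpose_mulVec (a : VecIdx q p → ℝ) (b : Idx2 q p) :
    ((E2 q p)ᵀ *ᵥ a) b = a b.1 := by
  simp [E2, mulVec, dotProduct]

theorem E_transpose_mulVec_inl (k : ℕ) (a : VecIdx q p ⊕ VecIdx q p → ℝ) (b : Idx1 q p) :
    ((S.E k)ᵀ *ᵥ a) (.inl b) = a (.inl b.1) := by
  rw [E, fromBlocks_transpose, fromBlocks_mulVec]
  simp [E1_transpose_mulVec]

theorem E_transpose_mulVec_inr (k : ℕ) (a : VecIdx q p ⊕ VecIdx q p → ℝ)
    (b : {_b : Idx2 q p // k < S.N}) :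
    ((S.E k)ᵀ *ᵥ a) (.inr b) = a (.inr b.1.1) := by
  rw [E, fromBlocks_transpose, fromBlocks_mulVec]
  simp only [transpose_zero, zero_mulVec, zero_add, Sum.elim_inr]
  exact E2_transpose_mulVec _ b.1

theorem E_transpose_mul_E (k : ℕ) : (S.E k)ᵀ * S.E k = 1 := by
  ext a b
  have : ((S.E k)ᵀ * S.E k) a b = ((S.E k)ᵀ *ᵥ fun r => S.E k r b) a := by
    simp [mul_apply, mulVec, dotProduct]
  rw [this]
  rcases a with a | a
  · rw [E_transpose_mulVec_inl]
    rcases b with b | b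
    · simp [E, E1, one_apply, Subtype.ext_iff]
    · simp [E]
  · rw [E_transpose_mulVec_inr]
    rcases b with b | b
    · simp [E]
    · simp [E, E2, one_apply, Subtype.ext_iff]

theorem E_mulVec_injective (k : ℕ) {ζ : S.ZIdx k → ℝ} (h : S.E k *ᵥ ζ = 0) : ζ = 0 := by
  have : (S.E k)ᵀ *ᵥ (S.E k *ᵥ ζ) = 0 := by rw [h, mulVec_zero]
  rwa [mulVec_mulVec, E_transpose_mul_E, one_mulVec] at this

theorem E_mulVec_inr_eq_zero {k : ℕ} (hk : ¬ k < S.N) (ζ : S.ZIdx k → ℝ) (a : VecIdx q p) :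
    (S.E k *ᵥ ζ) (.inr a) = 0 := by
  have : IsEmpty {_b : Idx2 q p // k < S.N} := ⟨fun b => hk b.2⟩
  rw [E, fromBlocks_mulVec]
  simp [mulVec, dotProduct]

theorem rowI_mulVec (a : VecIdx q p ⊕ VecIdx q p → ℝ) (r) : (rowI q p *ᵥ a) r = a (.inl r) := by
  rw [rowI, fromCols_mulVec]; simp

theorem rowM_mulVec (k : ℕ) (a : VecIdx q p ⊕ VecIdx q p → ℝ) (r) :
    (S.rowM k *ᵥ a) r = a (.inr r)
      - (((1 : Matrix (Blk p) (Blk p) ℝ) ⊗ₖ (S.L k * S.B)) *ᵥ (a ∘ Sum.inl)) r := by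
  rw [rowM, fromCols_mulVec]; simp [neg_mulVec, sub_eq_neg_add]

theorem F_apply_eq_zero (k : ℕ) {r : Blk q} {s : Blk p} (h : s.1 ≠ r.1) : S.F k r s = 0 := by
  rw [F, of_apply, E, fromBlocks_mulVec]
  simp only [zero_mulVec, add_zero, Sum.elim_inl, mulVec, dotProduct, E1, of_apply]
  refine Finset.sum_eq_zero fun b _ => ?_
  rw [if_neg, zero_mul]
  rintro hb
  exact h (by simpa [← hb] using b.2)

theorem F1_apply_eq_zero (k : ℕ) {r : Blk q} {s : Blk p} (h : ¬ Near r.1 s.1) :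
    S.F1 k r s = 0 := by
  rw [F1, of_apply, E, fromBlocks_mulVec]
  simp only [zero_mulVec, zero_add, Sum.elim_inr, mulVec, dotProduct, E2, of_apply, submatrix_apply]
  refine Finset.sum_eq_zero fun b _ => ?_
  rw [if_neg, zero_mul]
  rintro hb
  exact h (by simpa [← hb] using b.1.2)

theorem vec_F (k : ℕ) : (S.F k).vec = rowI q p *ᵥ (S.E (k + 1) *ᵥ S.zeta (k + 1)) := by
  ext ⟨s, r⟩
  rw [rowI_mulVec]; rfl

/-- This is what the row M is for: up to the term -L K1, the matrix on the left is the coefficient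
of the previous innovation in `gap`. -/
theorem vec_F1_sub (k : ℕ) : (S.F1 (k + 1) - S.L (k + 1) * S.B * S.F k).vec =
    S.rowM (k + 1) *ᵥ (S.E (k + 1) *ᵥ S.zeta (k + 1)) := by
  ext r
  rw [rowM_mulVec, vec_sub, Pi.sub_apply, vec_mul_eq_mulVec]
  rfl

theorem P1_transpose (hYt : ∀ k, (S.Yt k).PosDef) (hP : ∀ k, (S.P k)ᵀ = S.P k) (k : ℕ) :
    (S.P1 k)ᵀ = S.P1 k := by
  cases k with
  | zero => exact hP 0
  | succ k =>
    rw [P1, transpose_add, hP, transpose_mul, transpose_mul, (hYt k).transpose_eq,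
      transpose_transpose, Matrix.mul_assoc]

/-- The local innovation is the innovation plus C(K - K1) times the previous innovation, and these
two are uncorrelated. The splitting supplies the two weights needed for the Schur elimination. -/
theorem Y1t_eq (k : ℕ) : S.Y1t (k + 1) = S.Yt (k + 1)
    + (S.C * (S.K k - S.K1 k)) * S.Yt k * (S.C * (S.K k - S.K1 k))ᵀ := by
  rw [Y1t, P1, Yt.eq_1 S (k + 1), transpose_mul]
  simp only [Matrix.mul_add, Matrix.add_mul, Matrix.mul_assoc]
  abel

theorem Y1t_posDef (hYt : ∀ k, (S.Yt k).PosDef) (k : ℕ) : (S.Y1t k).PosDef := by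
  cases k with
  | zero => exact hYt 0
  | succ k =>
    rw [Y1t_eq]
    exact (hYt _).add_posSemidef ((hYt k).posSemidef.mul_mul_transpose _)

theorem R_of_lt {k : ℕ} (hk : k < S.N) :
    S.R k = S.Z1 k - S.Z2 k * (S.R (k + 1))⁻¹ * (S.Z2 k)ᵀ := by
  rw [R, if_pos hk]

theorem c_of_lt {k : ℕ} (hk : k < S.N) :
    S.c k = S.b k - (S.Z2 k * (S.R (k + 1))⁻¹) *ᵥ S.c (k + 1) := by
  rw [c, if_pos hk]

theorem Z1_of_lt {k : ℕ} (hk : k < S.N) : S.Z1 k =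
    (rowI q p * S.E k)ᵀ * (S.Y1t (k - 1) ⊗ₖ S.H (k - 1)) * (rowI q p * S.E k)
      + (S.rowM k * S.E k)ᵀ * (S.Yt (k - 1) ⊗ₖ S.H k) * (S.rowM k * S.E k) := by
  rw [Z1, if_pos hk, transpose_mul, transpose_mul]
  simp only [Matrix.mul_assoc]
  rw [← Matrix.mul_add]
  congr 1
  rw [transpose_fromRows, ← Matrix.mul_assoc (fromBlocks _ _ _ _), fromBlocks_mul_fromRows]
  simp only [Matrix.zero_mul, add_zero, zero_add]
  rw [fromRows_mul, fromCols_mul_fromRows]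
  simp only [Matrix.mul_assoc]

theorem Z1_of_not_lt {k : ℕ} (hk : ¬ k < S.N) : S.Z1 k =
    (rowI q p * S.E k)ᵀ * (S.Y1t (k - 1) ⊗ₖ S.H (k - 1)) * (rowI q p * S.E k) := by
  rw [Z1, if_neg hk, transpose_mul]
  simp only [Matrix.mul_assoc]

theorem dotProduct_transpose_mul_mul_mulVec {α β : Type*} [Fintype α] [Fintype β]
    (M : Matrix α β ℝ) (Y : Matrix α α ℝ) (z : β → ℝ) :
    z ⬝ᵥ (Mᵀ * Y * M) *ᵥ z = (M *ᵥ z) ⬝ᵥ Y *ᵥ (M *ᵥ z) := by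
  rw [← dotProduct_transpose_mulVec', Matrix.mul_assoc, mulVec_mulVec, mulVec_mulVec,
    Matrix.mul_assoc]

/-- The lower bound is what makes the backward induction close: R(k+2) dominates the weight Y1t ⊗ H
on the F-part of ζ(k+2). By `Y1t_eq` this weight is Y0 + TᵀYT, while the coupling Z2 is (M E)ᵀ Y T
(U E). Minimizing over ζ(k+2) therefore costs at most the completed square, and R(k+1) keeps its own
Y1t ⊗ H term plus something nonnegative. -/
theorem R_posDef_and_le (hYt : ∀ k, (S.Yt k).PosDef) (hH : ∀ k, (S.H k).PosDef) (k : ℕ)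
    (hk : 1 ≤ k) : (S.R k).PosDef ∧ ∀ z, ((rowI q p * S.E k) *ᵥ z) ⬝ᵥ
      (S.Y1t (k - 1) ⊗ₖ S.H (k - 1)) *ᵥ ((rowI q p * S.E k) *ᵥ z) ≤ z ⬝ᵥ S.R k *ᵥ z := by
  obtain ⟨k, rfl⟩ := Nat.exists_eq_add_of_le' hk
  have hY1 : (S.Y1t k ⊗ₖ S.H k).PosDef := (S.Y1t_posDef hYt k).kronecker (hH k)
  by_cases hlt : k + 1 < S.N
  · obtain ⟨hR, hle⟩ := R_posDef_and_le hYt hH (k + 2) (by omega)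
    set T : Matrix (VecIdx q p) (VecIdx q p) ℝ := (S.C * (S.K k - S.K1 k))ᵀ ⊗ₖ 1 with hT
    have hY : (S.Yt k ⊗ₖ S.H (k + 1)).PosDef := (hYt k).kronecker (hH (k + 1))
    have hY0 : (S.Yt (k + 1) ⊗ₖ S.H (k + 1)).PosDef := (hYt _).kronecker (hH (k + 1))
    have hX : ((S.Pt (k + 1))ᵀ * S.Cᵀ) ⊗ₖ S.H (k + 1) = (S.Yt k ⊗ₖ S.H (k + 1)) * T := by
      rw [hT, ← mul_kronecker_mul, Matrix.mul_one, Pt, transpose_mul, transpose_mul,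
        (hYt k).transpose_eq, Matrix.mul_assoc]
    have hYs : S.Y1t (k + 1) ⊗ₖ S.H (k + 1) = S.Yt (k + 1) ⊗ₖ S.H (k + 1)
        + Tᵀ * (S.Yt k ⊗ₖ S.H (k + 1)) * T := by
      rw [hT, kronecker_transpose, ← mul_kronecker_mul, ← mul_kronecker_mul, Matrix.mul_one,
        transpose_one, Matrix.one_mul, transpose_transpose, ← add_kronecker, Y1t_eq]
    have hZ2 : S.Z2 (k + 1) = (S.rowM (k + 1) * S.E (k + 1))ᵀ
        * ((S.Yt k ⊗ₖ S.H (k + 1)) * T) * (rowI q p * S.E (k + 2)) := by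
      rw [Z2, hX, transpose_mul]
      simp only [Matrix.mul_assoc]
    have hle' : ∀ z, ((rowI q p * S.E (k + 2)) *ᵥ z) ⬝ᵥ (S.Yt (k + 1) ⊗ₖ S.H (k + 1)
        + Tᵀ * (S.Yt k ⊗ₖ S.H (k + 1)) * T) *ᵥ ((rowI q p * S.E (k + 2)) *ᵥ z)
        ≤ z ⬝ᵥ S.R (k + 2) *ᵥ z := by
      rw [← hYs]
      exact hle
    have key := fun ζ => schur_elimination_le hR (rowI q p * S.E (k + 2))
      (S.rowM (k + 1) * S.E (k + 1)) T _ _ hY hle' ζ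
    have hform : S.R (k + 1) = (rowI q p * S.E (k + 1))ᵀ * (S.Y1t k ⊗ₖ S.H k)
        * (rowI q p * S.E (k + 1)) + ((S.rowM (k + 1) * S.E (k + 1))ᵀ * (S.Yt k ⊗ₖ S.H (k + 1))
          * (S.rowM (k + 1) * S.E (k + 1)) - S.Z2 (k + 1) * (S.R (k + 2))⁻¹ * (S.Z2 (k + 1))ᵀ) := by
      rw [S.R_of_lt hlt, S.Z1_of_lt hlt, Nat.add_sub_cancel, add_sub_assoc]
    have hsym : (S.R (k + 1))ᵀ = S.R (k + 1) := by
      rw [hform]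
      simp only [transpose_add, transpose_sub, transpose_mul, transpose_transpose,
        hR.transpose_inv, hY1.transpose_eq, hY.transpose_eq, Matrix.mul_assoc]
    have hval : ∀ z, z ⬝ᵥ S.R (k + 1) *ᵥ z = ((rowI q p * S.E (k + 1)) *ᵥ z) ⬝ᵥ
        (S.Y1t k ⊗ₖ S.H k) *ᵥ ((rowI q p * S.E (k + 1)) *ᵥ z)
        + z ⬝ᵥ ((S.rowM (k + 1) * S.E (k + 1))ᵀ * (S.Yt k ⊗ₖ S.H (k + 1))
          * (S.rowM (k + 1) * S.E (k + 1))
            - S.Z2 (k + 1) * (S.R (k + 2))⁻¹ * (S.Z2 (k + 1))ᵀ) *ᵥ z := by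
      intro z
      rw [hform, add_mulVec, dotProduct_add, dotProduct_transpose_mul_mul_mulVec]
    rw [← hZ2] at key
    constructor
    · refine .of_transpose_eq hsym fun z hz => ?_
      rw [hval]
      obtain ⟨f, hf⟩ := key z
      have n1 := hY1.posSemidef.dotProduct_nonneg ((rowI q p * S.E (k + 1)) *ᵥ z)
      have n2 := hY.posSemidef.dotProduct_nonneg ((S.rowM (k + 1) * S.E (k + 1)) *ᵥ z + T *ᵥ f)
      have n3 := hY0.posSemidef.dotProduct_nonneg f
      -- The form of R(k+1) is at least the sum of three squares, in Uz, in Mz + Tf and in f. If Uz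
      -- and f vanish, then Mz + Tf reduces to the second half of E z, which is nonzero for z ≠ 0.
      by_cases h1 : (rowI q p * S.E (k + 1)) *ᵥ z = 0
      · by_cases h3 : f = 0
        · have h2 : (S.rowM (k + 1) * S.E (k + 1)) *ᵥ z + T *ᵥ f ≠ 0 := by
            rw [h3, mulVec_zero, add_zero]
            intro h2
            apply hz
            apply S.E_mulVec_injective
            rw [← mulVec_mulVec] at h1 h2
            have hl : (S.E (k + 1) *ᵥ z) ∘ Sum.inl = 0 := by
              ext r
              exact (rowI_mulVec (S.E (k + 1) *ᵥ z) r).symm.trans (congrFun h1 r)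
            ext (r | r)
            · exact congrFun hl r
            · have := congrFun h2 r
              rwa [rowM_mulVec, hl, mulVec_zero, Pi.zero_apply, sub_zero] at this
          have := hY.dotProduct_pos h2
          linarith
        · have := hY0.dotProduct_pos h3
          linarith
      · have := hY1.dotProduct_pos h1
        linarith
    · intro z
      rw [hval, Nat.add_sub_cancel]
      obtain ⟨f, hf⟩ := key z
      have n2 := hY.posSemidef.dotProduct_nonneg ((S.rowM (k + 1) * S.E (k + 1)) *ᵥ z + T *ᵥ f)
      have n3 := hY0.posSemidef.dotProduct_nonneg f
      linarith
  · have hR : S.R (k + 1) = (rowI q p * S.E (k + 1))ᵀ * (S.Y1t k ⊗ₖ S.H k)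
        * (rowI q p * S.E (k + 1)) := by
      rw [R, if_neg hlt, S.Z1_of_not_lt hlt, Nat.add_sub_cancel]
    have hval : ∀ z, z ⬝ᵥ S.R (k + 1) *ᵥ z = ((rowI q p * S.E (k + 1)) *ᵥ z) ⬝ᵥ
        (S.Y1t k ⊗ₖ S.H k) *ᵥ ((rowI q p * S.E (k + 1)) *ᵥ z) := by
      intro z
      rw [hR, dotProduct_transpose_mul_mul_mulVec]
    constructor
    · refine .of_transpose_eq ?_ fun z hz => ?_
      · rw [hR]
        simp only [transpose_mul, transpose_transpose, hY1.transpose_eq, Matrix.mul_assoc]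
      · rw [hval]
        refine hY1.dotProduct_pos fun h => hz (S.E_mulVec_injective _ ?_)
        rw [← mulVec_mulVec] at h
        ext (r | r)
        · exact (rowI_mulVec (S.E (k + 1) *ᵥ z) r).symm.trans (congrFun h r)
        · exact S.E_mulVec_inr_eq_zero hlt z r
    · intro z
      rw [hval, Nat.add_sub_cancel]
termination_by S.N - k

/-! ### The block tridiagonal system and the normal equations for the gains. -/

theorem zeta_succ (k : ℕ) : S.zeta (k + 1) =
    -((S.R (k + 1))⁻¹ *ᵥ ((S.Z2 k)ᵀ *ᵥ S.zeta k - S.c (k + 1))) := by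
  cases k with
  | zero =>
    -- The convention ζ(0) = 0 removes the meaningless `Z2 0`, so the start of the recursion needs
    -- no separate treatment later.
    have : S.zeta 0 = 0 := rfl
    rw [this, mulVec_zero, zero_sub, mulVec_neg, neg_neg]; rfl
  | succ k => rfl

theorem R_mulVec_zeta (hYt : ∀ k, (S.Yt k).PosDef) (hH : ∀ k, (S.H k).PosDef) (k : ℕ) :
    S.R (k + 1) *ᵥ S.zeta (k + 1) = S.c (k + 1) - (S.Z2 k)ᵀ *ᵥ S.zeta k := by
  rw [zeta_succ, mulVec_neg, (S.R_posDef_and_le hYt hH (k + 1) (by omega)).1.mulVec_inv_mulVec,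
    neg_sub]

/-- The block tridiagonal system solved by the gains, for an inner block row. -/
theorem tridiagonal_inner (hYt : ∀ k, (S.Yt k).PosDef) (hH : ∀ k, (S.H k).PosDef) {k : ℕ}
    (hk : k + 1 < S.N) : (S.Z2 k)ᵀ *ᵥ S.zeta k + S.Z1 (k + 1) *ᵥ S.zeta (k + 1)
      + S.Z2 (k + 1) *ᵥ S.zeta (k + 2) = S.b (k + 1) := by
  have h1 := S.R_mulVec_zeta hYt hH k
  rw [S.R_of_lt hk, S.c_of_lt hk, sub_mulVec] at h1
  have h2 : S.Z2 (k + 1) *ᵥ S.zeta (k + 2) = (S.Z2 (k + 1) * (S.R (k + 2))⁻¹) *ᵥ S.c (k + 2)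
      - (S.Z2 (k + 1) * (S.R (k + 2))⁻¹ * (S.Z2 (k + 1))ᵀ) *ᵥ S.zeta (k + 1) := by
    rw [zeta_succ, mulVec_neg]
    simp only [mulVec_sub, mulVec_mulVec, Matrix.mul_assoc]
    abel
  rw [h2]
  rw [sub_eq_iff_eq_add] at h1
  rw [h1]
  abel

/-- The block tridiagonal system solved by the gains, for the last block row. -/
theorem tridiagonal_last (hYt : ∀ k, (S.Yt k).PosDef) (hH : ∀ k, (S.H k).PosDef) {k : ℕ}
    (hk : ¬ k + 1 < S.N) :
    (S.Z2 k)ᵀ *ᵥ S.zeta k + S.Z1 (k + 1) *ᵥ S.zeta (k + 1) = S.b (k + 1) := by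
  have h1 := S.R_mulVec_zeta hYt hH k
  rw [R, if_neg hk, c, if_neg hk] at h1
  rw [h1]
  abel

/-- The gain from the previous innovation in `u - L x` (absent for `k = 0`). -/
noncomputable def Dg : ℕ → Matrix (Blk q) (Blk p) ℝ
  | 0 => 0
  | k + 1 => S.F1 (k + 1) - S.L (k + 1) * (S.B * S.F k + S.K1 k)

/-- The covariance of `u - L x` with the local innovation. -/
noncomputable def gapLoc (k : ℕ) : Matrix (Blk q) (Blk p) ℝ :=
  S.F k * S.Y1t k + S.Dg k * ((S.Pt k)ᵀ * S.Cᵀ) - S.L k * (S.P1 k * S.Cᵀ)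

/-- The covariance of `u - L x` with the previous innovation. -/
noncomputable def gapPrev : ℕ → Matrix (Blk q) (Blk p) ℝ
  | 0 => 0
  | k + 1 => S.F (k + 1) * (S.C * S.Pt (k + 1)) + S.Dg (k + 1) * S.Yt k
      - S.L (k + 1) * S.Pt (k + 1)

theorem rowI_mul_E_transpose_mulVec_inl (k : ℕ) (a : VecIdx q p → ℝ) (b : Idx1 q p) :
    ((S.E k)ᵀ *ᵥ ((rowI q p)ᵀ *ᵥ a)) (.inl b) = a b.1 := by
  rw [E_transpose_mulVec_inl, rowI, transpose_fromCols, fromRows_mulVec]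
  simp

theorem rowI_mul_E_transpose_mulVec_inr (k : ℕ) (a : VecIdx q p → ℝ)
    (b : {_b : Idx2 q p // k < S.N}) :
    ((S.E k)ᵀ *ᵥ ((rowI q p)ᵀ *ᵥ a)) (.inr b) = 0 := by
  rw [E_transpose_mulVec_inr, rowI, transpose_fromCols, fromRows_mulVec]
  simp

theorem rowM_mul_E_transpose_mulVec_inl (k l : ℕ) (a : VecIdx q p → ℝ) (b : Idx1 q p) :
    ((S.E k)ᵀ *ᵥ ((S.rowM l)ᵀ *ᵥ a)) (.inl b) =
      -(((1 : Matrix (Blk p) (Blk p) ℝ) ⊗ₖ (S.L l * S.B))ᵀ *ᵥ a) b.1 := by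
  rw [E_transpose_mulVec_inl, rowM, transpose_fromCols, fromRows_mulVec]
  simp [neg_mulVec]

theorem rowM_mul_E_transpose_mulVec_inr (k l : ℕ) (a : VecIdx q p → ℝ)
    (b : {_b : Idx2 q p // k < S.N}) :
    ((S.E k)ᵀ *ᵥ ((S.rowM l)ᵀ *ᵥ a)) (.inr b) = a b.1.1 := by
  rw [E_transpose_mulVec_inr, rowM, transpose_fromCols, fromRows_mulVec]
  simp

/-- The part of the tridiagonal system that comes from the local innovation. -/
theorem system_loc (hYt : ∀ k, (S.Yt k).PosDef) (hH : ∀ k, (S.H k).PosDef)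
    (hP : ∀ k, (S.P k)ᵀ = S.P k) (k : ℕ) :
    (S.Z2 k)ᵀ *ᵥ S.zeta k + (S.E (k + 1))ᵀ *ᵥ ((rowI q p)ᵀ *ᵥ ((S.Y1t k ⊗ₖ S.H k) *ᵥ (S.F k).vec))
      - ((S.E (k + 1))ᵀ * (rowI q p)ᵀ) *ᵥ (((S.C * S.P1 k) ⊗ₖ S.H k) *ᵥ (S.L k).vec
        + ((S.C * S.Pt k) ⊗ₖ S.H k) *ᵥ (S.L k * S.K1 (k - 1)).vec)
      = (S.E (k + 1))ᵀ *ᵥ ((rowI q p)ᵀ *ᵥ (S.H k * S.gapLoc k).vec) := by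
  have hZ : (S.Z2 k)ᵀ *ᵥ S.zeta k = (S.E (k + 1))ᵀ *ᵥ ((rowI q p)ᵀ *ᵥ
      (((S.C * S.Pt k) ⊗ₖ S.H k) *ᵥ (S.rowM k *ᵥ (S.E k *ᵥ S.zeta k)))) := by
    rw [Z2]
    simp only [transpose_mul, transpose_transpose, kronecker_transpose, (hH k).transpose_eq,
      Matrix.mul_assoc, mulVec_mulVec]
  rw [hZ, ← mulVec_mulVec (M := (S.E (k + 1))ᵀ)]
  simp only [← mulVec_add, ← mulVec_sub]
  congr 2
  cases k with
  | zero =>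
    have h0 : S.Pt 0 = 0 := rfl
    rw [h0, Matrix.mul_zero, zero_kronecker, zero_mulVec, zero_mulVec, zero_add, add_zero,
      kronecker_mulVec_vec, kronecker_mulVec_vec, ← vec_sub, gapLoc, h0]
    congr 1
    simp only [transpose_mul, (S.Y1t_posDef hYt 0).transpose_eq, S.P1_transpose hYt hP,
      transpose_zero, Matrix.zero_mul, Matrix.mul_zero, add_zero, Matrix.mul_sub, Matrix.mul_assoc]
  | succ k =>
    rw [← vec_F1_sub, kronecker_mulVec_vec, kronecker_mulVec_vec, kronecker_mulVec_vec,
      kronecker_mulVec_vec, ← vec_add, ← vec_add, ← vec_sub, gapLoc, Dg]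
    congr 1
    simp only [transpose_mul, (S.Y1t_posDef hYt _).transpose_eq, S.P1_transpose hYt hP,
      Matrix.mul_sub, Matrix.mul_add, Matrix.sub_mul, Matrix.add_mul, Matrix.mul_assoc,
      Nat.add_sub_cancel]
    abel

/-- The part of the tridiagonal system that comes from the previous innovation. -/
theorem system_prev (hYt : ∀ k, (S.Yt k).PosDef) (k : ℕ) :
    (S.E (k + 1))ᵀ *ᵥ ((S.rowM (k + 1))ᵀ *ᵥ ((S.Yt k ⊗ₖ S.H (k + 1)) *ᵥ
        (S.rowM (k + 1) *ᵥ (S.E (k + 1) *ᵥ S.zeta (k + 1)))))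
      + S.Z2 (k + 1) *ᵥ S.zeta (k + 2)
      - ((S.E (k + 1))ᵀ * (S.rowM (k + 1))ᵀ) *ᵥ
        ((S.Yt k ⊗ₖ S.H (k + 1)) *ᵥ (S.L (k + 1) * S.K1 k).vec
          + ((S.Pt (k + 1))ᵀ ⊗ₖ S.H (k + 1)) *ᵥ (S.L (k + 1)).vec)
      = (S.E (k + 1))ᵀ *ᵥ ((S.rowM (k + 1))ᵀ *ᵥ (S.H (k + 1) * S.gapPrev (k + 1)).vec) := by
  have hZ : S.Z2 (k + 1) *ᵥ S.zeta (k + 2) = (S.E (k + 1))ᵀ *ᵥ ((S.rowM (k + 1))ᵀ *ᵥ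
      ((((S.Pt (k + 1))ᵀ * S.Cᵀ) ⊗ₖ S.H (k + 1)) *ᵥ (S.F (k + 1)).vec)) := by
    rw [Z2, vec_F]
    simp only [Matrix.mul_assoc, mulVec_mulVec]
  rw [hZ, ← mulVec_mulVec (M := (S.E (k + 1))ᵀ)]
  simp only [← mulVec_add, ← mulVec_sub]
  congr 2
  rw [← vec_F1_sub, kronecker_mulVec_vec, kronecker_mulVec_vec, kronecker_mulVec_vec,
    kronecker_mulVec_vec, ← vec_add, ← vec_add, ← vec_sub, gapPrev, Dg]
  congr 1
  simp only [transpose_mul, transpose_transpose, (hYt _).transpose_eq,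
    Matrix.mul_sub, Matrix.mul_add, Matrix.sub_mul, Matrix.add_mul, Matrix.mul_assoc]
  abel

theorem Z1_mulVec_zeta_of_lt {k : ℕ} (hk : k + 1 < S.N) : S.Z1 (k + 1) *ᵥ S.zeta (k + 1) =
    (S.E (k + 1))ᵀ *ᵥ ((rowI q p)ᵀ *ᵥ ((S.Y1t k ⊗ₖ S.H k) *ᵥ (S.F k).vec))
      + (S.E (k + 1))ᵀ *ᵥ ((S.rowM (k + 1))ᵀ *ᵥ ((S.Yt k ⊗ₖ S.H (k + 1)) *ᵥ
        (S.rowM (k + 1) *ᵥ (S.E (k + 1) *ᵥ S.zeta (k + 1))))) := by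
  rw [S.Z1_of_lt hk, vec_F, add_mulVec]
  simp only [transpose_mul, Matrix.mul_assoc, mulVec_mulVec, Nat.add_sub_cancel]

/-- A block row of the tridiagonal system splits by the weights H(k) and H(k+1). Undoing the
vectorization through (A ⊗ B) vec X = vec(B X Aᵀ), the two parts are the covariances of `gap` with
the local and with the previous innovation. -/
theorem normal_equations_inner (hYt : ∀ k, (S.Yt k).PosDef) (hH : ∀ k, (S.H k).PosDef)
    (hP : ∀ k, (S.P k)ᵀ = S.P k) {k : ℕ} (hk : k + 1 < S.N) :
    (S.E (k + 1))ᵀ *ᵥ ((rowI q p)ᵀ *ᵥ (S.H k * S.gapLoc k).vec)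
      + (S.E (k + 1))ᵀ *ᵥ ((S.rowM (k + 1))ᵀ *ᵥ (S.H (k + 1) * S.gapPrev (k + 1)).vec) = 0 := by
  have h := S.tridiagonal_inner hYt hH hk
  rw [S.Z1_mulVec_zeta_of_lt hk, b, if_pos hk] at h
  rw [← S.system_loc hYt hH hP, ← S.system_prev hYt]
  simp only [Nat.add_sub_cancel] at h ⊢
  rw [← sub_eq_zero] at h
  rw [← h]
  -- Truncated subtraction is harmless at k = 0: the gain with this index is multiplied by `Pt 0 =
  -- 0`.
  have : k + 1 - 2 = k - 1 := by omega
  rw [this]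
  abel

theorem normal_equations_last (hYt : ∀ k, (S.Yt k).PosDef) (hH : ∀ k, (S.H k).PosDef)
    (hP : ∀ k, (S.P k)ᵀ = S.P k) {k : ℕ} (hk : ¬ k + 1 < S.N) :
    (S.E (k + 1))ᵀ *ᵥ ((rowI q p)ᵀ *ᵥ (S.H k * S.gapLoc k).vec) = 0 := by
  have h := S.tridiagonal_last hYt hH hk
  have hZ : S.Z1 (k + 1) *ᵥ S.zeta (k + 1) =
      (S.E (k + 1))ᵀ *ᵥ ((rowI q p)ᵀ *ᵥ ((S.Y1t k ⊗ₖ S.H k) *ᵥ (S.F k).vec)) := by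
    rw [S.Z1_of_not_lt hk, vec_F]
    simp only [transpose_mul, Matrix.mul_assoc, mulVec_mulVec, Nat.add_sub_cancel]
  rw [hZ, b, if_neg hk] at h
  rw [← S.system_loc hYt hH hP]
  have : k + 1 - 2 = k - 1 := by omega
  simp only [Nat.add_sub_cancel, this, add_zero] at h ⊢
  rw [h, sub_self]

/-- The covariance of the costate with the previous innovation vanishes on the near blocks. -/
theorem H_mul_gapPrev_apply (hYt : ∀ k, (S.Yt k).PosDef) (hH : ∀ k, (S.H k).PosDef)
    (hP : ∀ k, (S.P k)ᵀ = S.P k) {k : ℕ} (hk : k + 1 < S.N) {r : Blk q} {s : Blk p}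
    (hrs : Near r.1 s.1) : (S.H (k + 1) * S.gapPrev (k + 1)) r s = 0 := by
  have h := congrFun (S.normal_equations_inner hYt hH hP hk) (.inr ⟨⟨(s, r), hrs⟩, hk⟩)
  rwa [Pi.add_apply, rowI_mul_E_transpose_mulVec_inr, rowM_mul_E_transpose_mulVec_inr,
    zero_add] at h

/-- The covariance of the costate with the local innovation vanishes on the diagonal blocks. -/
theorem H_mul_gapLoc_apply (hYt : ∀ k, (S.Yt k).PosDef) (hH : ∀ k, (S.H k).PosDef)
    (hP : ∀ k, (S.P k)ᵀ = S.P k) {k : ℕ} (hk : k + 1 < S.N) {r : Blk q} {s : Blk p}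
    (hrs : s.1 = r.1) : (S.H k * S.gapLoc k
      - (S.L (k + 1) * S.B)ᵀ * (S.H (k + 1) * S.gapPrev (k + 1))) r s = 0 := by
  have h := congrFun (S.normal_equations_inner hYt hH hP hk) (.inl ⟨(s, r), hrs⟩)
  rw [Pi.add_apply, rowI_mul_E_transpose_mulVec_inl, rowM_mul_E_transpose_mulVec_inl,
    kronecker_transpose, transpose_one, ← vec_mul_eq_mulVec, ← sub_eq_add_neg] at h
  exact h

/-- At the final stage no later gap feels the input, so the costate has a single term. -/
theorem H_mul_gapLoc_apply_last (hYt : ∀ k, (S.Yt k).PosDef) (hH : ∀ k, (S.H k).PosDef)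
    (hP : ∀ k, (S.P k)ᵀ = S.P k) {k : ℕ} (hk : ¬ k + 1 < S.N) {r : Blk q} {s : Blk p}
    (hrs : s.1 = r.1) : (S.H k * S.gapLoc k) r s = 0 := by
  have h := congrFun (S.normal_equations_last hYt hH hP hk) (.inl ⟨(s, r), hrs⟩)
  rwa [rowI_mul_E_transpose_mulVec_inl] at h

end ThreePlayer

/-! ### Calculus of cross covariances and centered Gaussian processes. -/

section Covariance

variable {Ω ι κ τ : Type*} [MeasurableSpace Ω] {μ : Measure Ω}

theorem HasCov.of_eq {X : Ω → ι → ℝ} {Y : Ω → κ → ℝ} {M M' : Matrix ι κ ℝ} (h : HasCov μ X Y M)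
    (hM : M = M') : HasCov μ X Y M' := hM ▸ h

theorem HasCov.symm {X : Ω → ι → ℝ} {Y : Ω → κ → ℝ} {M : Matrix ι κ ℝ} (h : HasCov μ X Y M) :
    HasCov μ Y X Mᵀ := fun r s => by
  have := h s r
  simp only [mul_comm (X _ s)] at this
  exact this

theorem HasCov.add_left {X X' : Ω → ι → ℝ} {Y : Ω → κ → ℝ} {M M' : Matrix ι κ ℝ}
    (h : HasCov μ X Y M) (h' : HasCov μ X' Y M') :
    HasCov μ (fun ω => X ω + X' ω) Y (M + M') := fun r s => by
  simp only [Pi.add_apply, add_mul]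
  exact ⟨(h r s).1.add (h' r s).1, by
    rw [integral_add (h r s).1 (h' r s).1, (h r s).2, (h' r s).2]; rfl⟩

theorem HasCov.sub_left {X X' : Ω → ι → ℝ} {Y : Ω → κ → ℝ} {M M' : Matrix ι κ ℝ}
    (h : HasCov μ X Y M) (h' : HasCov μ X' Y M') :
    HasCov μ (fun ω => X ω - X' ω) Y (M - M') := fun r s => by
  simp only [Pi.sub_apply, sub_mul]
  exact ⟨(h r s).1.sub (h' r s).1, by
    rw [integral_sub (h r s).1 (h' r s).1, (h r s).2, (h' r s).2]; rfl⟩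

theorem HasCov.zero_left (Y : Ω → κ → ℝ) : HasCov μ (fun _ => (0 : ι → ℝ)) Y 0 := fun r s => by
  simp

theorem HasCov.mulVec_left [Fintype ι] {X : Ω → ι → ℝ} {Y : Ω → κ → ℝ} {M : Matrix ι κ ℝ}
    (h : HasCov μ X Y M) (A : Matrix τ ι ℝ) : HasCov μ (fun ω => A *ᵥ X ω) Y (A * M) :=
  fun r s => by
    have hint : ∀ i ∈ Finset.univ, Integrable (fun ω => A r i * X ω i * Y ω s) μ := fun i _ => by
      simp only [mul_assoc]
      exact (h i s).1.const_mul _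
    have heq : (fun ω => (A *ᵥ X ω) r * Y ω s) = fun ω => ∑ i, A r i * X ω i * Y ω s := by
      ext ω
      rw [mulVec, dotProduct, Finset.sum_mul]
    refine ⟨heq ▸ integrable_finsetSum _ hint, ?_⟩
    rw [heq, integral_finsetSum _ hint, mul_apply]
    refine Finset.sum_congr rfl fun i _ => ?_
    simp only [mul_assoc]
    rw [integral_const_mul, (h i s).2]

theorem HasCov.add_right {X : Ω → ι → ℝ} {Y Y' : Ω → κ → ℝ} {M M' : Matrix ι κ ℝ}
    (h : HasCov μ X Y M) (h' : HasCov μ X Y' M') :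
    HasCov μ X (fun ω => Y ω + Y' ω) (M + M') :=
  (h.symm.add_left h'.symm).symm.of_eq (by simp)

theorem HasCov.sub_right {X : Ω → ι → ℝ} {Y Y' : Ω → κ → ℝ} {M M' : Matrix ι κ ℝ}
    (h : HasCov μ X Y M) (h' : HasCov μ X Y' M') :
    HasCov μ X (fun ω => Y ω - Y' ω) (M - M') :=
  (h.symm.sub_left h'.symm).symm.of_eq (by simp)

theorem HasCov.zero_right (X : Ω → ι → ℝ) : HasCov μ X (fun _ => (0 : κ → ℝ)) 0 := fun r s => by
  simp

theorem HasCov.mulVec_right [Fintype κ] {X : Ω → ι → ℝ} {Y : Ω → κ → ℝ} {M : Matrix ι κ ℝ}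
    (h : HasCov μ X Y M) (A : Matrix τ κ ℝ) : HasCov μ X (fun ω => A *ᵥ Y ω) (M * Aᵀ) :=
  (h.symm.mulVec_left A).symm.of_eq (by simp)

theorem HasCov.transpose_eq {X : Ω → ι → ℝ} {M : Matrix ι ι ℝ} (h : HasCov μ X X M) : Mᵀ = M := by
  ext r s
  rw [← (h.symm r s).2, (h r s).2]

/-- The form zᵀMz is the second moment of the scalar z · X; z is written as a one-row matrix to
reuse `HasCov.mulVec_left`. -/
theorem HasCov.posSemidef [Fintype ι] {X : Ω → ι → ℝ} {M : Matrix ι ι ℝ} (h : HasCov μ X X M) :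
    M.PosSemidef := by
  refine .of_transpose_eq h.transpose_eq fun z => ?_
  have h1 := ((h.mulVec_left (Matrix.of fun (_ : Unit) i => z i)).mulVec_right
    (Matrix.of fun (_ : Unit) i => z i)) () ()
  have h2 : z ⬝ᵥ M *ᵥ z = (Matrix.of (fun (_ : Unit) i => z i) * M
      * (Matrix.of fun (_ : Unit) i => z i)ᵀ) () () := by
    rw [Matrix.mul_assoc]
    simp [mul_apply, mulVec, dotProduct]
  rw [h2, ← h1.2]
  exact integral_nonneg fun ω => mul_self_nonneg _

/-- The coordinates of the random vector `X` lie in the space `G` of random variables. -/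
def CoordsIn (G : Submodule ℝ (Ω → ℝ)) (X : Ω → ι → ℝ) : Prop := ∀ r, (fun ω => X ω r) ∈ G

variable {G : Submodule ℝ (Ω → ℝ)}

omit [MeasurableSpace Ω] in
theorem CoordsIn.add {X Y : Ω → ι → ℝ} (hX : CoordsIn G X) (hY : CoordsIn G Y) :
    CoordsIn G (fun ω => X ω + Y ω) := fun r => G.add_mem (hX r) (hY r)

omit [MeasurableSpace Ω] in
theorem CoordsIn.sub {X Y : Ω → ι → ℝ} (hX : CoordsIn G X) (hY : CoordsIn G Y) :
    CoordsIn G (fun ω => X ω - Y ω) := fun r => G.sub_mem (hX r) (hY r)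

omit [MeasurableSpace Ω] in
theorem CoordsIn.zero : CoordsIn G (fun _ => (0 : ι → ℝ)) := fun _ => G.zero_mem

omit [MeasurableSpace Ω] in
theorem CoordsIn.mulVec [Fintype ι] {X : Ω → ι → ℝ} (hX : CoordsIn G X) (A : Matrix τ ι ℝ) :
    CoordsIn G (fun ω => A *ᵥ X ω) := fun r => by
  have : (fun ω => (A *ᵥ X ω) r) = ∑ i, A r i • fun ω => X ω i := by
    ext ω
    simp [Matrix.mulVec, dotProduct]
  rw [this]
  exact G.sum_mem fun i _ => G.smul_mem _ (hX i)

variable {T : Type*} {Z : T → Ω → ℝ}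

theorem memLp_two_of_mem_span (hZ : IsGaussianProcess Z μ) {f : Ω → ℝ}
    (hf : f ∈ Submodule.span ℝ (Set.range Z)) : MemLp f 2 μ := by
  induction hf using Submodule.span_induction with
  | mem f h =>
    obtain ⟨t, rfl⟩ := h
    exact (hZ.hasGaussianLaw_eval t).memLp_two
  | zero => exact MemLp.zero
  | add f g _ _ hf hg => exact hf.add hg
  | smul c f _ hf => exact hf.const_smul c

theorem integral_eq_zero_of_mem_span [IsProbabilityMeasure μ] (hZ : IsGaussianProcess Z μ)
    (h0 : ∀ t, ∫ ω, Z t ω ∂μ = 0) {f : Ω → ℝ} (hf : f ∈ Submodule.span ℝ (Set.range Z)) :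
    ∫ ω, f ω ∂μ = 0 := by
  have hi : ∀ f ∈ Submodule.span ℝ (Set.range Z), Integrable f μ := fun f hf =>
    (memLp_two_of_mem_span hZ hf).integrable one_le_two
  induction hf using Submodule.span_induction with
  | mem f h =>
    obtain ⟨t, rfl⟩ := h
    exact h0 t
  | zero => simp
  | add f g hf' hg' hf hg => rw [integral_add' (hi f hf') (hi g hg'), hf, hg, add_zero]
  | smul c f _ hf => simp [integral_const_mul, hf]

theorem measurable_of_mem_span (hZ : ∀ t, Measurable (Z t)) {f : Ω → ℝ}
    (hf : f ∈ Submodule.span ℝ (Set.range Z)) : Measurable f := by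
  induction hf using Submodule.span_induction with
  | mem f h =>
    obtain ⟨t, rfl⟩ := h
    exact hZ t
  | zero => exact measurable_zero
  | add f g _ _ hf hg => exact hf.add hg
  | smul c f _ hf => exact hf.const_smul c

/-- Each member is a finite combination of the Z's, hence a continuous linear image of a finite
subfamily. -/
theorem isGaussianProcess_of_mem_span (hZ : IsGaussianProcess Z μ) {X : ι → Ω → ℝ}
    (hX : ∀ i, X i ∈ Submodule.span ℝ (Set.range Z)) : IsGaussianProcess X μ := by
  refine hZ.of_isGaussianProcess fun i => ?_
  obtain ⟨c, hc⟩ := (Finsupp.mem_span_range_iff_exists_finsupp).1 (hX i)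
  refine ⟨c.support, ∑ t : c.support, c t • ContinuousLinearMap.proj t, fun ω => ?_⟩
  rw [← hc, Finsupp.sum]
  simp [Finset.sum_apply, Finset.restrict]
  exact (Finset.sum_attach c.support fun t => c t * Z t ω).symm

/-- Uncorrelated linear functions of a centered Gaussian process are independent. -/
theorem indepFun_of_hasCov_zero [IsProbabilityMeasure μ] (hZ : IsGaussianProcess Z μ)
    (h0 : ∀ t, ∫ ω, Z t ω ∂μ = 0) {X : Ω → ι → ℝ} {Y : Ω → κ → ℝ}
    (hX : CoordsIn (Submodule.span ℝ (Set.range Z)) X)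
    (hY : CoordsIn (Submodule.span ℝ (Set.range Z)) Y) (h : HasCov μ X Y 0) :
    IndepFun X Y μ := by
  refine IsGaussianProcess.indepFun_of_covariance_eq_zero (X := fun i ω => X ω i)
    (Y := fun i ω => Y ω i) (isGaussianProcess_of_mem_span hZ ?_)
    (fun i => (memLp_two_of_mem_span hZ (hX i)).1.aemeasurable)
    (fun i => (memLp_two_of_mem_span hZ (hY i)).1.aemeasurable) fun i j => ?_
  · rintro (i | i)
    · exact hX i
    · exact hY i
  · rw [covariance_eq_sub (memLp_two_of_mem_span hZ (hX i)) (memLp_two_of_mem_span hZ (hY j)),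
      integral_eq_zero_of_mem_span hZ h0 (hX i), zero_mul, sub_zero]
    exact (h i j).2

/-- A linear function of a centered Gaussian process that is uncorrelated with `Y` is orthogonal
to every Borel function of `Y`. -/
theorem integral_mul_eq_zero_of_hasCov_zero [IsProbabilityMeasure μ] (hZ : IsGaussianProcess Z μ)
    (h0 : ∀ t, ∫ ω, Z t ω ∂μ = 0) {X : Ω → ι → ℝ} {Y : Ω → κ → ℝ}
    (hX : CoordsIn (Submodule.span ℝ (Set.range Z)) X)
    (hY : CoordsIn (Submodule.span ℝ (Set.range Z)) Y) (hYm : ∀ i, Measurable fun ω => Y ω i)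
    (h : HasCov μ X Y 0) {φ : Ω → ℝ} (hφ : Measurable[MeasurableSpace.comap Y MeasurableSpace.pi] φ)
    (i : ι) : ∫ ω, X ω i * φ ω ∂μ = 0 := by
  have hYm' : Measurable Y := measurable_pi_lambda _ hYm
  obtain ⟨f, hf, rfl⟩ := Measurable.exists_eq_measurable_comp hφ
  have hind := (indepFun_of_hasCov_zero hZ h0 hX hY h).comp (measurable_pi_apply i) hf
  have := hind.integral_fun_mul_eq_mul_integral (memLp_two_of_mem_span hZ (hX i)).1
    (hf.comp hYm').aestronglyMeasurable
  simp only [Function.comp] at this ⊢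
  rw [this, integral_eq_zero_of_mem_span hZ h0 (hX i), zero_mul]

end Covariance

/-- If `X - M` is a centered Gaussian vector uncorrelated with `Y`, and `M` is a function of a part
of `Y`, then `M` is the conditional expectation of `X` with respect to that part. -/
theorem condExp_ae_eq_of_hasCov_zero {Ω ι κ T : Type*} {m m0 : MeasurableSpace Ω}
    {μ : Measure Ω} {Z : T → Ω → ℝ} [Fintype ι] [IsProbabilityMeasure μ] (hZ : IsGaussianProcess Z μ) (hZm : ∀ t, Measurable (Z t))
    (h0 : ∀ t, ∫ ω, Z t ω ∂μ = 0) {X M D : Ω → ι → ℝ} {Y : Ω → κ → ℝ}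
    (hX : ∀ ω, X ω = M ω + D ω) (hD : CoordsIn (Submodule.span ℝ (Set.range Z)) D)
    (hY : CoordsIn (Submodule.span ℝ (Set.range Z)) Y) (h : HasCov μ D Y 0)
    (hm : m ≤ MeasurableSpace.comap Y MeasurableSpace.pi)
    (hM : Measurable[m] M) (hMi : Integrable M μ) :
    μ[X | m] =ᵐ[μ] M := by
  have hYm : Measurable Y := measurable_pi_lambda _ fun i => measurable_of_mem_span hZm (hY i)
  have hDm : Measurable D := measurable_pi_lambda _ fun i => measurable_of_mem_span hZm (hD i)
  have hle := hm.trans hYm.comap_le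
  have hDi : Integrable D μ := Integrable.of_eval fun i =>
    (memLp_two_of_mem_span hZ (hD i)).integrable one_le_two
  -- D is independent of the larger σ-algebra of Y, hence of m, so conditioning leaves only its
  -- mean, which is zero.
  have hD0 : μ[D | m] =ᵐ[μ] 0 := by
    have hind := indep_of_indep_of_le_right ((IndepFun_iff_Indep _ _ _).1 (indepFun_of_hasCov_zero hZ h0 hD hY h)) hm
    refine (condExp_indep_eq hDm.comap_le hle
      (comap_measurable D).stronglyMeasurable hind).trans ?_
    have : ∫ ω, D ω ∂μ = 0 := by
      ext i
      rw [eval_integral fun i => (memLp_two_of_mem_span hZ (hD i)).integrable one_le_two]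
      exact integral_eq_zero_of_mem_span hZ h0 (hD i)
    rw [this]
    rfl
  have hXe : X = M + D := funext hX
  rw [hXe]
  refine (condExp_add hMi hDi m).trans ?_
  rw [condExp_of_stronglyMeasurable hle hM.stronglyMeasurable hMi]
  filter_upwards [hD0] with ω hω
  simp [hω]

namespace ThreePlayer

/-! ### The local gain as a regression on the near innovations. -/

section LocalGain

variable {n q p : Fin 3 → ℕ} (S : ThreePlayer n q p)

theorem C_apply_eq_zero {s : Blk p} {r : Blk n} (h : s.1 ≠ r.1) : S.C s r = 0 := by
  obtain ⟨i, a⟩ := s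
  obtain ⟨j, b⟩ := r
  exact blockDiagonal'_apply_ne _ _ _ h

theorem B_apply_eq_zero {s : Blk n} {r : Blk q} (h : s.1 ≠ r.1) : S.B s r = 0 := by
  obtain ⟨i, a⟩ := s
  obtain ⟨j, b⟩ := r
  exact blockDiagonal'_apply_ne _ _ _ h

theorem sum_near_mul_C (i : Fin 3) {s : Blk p} (hs : Near i s.1) (f : Blk n → ℝ) :
    ∑ t : NearIdx n i, f t.1 * S.C s t.1 = ∑ t, f t * S.C s t := by
  refine Fintype.sum_of_injective Subtype.val Subtype.val_injective _ _ (fun t ht => ?_)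
    fun t => rfl
  rw [S.C_apply_eq_zero, mul_zero]
  intro h
  exact ht ⟨⟨t, h ▸ hs⟩, rfl⟩

/-- These are the normal equations for regressing the next state of player i on the innovations of
the players in S_i. Because C is block diagonal, restricting P and C to S_i before or after
multiplying gives the same submatrix, so the matrix inverted in `K1row` is a principal submatrix of
`Yt`. -/
theorem K1row_mul_submatrix (hYt : ∀ k, (S.Yt k).PosDef) (k : ℕ) (i : Fin 3) :
    S.K1row k i * ((S.Yt k).submatrix Subtype.val Subtype.val :
        Matrix (NearIdx p i) (NearIdx p i) ℝ) =
      ((S.A * S.P k * S.Cᵀ).submatrix (fun r => ⟨i, r⟩) Subtype.val :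
        Matrix (Fin (n i)) (NearIdx p i) ℝ) := by
  set CS : Matrix (NearIdx p i) (NearIdx n i) ℝ := S.C.submatrix Subtype.val Subtype.val with hCS
  set PS : Matrix (NearIdx n i) (NearIdx n i) ℝ := (S.P k).submatrix Subtype.val Subtype.val
    with hPS
  set VS : Matrix (NearIdx p i) (NearIdx p i) ℝ := S.V.submatrix Subtype.val Subtype.val with hVS
  set YS : Matrix (NearIdx p i) (NearIdx p i) ℝ := (S.Yt k).submatrix Subtype.val Subtype.val
    with hYS
  have hpd : YS.PosDef := (hYt k).submatrix Subtype.val_injective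
  have h1 : CS * PS * CSᵀ + VS = YS := by
    ext a b
    simp only [hCS, hPS, hVS, hYS, Yt, Matrix.add_apply, submatrix_apply, mul_apply,
      transpose_apply]
    rw [S.sum_near_mul_C i b.2 (fun t => ∑ j : NearIdx n i, S.C a.1 j.1 * S.P k j.1 t)]
    congr 1
    refine Finset.sum_congr rfl fun t _ => ?_
    congr 1
    simp only [mul_comm (S.C _ _)]
    exact S.sum_near_mul_C i a.2 (fun j => S.P k j t)
  have h2 : S.A.submatrix (fun r => (⟨i, r⟩ : Blk n)) id
      * ((S.P k).submatrix id Subtype.val : Matrix (Blk n) (NearIdx n i) ℝ) * CSᵀ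
      = ((S.A * S.P k * S.Cᵀ).submatrix (fun r => ⟨i, r⟩) Subtype.val :
        Matrix (Fin (n i)) (NearIdx p i) ℝ) := by
    ext a b
    simp only [hCS, submatrix_apply, mul_apply, transpose_apply, id]
    exact S.sum_near_mul_C i b.2 (fun t => ∑ j, S.A ⟨i, a⟩ j * S.P k j t)
  have h3 : S.K1row k i = S.A.submatrix (fun r => (⟨i, r⟩ : Blk n)) id
      * ((S.P k).submatrix id Subtype.val : Matrix (Blk n) (NearIdx n i) ℝ) * CSᵀ
      * (CS * PS * CSᵀ + VS)⁻¹ := rfl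
  rw [← h2, h3, h1, Matrix.mul_assoc, hpd.inv_mul_cancel, Matrix.mul_one]

theorem K_mul_Yt (hYt : ∀ k, (S.Yt k).PosDef) (k : ℕ) :
    S.K k * S.Yt k = S.A * S.P k * S.Cᵀ := by
  have := (hYt k).inv_mul_cancel
  rw [Yt] at this
  rw [K, Yt, Matrix.mul_assoc, this, Matrix.mul_one]

theorem K1_apply_eq_zero (k : ℕ) {r : Blk n} {s : Blk p} (h : ¬ Near r.1 s.1) :
    S.K1 k r s = 0 := by
  rw [K1, of_apply, dif_neg h]

/-- The local estimation error is uncorrelated with the innovations of the near players. -/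
theorem Pt_apply_eq_zero (hYt : ∀ k, (S.Yt k).PosDef) (k : ℕ) {r : Blk n} {s : Blk p}
    (h : Near r.1 s.1) : S.Pt (k + 1) r s = 0 := by
  have h1 := congrFun (congrFun (S.K1row_mul_submatrix hYt k r.1) r.2) ⟨s, h⟩
  rw [submatrix_apply, ← S.K_mul_Yt hYt] at h1
  rw [Pt, Matrix.sub_mul, Matrix.sub_apply, sub_eq_zero]
  refine h1.symm.trans ?_
  rw [mul_apply, mul_apply]
  refine Fintype.sum_of_injective Subtype.val Subtype.val_injective _ _ (fun t ht => ?_)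
    fun t => ?_
  · rw [S.K1_apply_eq_zero, zero_mul]
    intro h
    exact ht ⟨⟨t, h⟩, rfl⟩
  · rw [K1, of_apply, dif_pos t.2]
    rfl

end LocalGain

/-! ### Estimation errors as functions of the noise, and their covariances. -/

section Errors

variable {n q p : Fin 3 → ℕ} (S : ThreePlayer n q p) {Ω : Type*} (x0 : Ω → Blk n → ℝ)
  (w : ℕ → Ω → Blk n → ℝ) (v : ℕ → Ω → Blk p → ℝ)

/-- The prediction error as a function of the noise. -/
noncomputable def err : ℕ → Ω → Blk n → ℝ
  | 0, ω => x0 ω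
  | k + 1, ω => S.A *ᵥ err k ω + w k ω - S.K k *ᵥ (S.C *ᵥ err k ω + v k ω)

/-- The innovation as a function of the noise. -/
noncomputable def errInnov (k : ℕ) (ω : Ω) : Blk p → ℝ := S.C *ᵥ S.err x0 w v k ω + v k ω

/-- The previous innovation as a function of the noise. -/
noncomputable def errPrev : ℕ → Ω → Blk p → ℝ
  | 0, _ => 0
  | k + 1, ω => S.errInnov x0 w v k ω

/-- The error of the local estimate as a function of the noise. -/
noncomputable def errLoc : ℕ → Ω → Blk n → ℝ
  | 0, ω => x0 ω
  | k + 1, ω => S.err x0 w v (k + 1) ω + (S.K k - S.K1 k) *ᵥ S.errInnov x0 w v k ω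

/-- The local innovation as a function of the noise. -/
noncomputable def errInnovLoc (k : ℕ) (ω : Ω) : Blk p → ℝ := S.C *ᵥ S.errLoc x0 w v k ω + v k ω

/-- The difference `u - L x` under the optimal controller. -/
noncomputable def gap (k : ℕ) (ω : Ω) : Blk q → ℝ :=
  S.F k *ᵥ S.errInnovLoc x0 w v k ω + S.Dg k *ᵥ S.errPrev x0 w v k ω
    - S.L k *ᵥ S.errLoc x0 w v k ω

/-- The gradient of the cost with respect to the input at time `k`, under the optimal controller. -/
noncomputable def costate (k : ℕ) (ω : Ω) : Blk q → ℝ :=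
  S.H k *ᵥ S.gap x0 w v k ω
    - if k + 1 < S.N then (S.L (k + 1) * S.B)ᵀ *ᵥ (S.H (k + 1) *ᵥ S.gap x0 w v (k + 1) ω) else 0

variable {S x0 w v} [MeasurableSpace Ω] {μ : Measure Ω} (hn : S.IsNoise μ x0 w v)
include hn

theorem IsNoise.cov_vw (k l : ℕ) : HasCov μ (v k) (w l) 0 := (hn.cov_wv l k).symm

theorem IsNoise.cov_w_of_ne {k l : ℕ} (h : k ≠ l) : HasCov μ (w k) (w l) 0 :=
  (hn.cov_w k l).of_eq (if_neg h)

theorem IsNoise.cov_v_of_ne {k l : ℕ} (h : k ≠ l) : HasCov μ (v k) (v l) 0 :=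
  (hn.cov_v k l).of_eq (if_neg h)

/-- The error at time k involves only the initial state and the noise before time k. -/
theorem IsNoise.cov_err_w {k l : ℕ} (h : k ≤ l) : HasCov μ (S.err x0 w v k) (w l) 0 := by
  induction k with
  | zero => exact hn.cov_x0w l
  | succ k ih =>
    have h1 := ih (by omega)
    exact (((h1.mulVec_left S.A).add_left (hn.cov_w_of_ne (by omega : k ≠ l))).sub_left
      (((h1.mulVec_left S.C).add_left (hn.cov_vw k l)).mulVec_left (S.K k))).of_eq (by simp)

theorem IsNoise.cov_err_v {k l : ℕ} (h : k ≤ l) : HasCov μ (S.err x0 w v k) (v l) 0 := by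
  induction k with
  | zero => exact hn.cov_x0v l
  | succ k ih =>
    have h1 := ih (by omega)
    exact (((h1.mulVec_left S.A).add_left (hn.cov_wv k l)).sub_left
      (((h1.mulVec_left S.C).add_left (hn.cov_v_of_ne (by omega : k ≠ l))).mulVec_left
        (S.K k))).of_eq (by simp)

theorem IsNoise.cov_errInnov_w {k l : ℕ} (h : k ≤ l) :
    HasCov μ (S.errInnov x0 w v k) (w l) 0 :=
  (((hn.cov_err_w h).mulVec_left S.C).add_left (hn.cov_vw k l)).of_eq (by simp)

theorem IsNoise.cov_errInnov_v {k l : ℕ} (h : k < l) :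
    HasCov μ (S.errInnov x0 w v k) (v l) 0 :=
  (((hn.cov_err_v h.le).mulVec_left S.C).add_left (hn.cov_v_of_ne h.ne)).of_eq (by simp)

theorem IsNoise.cov_err_errInnov_of_err {k : ℕ} {M : Matrix (Blk n) (Blk n) ℝ}
    (h : HasCov μ (S.err x0 w v k) (S.err x0 w v k) M) :
    HasCov μ (S.err x0 w v k) (S.errInnov x0 w v k) (M * S.Cᵀ) :=
  ((h.mulVec_right S.C).add_right (hn.cov_err_v le_rfl)).of_eq (by simp)

theorem IsNoise.cov_errInnov_errInnov_of_err {k : ℕ} {M : Matrix (Blk n) (Blk n) ℝ}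
    (h : HasCov μ (S.err x0 w v k) (S.err x0 w v k) M) :
    HasCov μ (S.errInnov x0 w v k) (S.errInnov x0 w v k) (S.C * M * S.Cᵀ + S.V) :=
  (((hn.cov_err_errInnov_of_err h).mulVec_left S.C).add_left
    (((hn.cov_err_v le_rfl).symm.mulVec_right S.C).add_right (hn.cov_v k k))).of_eq (by
      simp [Matrix.mul_assoc])

omit hn in
theorem Yt_posDef_of_err (hV : S.V.PosDef) {k : ℕ}
    (h : HasCov μ (S.err x0 w v k) (S.err x0 w v k) (S.P k)) : (S.Yt k).PosDef := by
  rw [Yt, add_comm]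
  exact hV.add_posSemidef (h.posSemidef.mul_mul_transpose _)

/-- As a covariance, P(k) is positive semidefinite, which makes Yt(k) invertible and gives K Yt = A
P Cᵀ. With this relation the terms quadratic in K cancel one of the mixed terms, and the Riccati
step remains. -/
theorem IsNoise.cov_err_err (hV : S.V.PosDef) (k : ℕ) :
    HasCov μ (S.err x0 w v k) (S.err x0 w v k) (S.P k) := by
  induction k with
  | zero => exact hn.cov_x0
  | succ k ih =>
    have hY := Yt_posDef_of_err hV ih
    have hKY : S.K k * S.Yt k = S.A * S.P k * S.Cᵀ := by
      have := hY.inv_mul_cancel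
      rw [Yt] at this
      rw [K, Yt, Matrix.mul_assoc, this, Matrix.mul_one]
    have hYK : S.Yt k * (S.K k)ᵀ = S.C * S.P k * S.Aᵀ := by
      rw [← hY.transpose_eq, ← transpose_mul, hKY]
      simp [ih.transpose_eq, Matrix.mul_assoc]
    have hey := hn.cov_err_errInnov_of_err ih
    have hyy : HasCov μ (S.errInnov x0 w v k) (S.errInnov x0 w v k) (S.Yt k) :=
      hn.cov_errInnov_errInnov_of_err ih
    have hew := hn.cov_err_w (k := k) le_rfl
    have hyw := hn.cov_errInnov_w (k := k) le_rfl
    have hww : HasCov μ (w k) (w k) S.W := (hn.cov_w k k).of_eq (if_pos rfl)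
    have h1 : HasCov μ (S.err x0 w v (k + 1)) (S.err x0 w v k) _ :=
      ((ih.mulVec_left S.A).add_left hew.symm).sub_left (hey.symm.mulVec_left (S.K k))
    have h2 : HasCov μ (S.err x0 w v (k + 1)) (w k) _ :=
      ((hew.mulVec_left S.A).add_left hww).sub_left (hyw.mulVec_left (S.K k))
    have h3 : HasCov μ (S.err x0 w v (k + 1)) (S.errInnov x0 w v k) _ :=
      ((hey.mulVec_left S.A).add_left hyw.symm).sub_left (hyy.mulVec_left (S.K k))
    refine HasCov.of_eq (((h1.mulVec_right S.A).add_right h2).sub_right (h3.mulVec_right (S.K k))) ?_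
    rw [hKY, P, show S.A * S.P k * S.Cᵀ * (S.C * S.P k * S.Cᵀ + S.V)⁻¹ = S.K k from rfl]
    simp only [transpose_mul, transpose_transpose, transpose_zero, ih.transpose_eq, Matrix.mul_zero,
      add_zero, sub_zero, Matrix.mul_assoc, sub_self, Matrix.sub_mul, Matrix.zero_mul]
    abel

theorem IsNoise.Yt_posDef (hV : S.V.PosDef) (k : ℕ) : (S.Yt k).PosDef :=
  Yt_posDef_of_err hV (hn.cov_err_err hV k)

theorem IsNoise.P_transpose (hV : S.V.PosDef) (k : ℕ) : (S.P k)ᵀ = S.P k :=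
  (hn.cov_err_err hV k).transpose_eq

theorem IsNoise.cov_errInnov_errInnov (hV : S.V.PosDef) (k : ℕ) :
    HasCov μ (S.errInnov x0 w v k) (S.errInnov x0 w v k) (S.Yt k) :=
  hn.cov_errInnov_errInnov_of_err (hn.cov_err_err hV k)

/-- The case j = k - 1 is the defining property of the Kalman gain, A P Cᵀ - K Yt = 0. Later errors
only add fresh noise. This is the source of the whiteness of the innovations. -/
theorem IsNoise.cov_err_errInnov_of_lt (hV : S.V.PosDef) {k j : ℕ} (h : j < k) :
    HasCov μ (S.err x0 w v k) (S.errInnov x0 w v j) 0 := by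
  induction k with
  | zero => omega
  | succ k ih =>
    rcases Nat.lt_succ_iff_lt_or_eq.1 h with h | rfl
    · have h1 := ih h
      exact (((h1.mulVec_left S.A).add_left (hn.cov_errInnov_w h.le).symm).sub_left
        (((h1.mulVec_left S.C).add_left (hn.cov_errInnov_v h).symm).mulVec_left (S.K k))).of_eq
        (by simp)
    · have hey := hn.cov_err_errInnov_of_err (hn.cov_err_err hV j)
      have hyw := hn.cov_errInnov_w (k := j) le_rfl
      exact (((hey.mulVec_left S.A).add_left hyw.symm).sub_left
        ((hn.cov_errInnov_errInnov hV j).mulVec_left (S.K j))).of_eq (by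
          rw [S.K_mul_Yt (hn.Yt_posDef hV)]
          simp [Matrix.mul_assoc])

theorem IsNoise.cov_errInnov_errInnov_of_lt (hV : S.V.PosDef) {k j : ℕ} (h : j < k) :
    HasCov μ (S.errInnov x0 w v k) (S.errInnov x0 w v j) 0 :=
  (((hn.cov_err_errInnov_of_lt hV h).mulVec_left S.C).add_left
    (hn.cov_errInnov_v h).symm).of_eq (by simp)

theorem IsNoise.cov_errLoc_errPrev (hV : S.V.PosDef) (k : ℕ) :
    HasCov μ (S.errLoc x0 w v k) (S.errPrev x0 w v k) (S.Pt k) := by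
  cases k with
  | zero => exact HasCov.zero_right _
  | succ k =>
    exact ((hn.cov_err_errInnov_of_lt hV k.lt_succ_self).add_left
      ((hn.cov_errInnov_errInnov hV k).mulVec_left _)).of_eq (by rw [zero_add]; rfl)

theorem IsNoise.cov_errPrev_errPrev (hV : S.V.PosDef) (k : ℕ) :
    HasCov μ (S.errPrev x0 w v (k + 1)) (S.errPrev x0 w v (k + 1)) (S.Yt k) :=
  hn.cov_errInnov_errInnov hV k

theorem IsNoise.cov_errPrev_errInnov (hV : S.V.PosDef) {k j : ℕ} (h : j + 1 < k) :
    HasCov μ (S.errPrev x0 w v k) (S.errInnov x0 w v j) 0 := by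
  cases k with
  | zero => omega
  | succ k => exact hn.cov_errInnov_errInnov_of_lt hV (by omega)

theorem IsNoise.cov_errLoc_errInnov (hV : S.V.PosDef) {k j : ℕ} (h : j + 1 < k) :
    HasCov μ (S.errLoc x0 w v k) (S.errInnov x0 w v j) 0 := by
  cases k with
  | zero => omega
  | succ k =>
    exact ((hn.cov_err_errInnov_of_lt hV (by omega)).add_left
      ((hn.cov_errInnov_errInnov_of_lt hV (by omega)).mulVec_left _)).of_eq (by simp)

theorem IsNoise.cov_errLoc_v (k : ℕ) : HasCov μ (S.errLoc x0 w v k) (v k) 0 := by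
  cases k with
  | zero => exact hn.cov_x0v 0
  | succ k =>
    exact ((hn.cov_err_v le_rfl).add_left
      ((hn.cov_errInnov_v k.lt_succ_self).mulVec_left _)).of_eq (by simp)

theorem IsNoise.cov_errPrev_v (k : ℕ) : HasCov μ (S.errPrev x0 w v k) (v k) 0 := by
  cases k with
  | zero => exact HasCov.zero_left _
  | succ k => exact hn.cov_errInnov_v k.lt_succ_self

theorem IsNoise.cov_errLoc_errLoc (hV : S.V.PosDef) (k : ℕ) :
    HasCov μ (S.errLoc x0 w v k) (S.errLoc x0 w v k) (S.P1 k) := by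
  cases k with
  | zero => exact hn.cov_x0
  | succ k =>
    have h1 := hn.cov_err_errInnov_of_lt hV k.lt_succ_self
    exact (((hn.cov_err_err hV (k + 1)).add_right (h1.mulVec_right _)).add_left
      ((h1.symm.add_right ((hn.cov_errInnov_errInnov hV k).mulVec_right _)).mulVec_left _)).of_eq
      (by simp [P1, Matrix.mul_assoc])

theorem IsNoise.cov_errLoc_errInnovLoc (hV : S.V.PosDef) (k : ℕ) :
    HasCov μ (S.errLoc x0 w v k) (S.errInnovLoc x0 w v k) (S.P1 k * S.Cᵀ) :=
  (((hn.cov_errLoc_errLoc hV k).mulVec_right S.C).add_right (hn.cov_errLoc_v k)).of_eq (by simp)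

theorem IsNoise.cov_errInnovLoc_errInnovLoc (hV : S.V.PosDef) (k : ℕ) :
    HasCov μ (S.errInnovLoc x0 w v k) (S.errInnovLoc x0 w v k) (S.Y1t k) :=
  (((hn.cov_errLoc_errInnovLoc hV k).mulVec_left S.C).add_left
    (((hn.cov_errLoc_v k).symm.mulVec_right S.C).add_right (hn.cov_v k k))).of_eq (by
      simp [Matrix.mul_assoc, Y1t])

theorem IsNoise.cov_errInnovLoc_errPrev (hV : S.V.PosDef) (k : ℕ) :
    HasCov μ (S.errInnovLoc x0 w v k) (S.errPrev x0 w v k) (S.C * S.Pt k) :=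
  (((hn.cov_errLoc_errPrev hV k).mulVec_left S.C).add_left (hn.cov_errPrev_v k).symm).of_eq
    (by simp)

theorem IsNoise.cov_errInnovLoc_errInnov (hV : S.V.PosDef) {k j : ℕ} (h : j + 1 < k) :
    HasCov μ (S.errInnovLoc x0 w v k) (S.errInnov x0 w v j) 0 :=
  (((hn.cov_errLoc_errInnov hV h).mulVec_left S.C).add_left
    (hn.cov_errInnov_v (by omega)).symm).of_eq (by simp)

theorem IsNoise.cov_gap_errInnovLoc (hV : S.V.PosDef) (k : ℕ) :
    HasCov μ (S.gap x0 w v k) (S.errInnovLoc x0 w v k) (S.gapLoc k) :=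
  ((((hn.cov_errInnovLoc_errInnovLoc hV k).mulVec_left _).add_left
    ((hn.cov_errInnovLoc_errPrev hV k).symm.mulVec_left _)).sub_left
    ((hn.cov_errLoc_errInnovLoc hV k).mulVec_left _)).of_eq (by rw [gapLoc, transpose_mul])

theorem IsNoise.cov_gap_errPrev (hV : S.V.PosDef) (k : ℕ) :
    HasCov μ (S.gap x0 w v (k + 1)) (S.errInnov x0 w v k) (S.gapPrev (k + 1)) :=
  (((hn.cov_errInnovLoc_errPrev hV (k + 1)).mulVec_left _).add_left
    ((hn.cov_errPrev_errPrev hV k).mulVec_left _)).sub_left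
    ((hn.cov_errLoc_errPrev hV (k + 1)).mulVec_left _)

/-- The gap at time k is made of the local error, the local innovation at k and the innovation at k
- 1, and each of these is uncorrelated with older innovations. -/
theorem IsNoise.cov_gap_errInnov (hV : S.V.PosDef) {k j : ℕ} (h : j + 1 < k) :
    HasCov μ (S.gap x0 w v k) (S.errInnov x0 w v j) 0 :=
  ((((hn.cov_errInnovLoc_errInnov hV h).mulVec_left _).add_left
    ((hn.cov_errPrev_errInnov hV h).mulVec_left _)).sub_left
    ((hn.cov_errLoc_errInnov hV h).mulVec_left _)).of_eq (by simp)

/-- The local innovation at k is the innovation at k plus a multiple of the one at k - 1, which is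
too old to correlate with the gap at k + 1. At k = 0 the two kinds of innovation coincide. -/
theorem IsNoise.cov_gap_succ_errInnovLoc (hV : S.V.PosDef) (k : ℕ) :
    HasCov μ (S.gap x0 w v (k + 1)) (S.errInnovLoc x0 w v k) (S.gapPrev (k + 1)) := by
  have h := hn.cov_gap_errPrev hV k
  cases k with
  | zero => exact h
  | succ k =>
    have h2 := ((hn.cov_gap_errInnov hV (by omega : k + 1 < k + 1 + 1)).mulVec_right
      (S.C * (S.K k - S.K1 k)))
    have h3 := (h.add_right h2).of_eq (M' := S.gapPrev (k + 1 + 1)) (by simp)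
    have heq : S.errInnovLoc x0 w v (k + 1) = fun ω => S.errInnov x0 w v (k + 1) ω
        + (S.C * (S.K k - S.K1 k)) *ᵥ S.errInnov x0 w v k ω := by
      ext1 ω
      rw [errInnovLoc, errLoc, mulVec_add, mulVec_mulVec, errInnov.eq_1 S x0 w v (k + 1)]
      abel
    rw [heq]
    exact h3

/-- Only the diagonal blocks vanish, one player's costate against the same player's local
innovation: the normal equations come from varying the block diagonal gain F. -/
theorem IsNoise.cov_costate_errInnovLoc (hV : S.V.PosDef) (hH : ∀ k, (S.H k).PosDef) (k : ℕ)
    {r : Blk q} {s : Blk p} (hrs : s.1 = r.1) :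
    Integrable (fun ω => S.costate x0 w v k ω r * S.errInnovLoc x0 w v k ω s) μ ∧
      ∫ ω, S.costate x0 w v k ω r * S.errInnovLoc x0 w v k ω s ∂μ = 0 := by
  by_cases hk : k + 1 < S.N
  · have h := ((hn.cov_gap_errInnovLoc hV k).mulVec_left (S.H k)).sub_left
      (((hn.cov_gap_succ_errInnovLoc hV k).mulVec_left (S.H (k + 1))).mulVec_left
        (S.L (k + 1) * S.B)ᵀ) r s
    rw [S.H_mul_gapLoc_apply (hn.Yt_posDef hV) hH (hn.P_transpose hV) hk hrs] at h
    simpa only [costate, if_pos hk] using h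
  · have h := (hn.cov_gap_errInnovLoc hV k).mulVec_left (S.H k) r s
    rw [S.H_mul_gapLoc_apply_last (hn.Yt_posDef hV) hH (hn.P_transpose hV) hk hrs] at h
    simpa only [costate, if_neg hk, sub_zero] using h

omit hn in
-- If Y is old enough to be uncorrelated with the gap at k + 1, the second term of the costate drops
-- out.
theorem cov_costate_of_gap {κ : Type*} {k : ℕ} {Y : Ω → κ → ℝ}
    {M : Matrix (Blk q) κ ℝ} (h : HasCov μ (S.gap x0 w v k) Y M)
    (h' : HasCov μ (S.gap x0 w v (k + 1)) Y 0) :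
    HasCov μ (S.costate x0 w v k) Y (S.H k * M) := by
  have h1 := h.mulVec_left (S.H k)
  by_cases hk : k + 1 < S.N
  · have h2 := (h1.sub_left ((h'.mulVec_left (S.H (k + 1))).mulVec_left
      (S.L (k + 1) * S.B)ᵀ)).of_eq (M' := S.H k * M) (by simp)
    have heq : S.costate x0 w v k = fun ω => S.H k *ᵥ S.gap x0 w v k ω
        - (S.L (k + 1) * S.B)ᵀ *ᵥ (S.H (k + 1) *ᵥ S.gap x0 w v (k + 1) ω) := by
      ext1 ω
      rw [costate, if_pos hk]
    rw [heq]
    exact h2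
  · have heq : S.costate x0 w v k = fun ω => S.H k *ᵥ S.gap x0 w v k ω := by
      ext1 ω
      rw [costate, if_neg hk, sub_zero]
    rw [heq]
    exact h1

theorem IsNoise.cov_costate_errPrev (hV : S.V.PosDef) (k : ℕ) :
    HasCov μ (S.costate x0 w v (k + 1)) (S.errInnov x0 w v k)
      (S.H (k + 1) * S.gapPrev (k + 1)) :=
  cov_costate_of_gap (hn.cov_gap_errPrev hV k) (hn.cov_gap_errInnov hV (by omega))

theorem IsNoise.cov_costate_errInnov (hV : S.V.PosDef) {k j : ℕ} (h : j + 1 < k) :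
    HasCov μ (S.costate x0 w v k) (S.errInnov x0 w v j) 0 :=
  (cov_costate_of_gap (hn.cov_gap_errInnov hV h)
    (hn.cov_gap_errInnov hV (by omega))).of_eq (by simp)

end Errors

end ThreePlayer

/-! ### Measurable and uncorrelated random variables as linear spaces. -/

section RandomVariableSpaces

variable {Ω ι τ : Type*}

/-- The random variables that are measurable with respect to `m`. -/
def measurableFun (m : MeasurableSpace Ω) : Submodule ℝ (Ω → ℝ) where
  carrier := {f | Measurable[m] f}
  add_mem' := fun hf hg => Measurable.add hf hg
  zero_mem' := measurable_zero
  smul_mem' := fun c _ hf => Measurable.const_smul hf c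

theorem measurableFun_mono {m m' : MeasurableSpace Ω} (h : m ≤ m') :
    measurableFun m ≤ measurableFun m' := fun _ hf => Measurable.mono hf h le_rfl

/-- The random variables that are uncorrelated with `z`. -/
def uncorrelated [MeasurableSpace Ω] (μ : Measure Ω) (z : Ω → ℝ) : Submodule ℝ (Ω → ℝ) where
  carrier := {f | Integrable (fun ω => z ω * f ω) μ ∧ ∫ ω, z ω * f ω ∂μ = 0}
  add_mem' := fun {f g} hf hg => by
    have : (fun ω => z ω * (f + g) ω) = fun ω => z ω * f ω + z ω * g ω := by
      ext ω
      simp [mul_add]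
    refine ⟨this ▸ hf.1.add hg.1, ?_⟩
    rw [this, integral_add hf.1 hg.1, hf.2, hg.2, add_zero]
  zero_mem' := by simp
  smul_mem' := fun c f hf => by
    have : (fun ω => z ω * (c • f) ω) = fun ω => c * (z ω * f ω) := by
      ext ω
      simp [mul_left_comm]
    refine ⟨this ▸ hf.1.const_mul c, ?_⟩
    rw [this, integral_const_mul, hf.2, mul_zero]

theorem HasCov.mem_uncorrelated [MeasurableSpace Ω] {μ : Measure Ω} {X : Ω → ι → ℝ}
    {Y : Ω → τ → ℝ} {M : Matrix ι τ ℝ} (h : HasCov μ X Y M) {r : ι} {s : τ} (h0 : M r s = 0) :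
    (fun ω => Y ω s) ∈ uncorrelated μ (fun ω => X ω r) := ⟨(h r s).1, (h r s).2.trans h0⟩

theorem hasCov_zero_iff [MeasurableSpace Ω] {μ : Measure Ω} {X : Ω → ι → ℝ} {Y : Ω → τ → ℝ} :
    HasCov μ X Y 0 ↔ ∀ r, CoordsIn (uncorrelated μ fun ω => X ω r) Y := Iff.rfl

variable {G : Submodule ℝ (Ω → ℝ)}

theorem mulVec_apply_mem [Fintype ι] {X : Ω → ι → ℝ} (A : Matrix τ ι ℝ) (r : τ)
    (h : ∀ j, A r j ≠ 0 → (fun ω => X ω j) ∈ G) : (fun ω => (A *ᵥ X ω) r) ∈ G := by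
  have : (fun ω => (A *ᵥ X ω) r) = ∑ i, A r i • fun ω => X ω i := by
    ext ω
    simp [Matrix.mulVec, dotProduct]
  rw [this]
  refine G.sum_mem fun i _ => ?_
  by_cases hi : A r i = 0
  · rw [hi, zero_smul]
    exact G.zero_mem
  · exact G.smul_mem _ (h i hi)

theorem CoordsIn.mono {G' : Submodule ℝ (Ω → ℝ)} {X : Ω → ι → ℝ} (h : CoordsIn G X)
    (hG : G ≤ G') : CoordsIn G' X := fun r => hG (h r)

end RandomVariableSpaces

/-! ### The information sets and the σ-algebras they generate. -/

section InformationSets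

variable {Ω : Type*} {p : Fin 3 → ℕ}

theorem delay_triangle (i j k : Fin 3) : delay i k ≤ delay i j + delay j k := by
  revert i j k
  decide

theorem delay_le_one {i j : Fin 3} (h : Near i j) : delay j i ≤ 1 := by
  revert i j
  decide

theorem near_of_delay_le_one {i j : Fin 3} (h : delay j i ≤ 1) : Near i j := by
  revert i j
  decide

theorem delay_self (i : Fin 3) : delay i i = 0 := if_pos rfl

theorem eq_of_delay_le_zero {i j : Fin 3} (h : delay j i ≤ 0) : j = i := by
  revert i j
  decide

theorem delay_le_two (i j : Fin 3) : delay j i ≤ 2 := by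
  revert i j
  decide

/-- The triangle inequality for path lengths: whatever j knows at time l reaches i with delay at
most `delay j i`. This is the combinatorial root of partial nestedness. -/
theorem info_subset_info {i j : Fin 3} {k l : ℕ} (h : l + delay j i ≤ k) :
    info p j l ⊆ info p i k := fun a (ha : a.1 + delay a.2.1 j ≤ l) => by
  have := delay_triangle a.2.1 j i
  change a.1 + delay a.2.1 i ≤ k
  omega

theorem info_subset_outputsUpTo {i : Fin 3} {k l d : ℕ} (h : l + d ≤ k) :
    info p i l ⊆ outputsUpTo p d k := fun a (ha : a.1 + delay a.2.1 i ≤ l) => by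
  change a.1 + d ≤ k
  omega

theorem outputsUpTo_subset {k l d d' : ℕ} (h : k + d' ≤ l + d) :
    outputsUpTo p d k ⊆ outputsUpTo p d' l := fun a (ha : a.1 + d ≤ k) => by
  change a.1 + d' ≤ l
  omega

theorem outputsUpTo_subset_infoPast {i : Fin 3} {k : ℕ} :
    outputsUpTo p 2 k ⊆ infoPast p i k := fun a (ha : a.1 + 2 ≤ k) => by
  have := delay_le_two i a.2.1
  refine ⟨?_, ?_⟩
  · change a.1 + delay a.2.1 i ≤ k
    omega
  · change a.1 + 1 ≤ k
    omega

theorem info_subset_infoPast {i : Fin 3} {k : ℕ} : info p i k ⊆ infoPast p i (k + 1) :=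
  fun a (ha : a.1 + delay a.2.1 i ≤ k) => by
  refine ⟨?_, ?_⟩
  · change a.1 + delay a.2.1 i ≤ k + 1
    omega
  · change a.1 + 1 ≤ k + 1
    omega

theorem sigmaOf_mono {I J : Set (ℕ × Blk p)} (h : I ⊆ J) (y : ℕ → Ω → Blk p → ℝ) :
    sigmaOf I y ≤ sigmaOf J y := by
  rw [sigmaOf, sigmaOf, show observe I y = (fun f : J → ℝ => fun a : I => f ⟨a.1, h a.2⟩) ∘
    observe J y from rfl, ← MeasurableSpace.comap_comp]
  refine MeasurableSpace.comap_mono ?_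
  exact (measurable_pi_lambda _ fun a => measurable_pi_apply _).comap_le

theorem output_mem_measurableFun {I : Set (ℕ × Blk p)} {y : ℕ → Ω → Blk p → ℝ} {a : ℕ × Blk p}
    (ha : a ∈ I) : (fun ω => y a.1 ω a.2) ∈ measurableFun (sigmaOf I y) :=
  (measurable_pi_apply (⟨a, ha⟩ : I)).comp (comap_measurable (observe I y))

theorem sigmaOf_le {I : Set (ℕ × Blk p)} {y : ℕ → Ω → Blk p → ℝ} {m : MeasurableSpace Ω}
    (h : ∀ a ∈ I, (fun ω => y a.1 ω a.2) ∈ measurableFun m) : sigmaOf I y ≤ m := by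
  have : Measurable[m] (observe I y) := measurable_pi_lambda _ fun a => h a.1 a.2
  exact this.comap_le

end InformationSets

/-! ### Runs of the system: the errors do not depend on the controls. -/

namespace ThreePlayer

variable {n q p : Fin 3 → ℕ} (S : ThreePlayer n q p) {Ω : Type*} (x0 : Ω → Blk n → ℝ)
  (w : ℕ → Ω → Blk n → ℝ) (v : ℕ → Ω → Blk p → ℝ)

/-- `(x, u, y)` satisfies the system equations. -/
structure IsRun (x : ℕ → Ω → Blk n → ℝ) (u : ℕ → Ω → Blk q → ℝ)
    (y : ℕ → Ω → Blk p → ℝ) : Prop where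
  start : ∀ ω, x 0 ω = x0 ω
  step : ∀ k ω, x (k + 1) ω = S.A *ᵥ x k ω + S.B *ᵥ u k ω + w k ω
  output : ∀ k ω, y k ω = S.C *ᵥ x k ω + v k ω

/-- The error of the two-step estimate as a function of the noise. -/
noncomputable def errTwo : ℕ → Ω → Blk n → ℝ
  | 0, ω => x0 ω
  | k + 1, ω => S.errLoc x0 w v (k + 1) ω + (S.B * S.F k + S.K1 k) *ᵥ S.errInnov x0 w v k ω

/-- The state of the system without control. -/
def freeState : ℕ → Ω → Blk n → ℝ
  | 0, ω => x0 ω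
  | k + 1, ω => S.A *ᵥ freeState k ω + w k ω

/-- The output of the system without control. -/
noncomputable def freeOut (k : ℕ) (ω : Ω) : Blk p → ℝ := S.C *ᵥ S.freeState x0 w k ω + v k ω

/-- The optimal control law, with the recursive expression for the two-step estimate. -/
noncomputable def law (u : ℕ → Ω → Blk q → ℝ) (y : ℕ → Ω → Blk p → ℝ) (k : ℕ) (ω : Ω) :
    Blk q → ℝ :=
  S.F k *ᵥ S.innovLoc u y k ω + S.F1 k *ᵥ S.prevInnov u y k ω + S.L k *ᵥ S.xTwo u y k ω

/-- The two-step estimate under the optimal control law, computed without the last outputs. -/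
noncomputable def xBar (u : ℕ → Ω → Blk q → ℝ) (y : ℕ → Ω → Blk p → ℝ) : ℕ → Ω → Blk n → ℝ
  | 0, _ => 0
  | k + 1, ω => S.A *ᵥ S.xPred u y k ω + S.B *ᵥ (S.F k *ᵥ (S.C *ᵥ (S.xPred u y k ω
      - S.xLoc u y k ω)) + S.F1 k *ᵥ S.prevInnov u y k ω + S.L k *ᵥ xBar u y k ω)

variable {S x0 w v}

theorem IsControlled.isRun {x : ℕ → Ω → Blk n → ℝ} {u : ℕ → Ω → Blk q → ℝ}
    {y : ℕ → Ω → Blk p → ℝ} (h : S.IsControlled x0 w v x u y) : S.IsRun x0 w v x u y :=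
  ⟨h.start, h.step, h.output⟩

theorem isRun_free : S.IsRun x0 w v (S.freeState x0 w) (fun _ _ => 0) (S.freeOut x0 w v) where
  start _ := rfl
  step k ω := by rw [mulVec_zero, add_zero]; rfl
  output _ _ := rfl

section Run

variable {x : ℕ → Ω → Blk n → ℝ} {u : ℕ → Ω → Blk q → ℝ} {y : ℕ → Ω → Blk p → ℝ}

/-- The recursion for the two-step estimate appears to use y(k) in its value at k + 1. When u(k)
follows the law, B F y(k) from the input and K1 y(k) from the local estimate are exactly what is
subtracted, so only outputs up to k - 1 remain. -/
theorem xTwo_eq_xBar {k : ℕ} {ω : Ω} (h : ∀ j < k, u j ω = S.law u y j ω) :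
    S.xTwo u y k ω = S.xBar u y k ω := by
  induction k with
  | zero => rfl
  | succ k ih =>
    rw [xTwo, xBar, xLoc, h k k.lt_succ_self, law, ih fun j hj => h j (by omega), innovLoc, innov]
    simp only [mulVec_add, mulVec_sub, add_mulVec, mulVec_mulVec, Matrix.mul_assoc, Matrix.add_mul]
    abel

variable (h : S.IsRun x0 w v x u y)
include h

/-- State and prediction receive the same B u, so their difference obeys a recursion driven by the
noise alone. -/
theorem IsRun.x_eq_xPred_add (k : ℕ) (ω : Ω) : x k ω = S.xPred u y k ω + S.err x0 w v k ω := by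
  induction k with
  | zero => rw [h.start, xPred, err, zero_add]
  | succ k ih =>
    rw [h.step, xPred, err, h.output, ih]
    simp only [mulVec_add, mulVec_sub]
    abel

theorem IsRun.innov_eq (k : ℕ) (ω : Ω) : S.innov u y k ω = S.errInnov x0 w v k ω := by
  rw [innov, errInnov, h.output, h.x_eq_xPred_add, mulVec_add]
  abel

theorem IsRun.prevInnov_eq (k : ℕ) (ω : Ω) : S.prevInnov u y k ω = S.errPrev x0 w v k ω := by
  cases k with
  | zero => rfl
  | succ k => exact h.innov_eq k ω

theorem IsRun.x_eq_xLoc_add (k : ℕ) (ω : Ω) : x k ω = S.xLoc u y k ω + S.errLoc x0 w v k ω := by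
  cases k with
  | zero => rw [h.start, xLoc, errLoc, zero_add]
  | succ k =>
    rw [h.x_eq_xPred_add, xPred, xLoc, errLoc, ← h.innov_eq, sub_mulVec, ← innov]
    abel

theorem IsRun.innovLoc_eq (k : ℕ) (ω : Ω) :
    S.innovLoc u y k ω = S.errInnovLoc x0 w v k ω := by
  rw [innovLoc, errInnovLoc, h.output, h.x_eq_xLoc_add, mulVec_add]
  abel

theorem IsRun.x_eq_xTwo_add (k : ℕ) (ω : Ω) : x k ω = S.xTwo u y k ω + S.errTwo x0 w v k ω := by
  cases k with
  | zero => rw [h.start, xTwo, errTwo, zero_add]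
  | succ k =>
    rw [h.x_eq_xLoc_add, xTwo, errTwo, h.innov_eq]
    abel

/-- The inputs of the run are arbitrary here. The law is affine in the state through the estimates,
and its dependence on x beyond `L x` cancels; `Dg` absorbs the correction that turns the two-step
estimate into the local one. -/
theorem IsRun.law_sub_eq_gap (k : ℕ) (ω : Ω) :
    S.law u y k ω - S.L k *ᵥ x k ω = S.gap x0 w v k ω := by
  rw [law, h.innovLoc_eq, h.prevInnov_eq, h.x_eq_xTwo_add, gap]
  cases k with
  | zero =>
    rw [errTwo, errLoc, xTwo, Dg, errPrev]
    simp
  | succ k =>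
    rw [errTwo, Dg, errPrev]
    simp only [mulVec_add, sub_mulVec, mulVec_mulVec]
    abel

end Run

/-! ### Uncontrolled outputs as linear functions of the innovations. -/

section FreeOutputs

variable {G : Submodule ℝ (Ω → ℝ)}

theorem xPred_free_mem {k : ℕ} (h : ∀ j < k, CoordsIn G (S.errInnov x0 w v j)) :
    CoordsIn G (S.xPred (fun _ _ => 0) (S.freeOut x0 w v) k) := by
  induction k with
  | zero => exact CoordsIn.zero
  | succ k ih =>
    have h1 := ((ih fun j hj => h j (by omega)).mulVec S.A).add
      ((h k k.lt_succ_self).mulVec (S.K k))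
    have heq : S.xPred (fun _ _ => 0) (S.freeOut x0 w v) (k + 1) =
        fun ω => S.A *ᵥ S.xPred (fun _ _ => 0) (S.freeOut x0 w v) k ω
          + S.K k *ᵥ S.errInnov x0 w v k ω := by
      ext1 ω
      rw [xPred, mulVec_zero, add_zero, ← isRun_free.innov_eq, innov]
    rw [heq]
    exact h1

theorem freeOut_eq (k : ℕ) (ω : Ω) : S.freeOut x0 w v k ω =
    S.C *ᵥ S.xPred (fun _ _ => 0) (S.freeOut x0 w v) k ω + S.errInnov x0 w v k ω := by
  rw [← isRun_free.innov_eq, innov]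
  abel

theorem freeOut_eq_loc (k : ℕ) (ω : Ω) : S.freeOut x0 w v k ω =
    S.C *ᵥ S.xLoc (fun _ _ => 0) (S.freeOut x0 w v) k ω + S.errInnovLoc x0 w v k ω := by
  rw [← isRun_free.innovLoc_eq, innovLoc]
  abel

theorem freeOut_mem {k : ℕ} (h : ∀ j ≤ k, CoordsIn G (S.errInnov x0 w v j)) :
    CoordsIn G (S.freeOut x0 w v k) := by
  have h1 := ((xPred_free_mem fun j hj => h j (le_of_lt hj)).mulVec S.C).add (h k le_rfl)
  rw [funext (freeOut_eq (S := S) (x0 := x0) (w := w) (v := v) k)]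
  exact h1

theorem observe_outputsUpTo_free_mem {d k : ℕ}
    (h : ∀ j, j + d ≤ k → CoordsIn G (S.errInnov x0 w v j)) :
    CoordsIn G (observe (outputsUpTo p d k) (S.freeOut x0 w v)) := fun a => by
  have ha : a.1.1 + d ≤ k := a.2
  exact freeOut_mem (fun j hj => h j (by omega)) a.1.2

variable {i : Fin 3} {k : ℕ} (h1 : ∀ j, j + 1 < k → CoordsIn G (S.errInnov x0 w v j))
  (h2 : ∀ j, j + 1 = k → ∀ s : Blk p, Near i s.1 → (fun ω => S.errInnov x0 w v j ω s) ∈ G)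
include h1 h2

/-- An output at time k - 1 is a function of older innovations plus the innovation of the same
player, and a delay of at most one makes that player near. -/
theorem observe_infoPast_free_mem :
    CoordsIn G (observe (infoPast p i k) (S.freeOut x0 w v)) := fun a => by
  obtain ⟨⟨t, s⟩, ha, hb⟩ := a
  replace ha : t + delay s.1 i ≤ k := ha
  replace hb : t + 1 ≤ k := hb
  change (fun ω => S.freeOut x0 w v t ω s) ∈ G
  rcases hb.lt_or_eq with hb | hb
  · exact freeOut_mem (fun j hj => h1 j (by omega)) s
  · rw [funext (freeOut_eq (S := S) (x0 := x0) (w := w) (v := v) t)]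
    exact G.add_mem ((xPred_free_mem fun j hj => h1 j (by omega)).mulVec S.C s)
      (h2 t hb s (near_of_delay_le_one (by omega)))

/-- Besides older innovations, the local estimate of player i uses the last one only through row i
of the sparse gain `K1`. -/
theorem xLoc_free_mem {r : Blk n} (hr : r.1 = i) :
    (fun ω => S.xLoc (fun _ _ => 0) (S.freeOut x0 w v) k ω r) ∈ G := by
  cases k with
  | zero => exact G.zero_mem
  | succ k =>
    have heq : (fun ω => S.xLoc (fun _ _ => 0) (S.freeOut x0 w v) (k + 1) ω r) =
        (fun ω => (S.A *ᵥ S.xPred (fun _ _ => 0) (S.freeOut x0 w v) k ω) r)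
          + fun ω => (S.K1 k *ᵥ S.errInnov x0 w v k ω) r := by
      ext1 ω
      rw [xLoc, mulVec_zero, add_zero, isRun_free.innov_eq]
      rfl
    rw [heq]
    refine G.add_mem ((xPred_free_mem fun j hj => h1 j (by omega)).mulVec S.A r)
      (mulVec_apply_mem _ _ fun s hs => h2 k rfl s ?_)
    by_contra hn
    exact hs (S.K1_apply_eq_zero k (hr ▸ hn))

/-- The only coordinates measured at time k itself are player i's own. They split into C_i times the
local estimate, which is already in G, and the local innovation. -/
theorem observe_info_free_mem
    (h3 : ∀ s : Blk p, s.1 = i → (fun ω => S.errInnovLoc x0 w v k ω s) ∈ G) :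
    CoordsIn G (observe (info p i k) (S.freeOut x0 w v)) := fun a => by
  by_cases hb : a.1 ∈ outputsUpTo p 1 k
  · exact observe_infoPast_free_mem h1 h2 ⟨a.1, a.2, hb⟩
  · obtain ⟨⟨t, s⟩, ha⟩ := a
    replace ha : t + delay s.1 i ≤ k := ha
    replace hb : ¬ t + 1 ≤ k := hb
    obtain rfl : t = k := by omega
    have hs : s.1 = i := eq_of_delay_le_zero (by omega)
    change (fun ω => S.freeOut x0 w v t ω s) ∈ G
    rw [funext (freeOut_eq_loc (S := S) (x0 := x0) (w := w) (v := v) t)]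
    refine G.add_mem (mulVec_apply_mem _ _ fun r hr => xLoc_free_mem h1 h2 ?_) (h3 s hs)
    by_contra hn
    exact hr (S.C_apply_eq_zero (hs ▸ Ne.symm hn))

end FreeOutputs

/-! ### Linear functions of the noise. -/

section Span

/-- The linear functions of the noise. -/
abbrev noiseSpan (x0 : Ω → Blk n → ℝ) (w : ℕ → Ω → Blk n → ℝ) (v : ℕ → Ω → Blk p → ℝ) :
    Submodule ℝ (Ω → ℝ) := Submodule.span ℝ (Set.range (primitive x0 w v))

theorem x0_mem_noiseSpan : CoordsIn (noiseSpan x0 w v) x0 := fun r =>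
  Submodule.subset_span ⟨.inl r, rfl⟩

theorem w_mem_noiseSpan (k : ℕ) : CoordsIn (noiseSpan x0 w v) (w k) := fun r =>
  Submodule.subset_span ⟨.inr (.inl (k, r)), rfl⟩

theorem v_mem_noiseSpan (k : ℕ) : CoordsIn (noiseSpan x0 w v) (v k) := fun r =>
  Submodule.subset_span ⟨.inr (.inr (k, r)), rfl⟩

theorem err_mem_noiseSpan (k : ℕ) : CoordsIn (noiseSpan x0 w v) (S.err x0 w v k) := by
  induction k with
  | zero => exact x0_mem_noiseSpan
  | succ k ih =>
    exact ((ih.mulVec _).add (w_mem_noiseSpan k)).sub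
      (((ih.mulVec _).add (v_mem_noiseSpan k)).mulVec _)

theorem errInnov_mem_noiseSpan (k : ℕ) : CoordsIn (noiseSpan x0 w v) (S.errInnov x0 w v k) :=
  ((err_mem_noiseSpan k).mulVec _).add (v_mem_noiseSpan k)

theorem errPrev_mem_noiseSpan (k : ℕ) : CoordsIn (noiseSpan x0 w v) (S.errPrev x0 w v k) := by
  cases k with
  | zero => exact CoordsIn.zero
  | succ k => exact errInnov_mem_noiseSpan k

theorem errLoc_mem_noiseSpan (k : ℕ) : CoordsIn (noiseSpan x0 w v) (S.errLoc x0 w v k) := by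
  cases k with
  | zero => exact x0_mem_noiseSpan
  | succ k => exact (err_mem_noiseSpan _).add ((errInnov_mem_noiseSpan k).mulVec _)

theorem errInnovLoc_mem_noiseSpan (k : ℕ) :
    CoordsIn (noiseSpan x0 w v) (S.errInnovLoc x0 w v k) :=
  ((errLoc_mem_noiseSpan k).mulVec _).add (v_mem_noiseSpan k)

theorem errTwo_mem_noiseSpan (k : ℕ) : CoordsIn (noiseSpan x0 w v) (S.errTwo x0 w v k) := by
  cases k with
  | zero => exact x0_mem_noiseSpan
  | succ k => exact (errLoc_mem_noiseSpan _).add ((errInnov_mem_noiseSpan k).mulVec _)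

theorem gap_mem_noiseSpan (k : ℕ) : CoordsIn (noiseSpan x0 w v) (S.gap x0 w v k) :=
  (((errInnovLoc_mem_noiseSpan k).mulVec _).add ((errPrev_mem_noiseSpan k).mulVec _)).sub
    ((errLoc_mem_noiseSpan k).mulVec _)

theorem costate_mem_noiseSpan (k : ℕ) : CoordsIn (noiseSpan x0 w v) (S.costate x0 w v k) := by
  refine ((gap_mem_noiseSpan k).mulVec (S.H k)).sub ?_
  split_ifs
  · exact ((gap_mem_noiseSpan (k + 1)).mulVec _).mulVec _
  · exact CoordsIn.zero

theorem freeState_mem_noiseSpan (k : ℕ) : CoordsIn (noiseSpan x0 w v) (S.freeState x0 w k) := by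
  induction k with
  | zero => exact x0_mem_noiseSpan
  | succ k ih => exact (ih.mulVec _).add (w_mem_noiseSpan k)

theorem freeOut_mem_noiseSpan (k : ℕ) : CoordsIn (noiseSpan x0 w v) (S.freeOut x0 w v k) :=
  ((freeState_mem_noiseSpan k).mulVec _).add (v_mem_noiseSpan k)

theorem observe_free_mem_noiseSpan (I : Set (ℕ × Blk p)) :
    CoordsIn (noiseSpan x0 w v) (observe I (S.freeOut x0 w v)) := fun a =>
  freeOut_mem_noiseSpan a.1.1 a.1.2

end Span

/-! ### Errors, gaps and costates are uncorrelated with the available outputs. -/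

section Orthogonality

variable [MeasurableSpace Ω] {μ : Measure Ω} (hn : S.IsNoise μ x0 w v)
include hn

theorem IsNoise.cov_w_free (k : ℕ) :
    HasCov μ (w k) (observe (outputsUpTo p 0 k) (S.freeOut x0 w v)) 0 :=
  hasCov_zero_iff.2 fun r => observe_outputsUpTo_free_mem fun j hj =>
    hasCov_zero_iff.1 ((hn.cov_errInnov_w (by omega)).symm.of_eq transpose_zero) r

theorem IsNoise.cov_err_free (hV : S.V.PosDef) (k : ℕ) :
    HasCov μ (S.err x0 w v k) (observe (outputsUpTo p 1 k) (S.freeOut x0 w v)) 0 :=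
  hasCov_zero_iff.2 fun r => observe_outputsUpTo_free_mem fun j hj =>
    hasCov_zero_iff.1 (hn.cov_err_errInnov_of_lt hV (by omega)) r

theorem IsNoise.cov_errTwo_free (hV : S.V.PosDef) (k : ℕ) :
    HasCov μ (S.errTwo x0 w v k) (observe (outputsUpTo p 2 k) (S.freeOut x0 w v)) 0 :=
  hasCov_zero_iff.2 fun r => observe_outputsUpTo_free_mem fun j hj => by
    refine hasCov_zero_iff.1 ?_ r
    cases k with
    | zero => omega
    | succ k =>
      exact ((hn.cov_errLoc_errInnov hV (by omega)).add_left
        ((hn.cov_errInnov_errInnov_of_lt hV (by omega)).mulVec_left _)).of_eq (by simp)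

theorem IsNoise.cov_gap_free (hV : S.V.PosDef) (k : ℕ) :
    HasCov μ (S.gap x0 w v k) (observe (outputsUpTo p 2 k) (S.freeOut x0 w v)) 0 :=
  hasCov_zero_iff.2 fun r => observe_outputsUpTo_free_mem fun j hj =>
    hasCov_zero_iff.1 (hn.cov_gap_errInnov hV (by omega)) r

theorem IsNoise.cov_errLoc_free (hV : S.V.PosDef) (i : Fin 3) (k : ℕ) :
    HasCov μ (fun ω (a : Fin (n i)) => S.errLoc x0 w v k ω ⟨i, a⟩)
      (observe (infoPast p i k) (S.freeOut x0 w v)) 0 := by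
  refine hasCov_zero_iff.2 fun r => observe_infoPast_free_mem (fun j hj =>
    hasCov_zero_iff.1 (hn.cov_errLoc_errInnov hV (by omega)) ⟨i, r⟩) fun j hj s hs => ?_
  subst hj
  exact (hn.cov_errLoc_errPrev hV (j + 1)).mem_uncorrelated (r := ⟨i, r⟩) (s := s)
    (S.Pt_apply_eq_zero (hn.Yt_posDef hV) j hs)

/-- The stationarity condition for player i: old innovations are handled by whiteness, near ones at
k - 1 by the equations for `F1`, the own local innovation by those for `F`. -/
theorem IsNoise.cov_costate_free (hV : S.V.PosDef) (hH : ∀ k, (S.H k).PosDef) (i : Fin 3) {k : ℕ}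
    (hk : k < S.N) :
    HasCov μ (fun ω (a : Fin (q i)) => S.costate x0 w v k ω ⟨i, a⟩)
      (observe (info p i k) (S.freeOut x0 w v)) 0 := by
  refine hasCov_zero_iff.2 fun r => observe_info_free_mem (fun j hj =>
    hasCov_zero_iff.1 (hn.cov_costate_errInnov hV (by omega)) ⟨i, r⟩) (fun j hj s hs => ?_)
    fun s hs => hn.cov_costate_errInnovLoc hV hH k (r := ⟨i, r⟩) hs
  subst hj
  exact (hn.cov_costate_errPrev hV j).mem_uncorrelated (r := ⟨i, r⟩) (s := s)
    (S.H_mul_gapPrev_apply (hn.Yt_posDef hV) hH (hn.P_transpose hV) hk hs)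

end Orthogonality

end ThreePlayer

namespace ThreePlayer

variable {n q p : Fin 3 → ℕ} {S : ThreePlayer n q p} {Ω : Type*} {x0 : Ω → Blk n → ℝ}
  {w : ℕ → Ω → Blk n → ℝ} {v : ℕ → Ω → Blk p → ℝ}

/-! ### What the estimates and the control law depend on. -/

section Estimators

variable {u : ℕ → Ω → Blk q → ℝ} {y : ℕ → Ω → Blk p → ℝ} {k : ℕ}
  (hu : ∀ j < k, ∀ s, (fun ω => u j ω s) ∈ measurableFun (sigmaOf (info p s.1 j) y))
include hu

theorem xPred_mem_measurableFun :
    CoordsIn (measurableFun (sigmaOf (outputsUpTo p 1 k) y)) (S.xPred u y k) := by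
  induction k with
  | zero => exact CoordsIn.zero
  | succ k ih =>
    have h1 := (ih fun j hj => hu j (by omega)).mono
      (measurableFun_mono (sigmaOf_mono (outputsUpTo_subset (by omega :
        k + 1 ≤ (k + 1) + 1)) y))
    have h2 : CoordsIn (measurableFun (sigmaOf (outputsUpTo p 1 (k + 1)) y)) (u k) := fun s =>
      measurableFun_mono (sigmaOf_mono (info_subset_outputsUpTo (by omega)) y)
        (hu k k.lt_succ_self s)
    have h3 : CoordsIn (measurableFun (sigmaOf (outputsUpTo p 1 (k + 1)) y)) (y k) := fun s =>
      output_mem_measurableFun (a := (k, s)) (le_refl (k + 1))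
    exact ((h1.mulVec S.A).add (h2.mulVec S.B)).add ((h3.sub (h1.mulVec S.C)).mulVec (S.K k))

theorem innov_mem_measurableFun {I : Set (ℕ × Blk p)} (hI : outputsUpTo p 1 k ⊆ I) {s : Blk p}
    (hs : (k, s) ∈ I) : (fun ω => S.innov u y k ω s) ∈ measurableFun (sigmaOf I y) :=
  (measurableFun _).sub_mem (output_mem_measurableFun hs)
    (((xPred_mem_measurableFun hu).mono (measurableFun_mono (sigmaOf_mono hI y))).mulVec S.C s)

theorem prevInnov_mem_measurableFun :
    CoordsIn (measurableFun (sigmaOf (outputsUpTo p 1 k) y)) (S.prevInnov u y k) := by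
  cases k with
  | zero => exact CoordsIn.zero
  | succ k =>
    exact fun s => innov_mem_measurableFun (fun j hj => hu j (by omega))
      (outputsUpTo_subset (by omega)) (le_refl (k + 1))

/-- B is block diagonal and `K1` is sparse, so row i calls only for player i's own last input and
for the last innovations of near players. -/
theorem xLoc_mem_measurableFun (r : Blk n) :
    (fun ω => S.xLoc u y k ω r) ∈ measurableFun (sigmaOf (infoPast p r.1 k) y) := by
  cases k with
  | zero => exact Submodule.zero_mem _
  | succ k =>
    have hsub : outputsUpTo p 1 k ⊆ infoPast p r.1 (k + 1) :=
      (outputsUpTo_subset (by omega)).trans outputsUpTo_subset_infoPast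
    have h1 := (xPred_mem_measurableFun (S := S) (fun j hj => hu j (by omega) :
      ∀ j < k, ∀ s, _)).mono (measurableFun_mono (sigmaOf_mono hsub y))
    refine Submodule.add_mem _ (Submodule.add_mem _ (h1.mulVec S.A r)
      (mulVec_apply_mem _ _ fun s hs => ?_)) (mulVec_apply_mem _ _ fun s hs => ?_)
    · have hrs : r.1 = s.1 := by
        by_contra hne
        exact hs (S.B_apply_eq_zero hne)
      rw [hrs]
      exact measurableFun_mono (sigmaOf_mono info_subset_infoPast y) (hu k k.lt_succ_self s)
    · have hrs : Near r.1 s.1 := by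
        by_contra hne
        exact hs (S.K1_apply_eq_zero k hne)
      have := delay_le_one hrs
      exact innov_mem_measurableFun (fun j hj => hu j (by omega)) hsub
        ⟨by change k + delay s.1 r.1 ≤ k + 1; omega, le_refl (k + 1)⟩

theorem xBar_mem_measurableFun :
    CoordsIn (measurableFun (sigmaOf (outputsUpTo p 2 k) y)) (S.xBar u y k) := by
  induction k with
  | zero => exact CoordsIn.zero
  | succ k ih =>
    have hu' : ∀ j < k, ∀ s, (fun ω => u j ω s) ∈ measurableFun (sigmaOf (info p s.1 j) y) :=
      fun j hj => hu j (by omega)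
    have hsub : outputsUpTo p 1 k ⊆ outputsUpTo p 2 (k + 1) := outputsUpTo_subset (by omega)
    have hle := measurableFun_mono (sigmaOf_mono hsub y)
    have h1 := (xPred_mem_measurableFun (S := S) hu').mono hle
    have h2 := (prevInnov_mem_measurableFun (S := S) hu').mono hle
    have h3 := (ih hu').mono (measurableFun_mono (sigmaOf_mono
      (outputsUpTo_subset (by omega) : outputsUpTo p 2 k ⊆ outputsUpTo p 2 (k + 1)) y))
    have h4 : CoordsIn (measurableFun (sigmaOf (outputsUpTo p 2 (k + 1)) y)) (S.xLoc u y k) :=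
      fun r => hle (measurableFun_mono (sigmaOf_mono Set.inter_subset_right y)
        (xLoc_mem_measurableFun hu' r))
    exact (h1.mulVec S.A).add ((((((h1.sub h4).mulVec S.C).mulVec (S.F k)).add
      (h2.mulVec (S.F1 k))).add (h3.mulVec (S.L k))).mulVec S.B)

/-- Admissibility of the law is a matter of the sparsity of `F`, `F1` and C. The two-step estimate
enters through the full gain `L`, so it must be common knowledge; `xBar` shows that it is. -/
theorem law_mem_measurableFun (hlaw : ∀ j < k, ∀ ω, u j ω = S.law u y j ω) (r : Blk q) :
    (fun ω => S.law u y k ω r) ∈ measurableFun (sigmaOf (info p r.1 k) y) := by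
  have h1 : CoordsIn (measurableFun (sigmaOf (info p r.1 k) y)) (S.xTwo u y k) := by
    have heq : S.xTwo u y k = S.xBar u y k := funext fun ω => xTwo_eq_xBar fun j hj => hlaw j hj ω
    rw [heq]
    exact (xBar_mem_measurableFun hu).mono (measurableFun_mono (sigmaOf_mono
      (outputsUpTo_subset_infoPast.trans Set.inter_subset_left) y))
  refine Submodule.add_mem _ (Submodule.add_mem _ (mulVec_apply_mem _ _ fun s hs => ?_)
    (mulVec_apply_mem _ _ fun s hs => ?_)) (h1.mulVec (S.L k) r)
  · have hrs : s.1 = r.1 := by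
      by_contra hne
      exact hs (S.F_apply_eq_zero k hne)
    refine Submodule.sub_mem _ (output_mem_measurableFun (a := (k, s)) ?_)
      (mulVec_apply_mem _ _ fun t ht => ?_)
    · change k + delay s.1 r.1 ≤ k
      rw [hrs, delay_self, add_zero]
    · have hst : s.1 = t.1 := by
        by_contra hne
        exact ht (S.C_apply_eq_zero hne)
      rw [← hrs, hst]
      exact measurableFun_mono (sigmaOf_mono Set.inter_subset_left y)
        (xLoc_mem_measurableFun hu t)
  · cases k with
    | zero => exact Submodule.zero_mem _
    | succ k =>
      have hrs : Near r.1 s.1 := by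
        by_contra hne
        exact hs (S.F1_apply_eq_zero _ hne)
      have := delay_le_one hrs
      refine innov_mem_measurableFun (fun j hj => hu j (by omega))
        ((outputsUpTo_subset (by omega)).trans
          (outputsUpTo_subset_infoPast.trans Set.inter_subset_left)) ?_
      change k + delay s.1 r.1 ≤ k + 1
      omega

end Estimators

/-! ### Partial nestedness: controls do not change what can be known. -/

section Controlled

variable {x : ℕ → Ω → Blk n → ℝ} {u : ℕ → Ω → Blk q → ℝ} {y : ℕ → Ω → Blk p → ℝ}
  (h : S.IsControlled x0 w v x u y)
include h

theorem IsControlled.input_mem_measurableFun {k : ℕ} (hk : k < S.N) (s : Blk q) :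
    (fun ω => u k ω s) ∈ measurableFun (sigmaOf (info p s.1 k) y) := by
  obtain ⟨f, hf, hfu⟩ := h.control k hk s.1
  rw [show (fun ω => u k ω s) = fun ω => f (observe (info p s.1 k) y ω) s.2 from
    funext fun ω => hfu ω s.2]
  exact (measurable_pi_apply s.2).comp (hf.comp (comap_measurable _))

theorem IsControlled.output_mem_of_state {t : ℕ}
    (ht : ∀ r : Blk n, (fun ω => x t ω r - S.freeState x0 w t ω r) ∈
      measurableFun (sigmaOf (info p r.1 t) (S.freeOut x0 w v))) (s : Blk p) :
    (fun ω => y t ω s) ∈ measurableFun (sigmaOf (info p s.1 t) (S.freeOut x0 w v)) := by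
  have heq : (fun ω => y t ω s) = (fun ω => S.freeOut x0 w v t ω s)
      + fun ω => (S.C *ᵥ (x t ω - S.freeState x0 w t ω)) s := by
    ext1 ω
    rw [h.output]
    simp only [Pi.add_apply, Pi.sub_apply, mulVec_sub, freeOut]
    ring
  rw [heq]
  refine Submodule.add_mem _ (output_mem_measurableFun (a := (t, s)) ?_)
    (mulVec_apply_mem _ _ fun r hr => ?_)
  · change t + delay s.1 s.1 ≤ t
    rw [delay_self, add_zero]
  · have hsr : s.1 = r.1 := by
      by_contra hne
      exact hr (S.C_apply_eq_zero hne)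
    rw [hsr]
    exact ht r

/-- The effect of the controls on the state of a player is a function of the outputs of the
uncontrolled system in the information set of that player. -/
theorem IsControlled.state_mem_measurableFun (t : ℕ) (ht : t ≤ S.N) (r : Blk n) :
    (fun ω => x t ω r - S.freeState x0 w t ω r) ∈
      measurableFun (sigmaOf (info p r.1 t) (S.freeOut x0 w v)) := by
  induction t using Nat.strong_induction_on generalizing r with
  | _ t ih =>
    cases t with
    | zero =>
      have : (fun ω => x 0 ω r - S.freeState x0 w 0 ω r) = 0 := by
        ext1 ω
        rw [h.start, freeState, sub_self, Pi.zero_apply]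
      rw [this]
      exact Submodule.zero_mem _
    | succ t =>
      have heq : (fun ω => x (t + 1) ω r - S.freeState x0 w (t + 1) ω r) =
          (fun ω => (S.A *ᵥ (x t ω - S.freeState x0 w t ω)) r)
            + fun ω => (S.B *ᵥ u t ω) r := by
        ext1 ω
        rw [h.step, freeState]
        simp only [Pi.add_apply, Pi.sub_apply, mulVec_sub]
        ring
      rw [heq]
      refine Submodule.add_mem _ (mulVec_apply_mem _ _ fun m hm => ?_)
        (mulVec_apply_mem _ _ fun s hs => ?_)
      · have hrm : Near r.1 m.1 := by
          by_contra hne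
          exact hm (S.A_sparse _ _ hne)
        have := delay_le_one hrm
        exact measurableFun_mono (sigmaOf_mono (info_subset_info (by omega)) _)
          (ih t t.lt_succ_self (by omega) m)
      · have hrs : r.1 = s.1 := by
          by_contra hne
          exact hs (S.B_apply_eq_zero hne)
        rw [hrs]
        -- The input of a player depends on the outputs of other players at earlier times, so the
        -- strong induction hypothesis is applied at each time in the information set.
        refine measurableFun_mono ?_ (h.input_mem_measurableFun (by omega : t < S.N) s)
        refine sigmaOf_le fun a ha => ?_
        replace ha : a.1 + delay a.2.1 s.1 ≤ t := ha
        refine measurableFun_mono (sigmaOf_mono (info_subset_info (by omega)) _)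
          (h.output_mem_of_state (t := a.1) (fun r' => ih a.1 (by omega) (by omega) r') a.2)

theorem IsControlled.output_mem_measurableFun {t : ℕ} (ht : t ≤ S.N) (s : Blk p) :
    (fun ω => y t ω s) ∈ measurableFun (sigmaOf (info p s.1 t) (S.freeOut x0 w v)) :=
  h.output_mem_of_state (h.state_mem_measurableFun t ht) s

/-- The information pattern is partially nested: the outputs in an information set are functions
of the outputs of the uncontrolled system in that set. -/
theorem IsControlled.sigmaOf_le_free {I : Set (ℕ × Blk p)}
    (hI : ∀ a ∈ I, a.1 ≤ S.N ∧ info p a.2.1 a.1 ⊆ I) :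
    sigmaOf I y ≤ sigmaOf I (S.freeOut x0 w v) :=
  sigmaOf_le fun a ha => measurableFun_mono (sigmaOf_mono (hI a ha).2 _)
    (h.output_mem_measurableFun (hI a ha).1 a.2)

theorem IsControlled.sigmaOf_info_le_free (i : Fin 3) {k : ℕ} (hk : k ≤ S.N) :
    sigmaOf (info p i k) y ≤ sigmaOf (info p i k) (S.freeOut x0 w v) :=
  h.sigmaOf_le_free fun a (ha : a.1 + delay a.2.1 i ≤ k) =>
    ⟨by omega, info_subset_info ha⟩

theorem IsControlled.sigmaOf_outputsUpTo_le_free (d : ℕ) {k : ℕ} (hk : k ≤ S.N) :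
    sigmaOf (outputsUpTo p d k) y ≤ sigmaOf (outputsUpTo p d k) (S.freeOut x0 w v) :=
  h.sigmaOf_le_free fun a (ha : a.1 + d ≤ k) =>
    ⟨by omega, info_subset_outputsUpTo ha⟩

theorem IsControlled.sigmaOf_infoPast_le_free (i : Fin 3) {k : ℕ} (hk : k ≤ S.N) :
    sigmaOf (infoPast p i k) y ≤ sigmaOf (infoPast p i k) (S.freeOut x0 w v) :=
  h.sigmaOf_le_free fun a ha => by
    have h1 : a.1 + delay a.2.1 i ≤ k := ha.1
    have h2 : a.1 + 1 ≤ k := ha.2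
    exact ⟨by omega, Set.subset_inter (info_subset_info h1) (info_subset_outputsUpTo h2)⟩

end Controlled

/-! ### The optimal run, constructed from the noise. -/

section OptimalRun

variable (S x0 w v)

/-- The state under the optimal controller. -/
noncomputable def optState : ℕ → Ω → Blk n → ℝ
  | 0, ω => x0 ω
  | k + 1, ω => S.A *ᵥ optState k ω + S.B *ᵥ (S.L k *ᵥ optState k ω + S.gap x0 w v k ω) + w k ω

/-- The input of the optimal controller. -/
noncomputable def optInput (k : ℕ) (ω : Ω) : Blk q → ℝ :=
  S.L k *ᵥ S.optState x0 w v k ω + S.gap x0 w v k ω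

/-- The output under the optimal controller. -/
noncomputable def optOutput (k : ℕ) (ω : Ω) : Blk p → ℝ := S.C *ᵥ S.optState x0 w v k ω + v k ω

theorem isRun_opt :
    S.IsRun x0 w v (S.optState x0 w v) (S.optInput x0 w v) (S.optOutput x0 w v) where
  start _ := rfl
  step _ _ := rfl
  output _ _ := rfl

/-- Defining the input as `L x + gap` avoids solving the closed loop. That it obeys the feedback law
follows because `law_sub_eq_gap` holds for every run, in particular for this one. -/
theorem optInput_eq_law (k : ℕ) (ω : Ω) :
    S.optInput x0 w v k ω = S.law (S.optInput x0 w v) (S.optOutput x0 w v) k ω := by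
  have h := (S.isRun_opt x0 w v).law_sub_eq_gap k ω
  rw [sub_eq_iff_eq_add] at h
  rw [h, optInput, add_comm]

theorem optInput_mem_measurableFun (k : ℕ) (s : Blk q) : (fun ω => S.optInput x0 w v k ω s) ∈
    measurableFun (sigmaOf (info p s.1 k) (S.optOutput x0 w v)) := by
  induction k using Nat.strong_induction_on generalizing s with
  | _ k ih =>
    rw [funext (S.optInput_eq_law x0 w v k)]
    exact law_mem_measurableFun (fun j hj s => ih j hj s)
      (fun j _ ω => S.optInput_eq_law x0 w v j ω) s

theorem isControlled_opt :
    S.IsControlled x0 w v (S.optState x0 w v) (S.optInput x0 w v) (S.optOutput x0 w v) where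
  start _ := rfl
  step _ _ := rfl
  output _ _ := rfl
  control k _ i := by
    have hm : Measurable[sigmaOf (info p i k) (S.optOutput x0 w v)]
        fun ω (a : Fin (q i)) => S.optInput x0 w v k ω ⟨i, a⟩ :=
      @measurable_pi_lambda _ _ _ (_) _ _ fun a => S.optInput_mem_measurableFun x0 w v k ⟨i, a⟩
    -- Doob–Dynkin factorization: measurability with respect to the information set yields the Borel
    -- control function.
    obtain ⟨f, hf, hfu⟩ := Measurable.exists_eq_measurable_comp
      (f := observe (info p i k) (S.optOutput x0 w v)) hm
    exact ⟨f, hf, fun ω a => congrFun (congrFun hfu ω) a⟩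

theorem optState_mem_noiseSpan (k : ℕ) :
    CoordsIn (noiseSpan x0 w v) (S.optState x0 w v k) := by
  induction k with
  | zero => exact x0_mem_noiseSpan
  | succ k ih =>
    exact ((ih.mulVec _).add (((ih.mulVec _).add (gap_mem_noiseSpan k)).mulVec _)).add
      (w_mem_noiseSpan k)

theorem optInput_mem_noiseSpan (k : ℕ) :
    CoordsIn (noiseSpan x0 w v) (S.optInput x0 w v k) :=
  ((S.optState_mem_noiseSpan x0 w v k).mulVec _).add (gap_mem_noiseSpan k)

end OptimalRun

end ThreePlayer

/-! ### Square integrable random vectors. -/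

section SquareIntegrable

variable {Ω ι κ : Type*} [MeasurableSpace Ω] {μ : Measure Ω}

/-- The square integrable random variables. -/
def squareIntegrable (μ : Measure Ω) : Submodule ℝ (Ω → ℝ) where
  carrier := {f | MemLp f 2 μ}
  add_mem' := fun hf hg => MemLp.add hf hg
  zero_mem' := MemLp.zero
  smul_mem' := fun c _ hf => MemLp.const_smul hf c

theorem integrable_dotProduct [Fintype ι] {X Y : Ω → ι → ℝ}
    (hX : CoordsIn (squareIntegrable μ) X) (hY : CoordsIn (squareIntegrable μ) Y) :
    Integrable (fun ω => X ω ⬝ᵥ Y ω) μ :=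
  integrable_finsetSum _ fun r _ => MemLp.integrable_mul (hX r) (hY r)

theorem integral_dotProduct [Fintype ι] {X Y : Ω → ι → ℝ}
    (hX : CoordsIn (squareIntegrable μ) X) (hY : CoordsIn (squareIntegrable μ) Y) :
    ∫ ω, X ω ⬝ᵥ Y ω ∂μ = ∑ r, ∫ ω, X ω r * Y ω r ∂μ := by
  have h : ∀ r ∈ Finset.univ, Integrable (fun ω => X ω r * Y ω r) μ := fun r _ =>
    MemLp.integrable_mul (hX r) (hY r)
  exact integral_finsetSum _ h

omit [MeasurableSpace Ω] in
theorem CoordsIn.sumElim {G : Submodule ℝ (Ω → ℝ)} {X : Ω → ι → ℝ} {Y : Ω → κ → ℝ}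
    (hX : CoordsIn G X) (hY : CoordsIn G Y) : CoordsIn G (fun ω => Sum.elim (X ω) (Y ω)) := by
  rintro (r | r)
  · exact hX r
  · exact hY r

open scoped MatrixOrder Matrix.Norms.L2Operator in
theorem Matrix.PosSemidef.exists_eq_transpose_mul_self [Fintype ι] [DecidableEq ι]
    {M : Matrix ι ι ℝ} (hM : M.PosSemidef) : ∃ T : Matrix ι ι ℝ, M = Tᵀ * T := by
  obtain ⟨T, hT⟩ := CStarAlgebra.nonneg_iff_eq_star_mul_self.mp hM.nonneg
  exact ⟨T, hT⟩

/-- A random vector with an integrable quadratic form is square integrable after the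
transformation by a root of the matrix of the form. -/
theorem mulVec_mem_squareIntegrable [Fintype ι] {T : Matrix ι ι ℝ} {X : Ω → ι → ℝ}
    (hX : ∀ r, Measurable fun ω => X ω r)
    (h : ∫⁻ ω, ENNReal.ofReal (X ω ⬝ᵥ (Tᵀ * T) *ᵥ X ω) ∂μ < ⊤) :
    CoordsIn (squareIntegrable μ) fun ω => T *ᵥ X ω := fun r => by
  have hm : Measurable fun ω => (T *ᵥ X ω) r := by
    simp only [Matrix.mulVec, dotProduct]
    fun_prop
  change MemLp _ 2 μ
  rw [memLp_two_iff_integrable_sq hm.aestronglyMeasurable]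
  refine ⟨(hm.pow_const 2).aestronglyMeasurable, ?_⟩
  rw [hasFiniteIntegral_iff_ofReal (Filter.Eventually.of_forall fun ω => sq_nonneg _)]
  refine lt_of_le_of_lt (lintegral_mono fun ω => ENNReal.ofReal_le_ofReal ?_) h
  rw [← mulVec_mulVec, dotProduct_transpose_mulVec', sq]
  exact Finset.single_le_sum (f := fun i => (T *ᵥ X ω) i * (T *ᵥ X ω) i)
    (fun i _ => mul_self_nonneg _) (Finset.mem_univ r)

end SquareIntegrable

/-! ### The cost excess over the optimal run. -/

namespace ThreePlayer

variable {n q p : Fin 3 → ℕ} {S : ThreePlayer n q p}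

/-- Summation of the completed squares along two runs. -/
theorem sum_stage_completion (hQ0 : S.Q0.PosSemidef) (hQ : S.Q.PosSemidef)
    (hQuu : S.Quu.PosDef) {a b : ℕ → Blk n → ℝ} {c e : ℕ → Blk q → ℝ} {w : ℕ → Blk n → ℝ}
    (ha : ∀ k, a (k + 1) = S.A *ᵥ a k + S.B *ᵥ c k + w k)
    (hb : ∀ k, b (k + 1) = S.A *ᵥ b k + S.B *ᵥ e k) (hb0 : b 0 = 0) :
    ∑ k ∈ Finset.range S.N, Sum.elim (a k) (c k) ⬝ᵥ S.Q *ᵥ Sum.elim (b k) (e k)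
        + a S.N ⬝ᵥ S.Q0 *ᵥ b S.N
      = ∑ k ∈ Finset.range S.N, ((c k - S.L k *ᵥ a k) ⬝ᵥ S.H k *ᵥ (e k - S.L k *ᵥ b k)
        + w k ⬝ᵥ S.Ric (k + 1) *ᵥ b (k + 1)) := by
  -- The stage identity telescopes with the Riccati form as value at the running end time; at m = N
  -- this is the terminal cost.
  have key : ∀ m ≤ S.N,
      ∑ k ∈ Finset.range m, Sum.elim (a k) (c k) ⬝ᵥ S.Q *ᵥ Sum.elim (b k) (e k)
        + a m ⬝ᵥ S.Ric m *ᵥ b m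
      = ∑ k ∈ Finset.range m, ((c k - S.L k *ᵥ a k) ⬝ᵥ S.H k *ᵥ (e k - S.L k *ᵥ b k)
        + w k ⬝ᵥ S.Ric (k + 1) *ᵥ b (k + 1)) := by
    intro m hm
    induction m with
    | zero => simp [hb0]
    | succ m ih =>
      rw [Finset.sum_range_succ, Finset.sum_range_succ, ← ih (by omega)]
      have h1 := S.stage_completion hQ0 hQ hQuu (by omega : m < S.N) (a m) (b m) (c m) (e m)
      rw [← hb] at h1
      rw [ha, add_dotProduct]
      linarith
  have h := key S.N le_rfl
  rwa [show S.Ric S.N = S.Q0 by rw [Ric, if_neg (lt_irrefl _)]] at h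

section Optimality

variable {Ω : Type*} [MeasurableSpace Ω] {μ : Measure Ω} {x0 : Ω → Blk n → ℝ}
  {w : ℕ → Ω → Blk n → ℝ} {v : ℕ → Ω → Blk p → ℝ}

/-- The cost of a run, as a random variable. -/
noncomputable def pathCost (S : ThreePlayer n q p) (x : ℕ → Ω → Blk n → ℝ)
    (u : ℕ → Ω → Blk q → ℝ) (ω : Ω) : ℝ :=
  (∑ k ∈ Finset.range S.N, Sum.elim (x k ω) (u k ω) ⬝ᵥ S.Q *ᵥ Sum.elim (x k ω) (u k ω))
    + x S.N ω ⬝ᵥ S.Q0 *ᵥ x S.N ω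

omit [MeasurableSpace Ω] in
theorem pathCost_nonneg (hQ0 : S.Q0.PosSemidef) (hQ : S.Q.PosSemidef) (x : ℕ → Ω → Blk n → ℝ)
    (u : ℕ → Ω → Blk q → ℝ) (ω : Ω) : 0 ≤ S.pathCost x u ω :=
  add_nonneg (Finset.sum_nonneg fun _ _ => hQ.dotProduct_nonneg _) (hQ0.dotProduct_nonneg _)

theorem integrable_pathCost {x : ℕ → Ω → Blk n → ℝ} {u : ℕ → Ω → Blk q → ℝ}
    (hx : ∀ k ≤ S.N, CoordsIn (squareIntegrable μ) (x k))
    (hu : ∀ k < S.N, CoordsIn (squareIntegrable μ) (u k)) : Integrable (S.pathCost x u) μ := by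
  refine Integrable.add (integrable_finsetSum _ fun k hk => ?_)
    (integrable_dotProduct (hx _ le_rfl) ((hx _ le_rfl).mulVec _))
  rw [Finset.mem_range] at hk
  have := (hx k hk.le).sumElim (hu k hk)
  exact integrable_dotProduct this (this.mulVec _)

theorem cost_eq_ofReal (hQ0 : S.Q0.PosSemidef) (hQ : S.Q.PosSemidef) {x : ℕ → Ω → Blk n → ℝ}
    {u : ℕ → Ω → Blk q → ℝ} (hx : ∀ k ≤ S.N, CoordsIn (squareIntegrable μ) (x k))
    (hu : ∀ k < S.N, CoordsIn (squareIntegrable μ) (u k)) :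
    S.cost μ x u = ENNReal.ofReal (∫ ω, S.pathCost x u ω ∂μ) :=
  (ofReal_integral_eq_lintegral_ofReal (integrable_pathCost hx hu)
    (Filter.Eventually.of_forall (pathCost_nonneg hQ0 hQ x u))).symm

variable (hn : S.IsNoise μ x0 w v)
include hn

theorem IsNoise.measurable_primitive (a) : Measurable (primitive x0 w v a) := by
  rcases a with r | a | a
  · exact (measurable_pi_apply r).comp hn.measurable_x0
  · exact (measurable_pi_apply a.2).comp (hn.measurable_w a.1)
  · exact (measurable_pi_apply a.2).comp (hn.measurable_v a.1)

theorem IsNoise.squareIntegrable_of_mem {ι : Type*} {X : Ω → ι → ℝ}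
    (hX : CoordsIn (noiseSpan x0 w v) X) : CoordsIn (squareIntegrable μ) X := fun r =>
  memLp_two_of_mem_span hn.gaussian (hX r)

theorem IsNoise.sigmaOf_free_le (I : Set (ℕ × Blk p)) :
    sigmaOf I (S.freeOut x0 w v) ≤ ‹MeasurableSpace Ω› :=
  sigmaOf_le fun a _ => measurable_of_mem_span hn.measurable_primitive
    (freeOut_mem_noiseSpan a.1 a.2)

/-- Linear functions of the noise that are uncorrelated with the outputs in `I` are orthogonal to
the functions of these outputs. -/
theorem IsNoise.integral_dotProduct_eq_zero [IsProbabilityMeasure μ] {ι : Type*} [Fintype ι]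
    {I : Set (ℕ × Blk p)} {X Y : Ω → ι → ℝ} (hX : CoordsIn (noiseSpan x0 w v) X)
    (hcov : HasCov μ X (observe I (S.freeOut x0 w v)) 0)
    (hYm : CoordsIn (measurableFun (sigmaOf I (S.freeOut x0 w v))) Y)
    (hY : CoordsIn (squareIntegrable μ) Y) : ∫ ω, X ω ⬝ᵥ Y ω ∂μ = 0 := by
  rw [integral_dotProduct (hn.squareIntegrable_of_mem hX) hY]
  exact Finset.sum_eq_zero fun r _ => integral_mul_eq_zero_of_hasCov_zero hn.gaussian hn.mean_zero
    hX (observe_free_mem_noiseSpan I) (fun a => measurable_of_mem_span hn.measurable_primitive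
      (observe_free_mem_noiseSpan I a)) hcov (hYm r) r

variable {x : ℕ → Ω → Blk n → ℝ} {u : ℕ → Ω → Blk q → ℝ} {y : ℕ → Ω → Blk p → ℝ}
  (h : S.IsControlled x0 w v x u y)
include h

theorem IsNoise.measurable_input {k : ℕ} (hk : k < S.N) (s : Blk q) :
    Measurable fun ω => u k ω s :=
  (measurableFun_mono ((h.sigmaOf_info_le_free s.1 hk.le).trans (hn.sigmaOf_free_le _))
    (h.input_mem_measurableFun hk s) :)

theorem IsNoise.measurable_state {k : ℕ} (hk : k ≤ S.N) (r : Blk n) :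
    Measurable fun ω => x k ω r := by
  have h1 : Measurable fun ω => x k ω r - S.freeState x0 w k ω r :=
    measurableFun_mono (hn.sigmaOf_free_le _) (h.state_mem_measurableFun k hk r)
  have h2 : Measurable fun ω => S.freeState x0 w k ω r :=
    measurable_of_mem_span hn.measurable_primitive (freeState_mem_noiseSpan k r)
  have heq : (fun ω => x k ω r) = (fun ω => x k ω r - S.freeState x0 w k ω r)
      + fun ω => S.freeState x0 w k ω r := by
    ext ω
    simp
  exact heq ▸ h1.add h2

theorem IsNoise.state_mem_of_input (hu : ∀ k < S.N, CoordsIn (squareIntegrable μ) (u k)) {k : ℕ}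
    (hk : k ≤ S.N) : CoordsIn (squareIntegrable μ) (x k) := by
  induction k with
  | zero =>
    rw [funext h.start]
    exact hn.squareIntegrable_of_mem x0_mem_noiseSpan
  | succ k ih =>
    rw [funext (h.step k)]
    exact (((ih (by omega)).mulVec _).add ((hu k hk).mulVec _)).add
      (hn.squareIntegrable_of_mem (w_mem_noiseSpan k))

/-- The inputs of a controller with finite cost are square integrable. -/
theorem IsNoise.input_mem_of_cost_lt_top (hQ0 : S.Q0.PosSemidef) (hQ : S.Q.PosSemidef)
    (hQuu : S.Quu.PosDef) (hfin : S.cost μ x u < ⊤) (k : ℕ) (hk : k < S.N) :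
    CoordsIn (squareIntegrable μ) (u k) := by
  induction k using Nat.strong_induction_on with
  | _ k ih =>
    have hx : ∀ j ≤ k, CoordsIn (squareIntegrable μ) (x j) := by
      intro j hj
      induction j with
      | zero =>
        rw [funext h.start]
        exact hn.squareIntegrable_of_mem x0_mem_noiseSpan
      | succ j ihj =>
        rw [funext (h.step j)]
        exact (((ihj (by omega)).mulVec _).add ((ih j (by omega) (by omega)).mulVec _)).add
          (hn.squareIntegrable_of_mem (w_mem_noiseSpan j))
    obtain ⟨T, hT⟩ := hQ.exists_eq_transpose_mul_self
    have hz : CoordsIn (squareIntegrable μ) fun ω => T *ᵥ Sum.elim (x k ω) (u k ω) := by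
      refine mulVec_mem_squareIntegrable ?_ (lt_of_le_of_lt (lintegral_mono fun ω => ?_) hfin)
      · rintro (r | r)
        · exact hn.measurable_state h hk.le r
        · exact hn.measurable_input h hk r
      · refine ENNReal.ofReal_le_ofReal ?_
        rw [← hT]
        exact (Finset.single_le_sum (f := fun k => Sum.elim (x k ω) (u k ω) ⬝ᵥ
          S.Q *ᵥ Sum.elim (x k ω) (u k ω)) (fun j _ => hQ.dotProduct_nonneg _)
          (Finset.mem_range.2 hk)).trans (le_add_of_nonneg_right (hQ0.dotProduct_nonneg _))
    have hTuu : S.Quu = T.toCols₂ᵀ * T.toCols₂ := by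
      ext r s
      rw [Quu, hT]
      rfl
    -- Finite cost controls T(x, u) with TᵀT = Q, and x(k) is already square integrable. Removing
    -- the x-part leaves T₂ u, from which u is recovered since T₂ᵀT₂ = Quu is invertible, although Q
    -- itself may be singular.
    have heq : u k = fun ω => S.Quu⁻¹ *ᵥ (T.toCols₂ᵀ *ᵥ (T *ᵥ Sum.elim (x k ω) (u k ω)
        - T.toCols₁ *ᵥ x k ω)) := by
      ext1 ω
      have h1 : T *ᵥ Sum.elim (x k ω) (u k ω) = T.toCols₁ *ᵥ x k ω + T.toCols₂ *ᵥ u k ω := by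
        conv_lhs => rw [← fromCols_toCols T]
        rw [fromCols_mulVec]
        simp
      rw [h1, add_sub_cancel_left, mulVec_mulVec _ T.toCols₂ᵀ, ← hTuu, mulVec_mulVec,
        hQuu.inv_mul_cancel, one_mulVec]
    rw [heq]
    exact ((hz.sub ((hx k le_rfl).mulVec _)).mulVec _).mulVec _

omit [MeasurableSpace Ω] hn in
/-- The deviation of the state from the optimal one is a function of past outputs. -/
theorem IsControlled.state_sub_opt_mem {k : ℕ} (hk : k ≤ S.N) :
    CoordsIn (measurableFun (sigmaOf (outputsUpTo p 1 k) (S.freeOut x0 w v)))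
      fun ω => x k ω - S.optState x0 w v k ω := by
  induction k with
  | zero =>
    have : (fun ω => x 0 ω - S.optState x0 w v 0 ω) = fun _ => 0 := by
      ext1 ω
      rw [h.start, optState, sub_self]
    rw [this]
    exact CoordsIn.zero
  | succ k ih =>
    have heq : (fun ω => x (k + 1) ω - S.optState x0 w v (k + 1) ω) = fun ω =>
        S.A *ᵥ (x k ω - S.optState x0 w v k ω) + S.B *ᵥ (u k ω - S.optInput x0 w v k ω) := by
      ext1 ω
      rw [h.step, (S.isRun_opt x0 w v).step]
      simp only [mulVec_sub]
      abel
    rw [heq]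
    have hu : ∀ {x u y}, S.IsControlled x0 w v x u y →
        CoordsIn (measurableFun (sigmaOf (outputsUpTo p 1 (k + 1)) (S.freeOut x0 w v))) (u k) :=
      fun h s => measurableFun_mono ((h.sigmaOf_info_le_free s.1 (by omega)).trans
        (sigmaOf_mono (info_subset_outputsUpTo le_rfl) _)) (h.input_mem_measurableFun hk s)
    exact (((ih (by omega)).mono (measurableFun_mono (sigmaOf_mono
      (outputsUpTo_subset (by omega)) _))).mulVec _).add
      (((hu h).sub (hu (S.isControlled_opt x0 w v))).mulVec _)

omit [MeasurableSpace Ω] hn in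
theorem IsControlled.input_sub_opt_mem {k : ℕ} (hk : k < S.N) (s : Blk q) :
    (fun ω => u k ω s - S.optInput x0 w v k ω s) ∈
      measurableFun (sigmaOf (info p s.1 k) (S.freeOut x0 w v)) := by
  have hu : ∀ {x u y}, S.IsControlled x0 w v x u y →
      (fun ω => u k ω s) ∈ measurableFun (sigmaOf (info p s.1 k) (S.freeOut x0 w v)) :=
    fun h => measurableFun_mono (h.sigmaOf_info_le_free s.1 hk.le) (h.input_mem_measurableFun hk s)
  exact Submodule.sub_mem _ (hu h) (hu (S.isControlled_opt x0 w v))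

variable [IsProbabilityMeasure μ] (hu : ∀ k < S.N, CoordsIn (squareIntegrable μ) (u k))
include hu

/-- Each coordinate of the deviation belongs to one player and is a Borel function of the
uncontrolled outputs in that player's information set, so the orthogonality is applied coordinate by
coordinate. -/
theorem IsNoise.integral_costate_eq_zero (hV : S.V.PosDef) (hH : ∀ k, (S.H k).PosDef) {k : ℕ}
    (hk : k < S.N) :
    ∫ ω, S.costate x0 w v k ω ⬝ᵥ (u k ω - S.optInput x0 w v k ω) ∂μ = 0 := by
  have hd := (hu k hk).sub (hn.squareIntegrable_of_mem (S.optInput_mem_noiseSpan x0 w v k))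
  have hc := costate_mem_noiseSpan (S := S) (x0 := x0) (w := w) (v := v) k
  rw [integral_dotProduct (hn.squareIntegrable_of_mem hc) hd]
  refine Finset.sum_eq_zero fun r _ => ?_
  exact integral_mul_eq_zero_of_hasCov_zero hn.gaussian hn.mean_zero
    (X := fun ω (a : Fin (q r.1)) => S.costate x0 w v k ω ⟨r.1, a⟩) (fun a => hc _)
    (observe_free_mem_noiseSpan _) (fun a => measurable_of_mem_span hn.measurable_primitive
      (observe_free_mem_noiseSpan _ a)) (hn.cov_costate_free hV hH r.1 hk)
    (h.input_sub_opt_mem hk r) r.2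

/-- The deviation of the state at k + 1 is a function of uncontrolled outputs up to k, which do not
yet contain w(k). -/
theorem IsNoise.integral_noise_eq_zero {k : ℕ} (hk : k < S.N) :
    ∫ ω, w k ω ⬝ᵥ S.Ric (k + 1) *ᵥ (x (k + 1) ω - S.optState x0 w v (k + 1) ω) ∂μ = 0 :=
  hn.integral_dotProduct_eq_zero (w_mem_noiseSpan k) (hn.cov_w_free k)
    (((h.state_sub_opt_mem hk).mono (measurableFun_mono (sigmaOf_mono
      (outputsUpTo_subset (by omega)) _))).mulVec _)
    (((hn.state_mem_of_input h hu hk).sub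
      (hn.squareIntegrable_of_mem (S.optState_mem_noiseSpan x0 w v _))).mulVec _)

/-- In the dynamics of the state deviation, the part from time k depends on uncontrolled outputs up
to k - 1 only, two steps before the gap, hence is orthogonal to it. -/
theorem IsNoise.integral_gap_eq (hV : S.V.PosDef) {k : ℕ} (hk : k + 1 < S.N) :
    ∫ ω, S.gap x0 w v (k + 1) ω ⬝ᵥ S.H (k + 1) *ᵥ (S.L (k + 1) *ᵥ
        (x (k + 1) ω - S.optState x0 w v (k + 1) ω)) ∂μ
      = ∫ ω, S.gap x0 w v (k + 1) ω ⬝ᵥ S.H (k + 1) *ᵥ ((S.L (k + 1) * S.B) *ᵥ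
        (u k ω - S.optInput x0 w v k ω)) ∂μ := by
  have hg := hn.squareIntegrable_of_mem
    (gap_mem_noiseSpan (S := S) (x0 := x0) (w := w) (v := v) (k + 1))
  have hdx := (hn.state_mem_of_input h hu (by omega : k ≤ S.N)).sub
    (hn.squareIntegrable_of_mem (S.optState_mem_noiseSpan x0 w v k))
  have hdu := (hu k (by omega)).sub
    (hn.squareIntegrable_of_mem (S.optInput_mem_noiseSpan x0 w v k))
  have heq : ∀ ω, S.gap x0 w v (k + 1) ω ⬝ᵥ S.H (k + 1) *ᵥ (S.L (k + 1) *ᵥ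
        (x (k + 1) ω - S.optState x0 w v (k + 1) ω)) =
      S.gap x0 w v (k + 1) ω ⬝ᵥ S.H (k + 1) *ᵥ (S.L (k + 1) *ᵥ (S.A *ᵥ
        (x k ω - S.optState x0 w v k ω)))
      + S.gap x0 w v (k + 1) ω ⬝ᵥ S.H (k + 1) *ᵥ ((S.L (k + 1) * S.B) *ᵥ
        (u k ω - S.optInput x0 w v k ω)) := by
    intro ω
    rw [h.step, (S.isRun_opt x0 w v).step, ← dotProduct_add]
    congr 1
    simp only [mulVec_sub, mulVec_add, mulVec_mulVec]
    abel
  simp only [heq]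
  rw [integral_add (integrable_dotProduct hg (((hdx.mulVec _).mulVec _).mulVec _))
    (integrable_dotProduct hg ((hdu.mulVec _).mulVec _)),
    hn.integral_dotProduct_eq_zero (gap_mem_noiseSpan (k + 1)) (hn.cov_gap_free hV (k + 1))
      (((((h.state_sub_opt_mem (by omega)).mono (measurableFun_mono (sigmaOf_mono
        (outputsUpTo_subset (by omega)) _))).mulVec _).mulVec _).mulVec _)
      (((hdx.mulVec _).mulVec _).mulVec _), zero_add]

/-- The first variation of the cost at the optimal controller vanishes. -/
theorem IsNoise.integral_sum_gap_eq_zero (hV : S.V.PosDef) (hH : ∀ k, (S.H k).PosDef) :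
    ∑ k ∈ Finset.range S.N, ∫ ω, S.gap x0 w v k ω ⬝ᵥ S.H k *ᵥ ((u k ω - S.optInput x0 w v k ω)
      - S.L k *ᵥ (x k ω - S.optState x0 w v k ω)) ∂μ = 0 := by
  have hg := fun k => hn.squareIntegrable_of_mem
    (gap_mem_noiseSpan (S := S) (x0 := x0) (w := w) (v := v) k)
  have hdx := fun k (hk : k < S.N) => (hn.state_mem_of_input h hu hk.le).sub
    (hn.squareIntegrable_of_mem (S.optState_mem_noiseSpan x0 w v k))
  have hdu := fun k (hk : k < S.N) => (hu k hk).sub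
    (hn.squareIntegrable_of_mem (S.optInput_mem_noiseSpan x0 w v k))
  set a : ℕ → ℝ := fun k => ∫ ω, S.gap x0 w v k ω ⬝ᵥ S.H k *ᵥ
    (u k ω - S.optInput x0 w v k ω) ∂μ with ha
  set c : ℕ → ℝ := fun k => ∫ ω, S.gap x0 w v k ω ⬝ᵥ S.H k *ᵥ (S.L k *ᵥ
    (x k ω - S.optState x0 w v k ω)) ∂μ with hc
  have h1 : ∀ k ∈ Finset.range S.N, ∫ ω, S.gap x0 w v k ω ⬝ᵥ S.H k *ᵥ
      ((u k ω - S.optInput x0 w v k ω) - S.L k *ᵥ (x k ω - S.optState x0 w v k ω)) ∂μ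
      = a k - c k := by
    intro k hk
    rw [Finset.mem_range] at hk
    rw [ha, hc, ← integral_sub (integrable_dotProduct (hg k) ((hdu k hk).mulVec _))
      (integrable_dotProduct (hg k) (((hdx k hk).mulVec _).mulVec _))]
    simp only [mulVec_sub, dotProduct_sub]
  -- Stationarity in the form of a shift: the direct effect of the input at k is cancelled by its
  -- effect on the state at k + 1.
  have h2 : ∀ k < S.N, a k = if k + 1 < S.N then c (k + 1) else 0 := by
    intro k hk
    have h3 := hn.integral_costate_eq_zero h hu hV hH hk
    split_ifs with hk1
    · rw [hc]
      simp only
      rw [hn.integral_gap_eq h hu hV hk1, ← sub_eq_zero, ← h3, ha, ← integral_sub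
        (integrable_dotProduct (hg k) ((hdu k hk).mulVec _))
        (integrable_dotProduct (hg (k + 1)) (((hdu k hk).mulVec _).mulVec _))]
      refine integral_congr_ae (Filter.Eventually.of_forall fun ω => ?_)
      simp only [costate, if_pos hk1, sub_dotProduct]
      congr 1
      · rw [← dotProduct_transpose_mulVec', (hH k).transpose_eq]
      · rw [← dotProduct_transpose_mulVec', transpose_transpose, ← dotProduct_transpose_mulVec',
          (hH (k + 1)).transpose_eq]
    · rw [← h3, ha]
      refine integral_congr_ae (Filter.Eventually.of_forall fun ω => ?_)
      simp only [costate, if_neg hk1, sub_zero]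
      rw [← dotProduct_transpose_mulVec', (hH k).transpose_eq]
  have h4 : c 0 = 0 := by
    rw [hc]
    simp only [h.start, optState, sub_self, mulVec_zero, dotProduct_zero, integral_zero]
  rw [Finset.sum_congr rfl h1, Finset.sum_sub_distrib, sub_eq_zero,
    Finset.sum_congr rfl fun k hk => h2 k (Finset.mem_range.1 hk)]
  rcases hN : S.N with _ | M
  · simp
  -- The last a is zero, and so is c 0 because the initial states agree; the remaining sums match
  -- after the shift.
  · rw [Finset.sum_range_succ, if_neg (by omega), Finset.sum_range_succ' c, h4]
    congr 1
    exact Finset.sum_congr rfl fun k hk => if_pos (by have := Finset.mem_range.1 hk; omega)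

/-- The excess of the cost over the cost of the optimal controller. -/
theorem IsNoise.integral_pathCost_eq (hV : S.V.PosDef) (hQ0 : S.Q0.PosSemidef)
    (hQ : S.Q.PosSemidef) (hQuu : S.Quu.PosDef) :
    ∫ ω, S.pathCost x u ω ∂μ = ∫ ω, S.pathCost (S.optState x0 w v) (S.optInput x0 w v) ω ∂μ
      + ∫ ω, ∑ k ∈ Finset.range S.N, ((u k ω - S.optInput x0 w v k ω)
        - S.L k *ᵥ (x k ω - S.optState x0 w v k ω)) ⬝ᵥ S.H k *ᵥ ((u k ω - S.optInput x0 w v k ω)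
        - S.L k *ᵥ (x k ω - S.optState x0 w v k ω)) ∂μ := by
  have hH := S.H_posDef hQ0 hQ hQuu
  have hg := fun k => hn.squareIntegrable_of_mem
    (gap_mem_noiseSpan (S := S) (x0 := x0) (w := w) (v := v) k)
  have hdx := fun k (hk : k ≤ S.N) => (hn.state_mem_of_input h hu hk).sub
    (hn.squareIntegrable_of_mem (S.optState_mem_noiseSpan x0 w v k))
  have hdu := fun k (hk : k < S.N) => (hu k hk).sub
    (hn.squareIntegrable_of_mem (S.optInput_mem_noiseSpan x0 w v k))
  have hdyn : ∀ ω k, x (k + 1) ω - S.optState x0 w v (k + 1) ω =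
      S.A *ᵥ (x k ω - S.optState x0 w v k ω) + S.B *ᵥ (u k ω - S.optInput x0 w v k ω) := by
    intro ω k
    rw [h.step, (S.isRun_opt x0 w v).step]
    simp only [mulVec_sub]
    abel
  have hd0 : ∀ ω, x 0 ω - S.optState x0 w v 0 ω = 0 := fun ω => by
    rw [h.start, optState, sub_self]
  have hsum : ∀ ω, S.pathCost x u ω = S.pathCost (S.optState x0 w v) (S.optInput x0 w v) ω
      + 2 * ∑ k ∈ Finset.range S.N, (S.gap x0 w v k ω ⬝ᵥ S.H k *ᵥ
          ((u k ω - S.optInput x0 w v k ω) - S.L k *ᵥ (x k ω - S.optState x0 w v k ω))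
        + w k ω ⬝ᵥ S.Ric (k + 1) *ᵥ (x (k + 1) ω - S.optState x0 w v (k + 1) ω))
      + ∑ k ∈ Finset.range S.N, ((u k ω - S.optInput x0 w v k ω)
        - S.L k *ᵥ (x k ω - S.optState x0 w v k ω)) ⬝ᵥ S.H k *ᵥ ((u k ω - S.optInput x0 w v k ω)
        - S.L k *ᵥ (x k ω - S.optState x0 w v k ω)) := by
    intro ω
    have e1 := sum_stage_completion hQ0 hQ hQuu (a := fun k => S.optState x0 w v k ω)
      (c := fun k => S.optInput x0 w v k ω) (w := fun k => w k ω)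
      (b := fun k => x k ω - S.optState x0 w v k ω)
      (e := fun k => u k ω - S.optInput x0 w v k ω)
      (fun k => (S.isRun_opt x0 w v).step k ω) (hdyn ω) (hd0 ω)
    -- The deviation obeys the dynamics without noise, so here the completed squares carry no noise
    -- term.
    have e2 := sum_stage_completion hQ0 hQ hQuu
      (a := fun k => x k ω - S.optState x0 w v k ω)
      (c := fun k => u k ω - S.optInput x0 w v k ω) (w := fun k => 0)
      (b := fun k => x k ω - S.optState x0 w v k ω)
      (e := fun k => u k ω - S.optInput x0 w v k ω)
      (fun k => by rw [add_zero]; exact hdyn ω k) (hdyn ω) (hd0 ω)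
    have hgap : ∀ k, S.optInput x0 w v k ω - S.L k *ᵥ S.optState x0 w v k ω
        = S.gap x0 w v k ω := fun k => by
      rw [optInput]
      abel
    simp only [hgap] at e1
    simp only [zero_dotProduct, add_zero] at e2
    rw [← e1, ← e2]
    have hquad : ∀ {ι : Type} [Fintype ι] {M : Matrix ι ι ℝ}, M.PosSemidef → ∀ a b : ι → ℝ,
        (a + b) ⬝ᵥ M *ᵥ (a + b) = a ⬝ᵥ M *ᵥ a + 2 * (a ⬝ᵥ M *ᵥ b) + b ⬝ᵥ M *ᵥ b := by
      intro ι _ M hM a b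
      have : b ⬝ᵥ M *ᵥ a = a ⬝ᵥ M *ᵥ b := by
        conv_lhs => rw [← hM.transpose_eq, dotProduct_transpose_mulVec', dotProduct_comm]
      simp only [mulVec_add, dotProduct_add, add_dotProduct, this]
      ring
    have hx : ∀ k, x k ω = S.optState x0 w v k ω + (x k ω - S.optState x0 w v k ω) :=
      fun k => (add_sub_cancel _ _).symm
    have hxu : ∀ k, Sum.elim (x k ω) (u k ω) =
        Sum.elim (S.optState x0 w v k ω) (S.optInput x0 w v k ω)
          + Sum.elim (x k ω - S.optState x0 w v k ω) (u k ω - S.optInput x0 w v k ω) := by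
      intro k
      ext (r | r) <;> simp
    have hterm : x S.N ω ⬝ᵥ S.Q0 *ᵥ x S.N ω = _ :=
      (congrArg (fun z => z ⬝ᵥ S.Q0 *ᵥ z) (hx S.N)).trans (hquad hQ0 _ _)
    have hstage : ∀ k, Sum.elim (x k ω) (u k ω) ⬝ᵥ S.Q *ᵥ Sum.elim (x k ω) (u k ω) = _ :=
      fun k => (congrArg (fun z => z ⬝ᵥ S.Q *ᵥ z) (hxu k)).trans (hquad hQ _ _)
    rw [pathCost, pathCost, hterm, Finset.sum_congr rfl fun k _ => hstage k,
      Finset.sum_add_distrib, Finset.sum_add_distrib, ← Finset.mul_sum]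
    ring
  have hi1 := integrable_pathCost (S := S) (μ := μ)
    (fun k _ => hn.squareIntegrable_of_mem (S.optState_mem_noiseSpan x0 w v k))
    (fun k _ => hn.squareIntegrable_of_mem (S.optInput_mem_noiseSpan x0 w v k))
  have hid := fun k (hk : k ∈ Finset.range S.N) =>
    (hdu k (Finset.mem_range.1 hk)).sub ((hdx k (Finset.mem_range.1 hk).le).mulVec (S.L k))
  have hi2 := fun k (hk : k ∈ Finset.range S.N) =>
    integrable_dotProduct (hg k) ((hid k hk).mulVec (S.H k))
  have hi3 := fun k (hk : k ∈ Finset.range S.N) =>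
    integrable_dotProduct (hn.squareIntegrable_of_mem (w_mem_noiseSpan (x0 := x0) (v := v) k))
      ((hdx (k + 1) (Finset.mem_range.1 hk)).mulVec (S.Ric (k + 1)))
  have hi4 := integrable_finsetSum _ fun k (hk : k ∈ Finset.range S.N) =>
    integrable_dotProduct (hid k hk) ((hid k hk).mulVec (S.H k))
  have hi5 := fun k (hk : k ∈ Finset.range S.N) => (hi2 k hk).add (hi3 k hk)
  simp only [Pi.add_def] at hi5
  have hi23 := integrable_finsetSum _ hi5
  have hi6 := hi1.add (hi23.const_mul 2)
  simp only [Pi.add_def] at hi6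
  simp only [hsum]
  rw [integral_add hi6 hi4, integral_add hi1 (hi23.const_mul 2),
    integral_const_mul, integral_finsetSum _ hi5,
    Finset.sum_congr rfl fun k hk => integral_add (hi2 k hk) (hi3 k hk), Finset.sum_add_distrib,
    hn.integral_sum_gap_eq_zero h hu hV hH,
    Finset.sum_eq_zero fun k hk => hn.integral_noise_eq_zero h hu (Finset.mem_range.1 hk)]
  simp

end Optimality

end ThreePlayer

/-! ### Characterization of optimal runs and of their conditional expectations. -/

namespace ThreePlayer

variable {n q p : Fin 3 → ℕ} {S : ThreePlayer n q p} {Ω : Type*} {x0 : Ω → Blk n → ℝ}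
  {w : ℕ → Ω → Blk n → ℝ} {v : ℕ → Ω → Blk p → ℝ} {x : ℕ → Ω → Blk n → ℝ}
  {u : ℕ → Ω → Blk q → ℝ} {y : ℕ → Ω → Blk p → ℝ}

theorem IsRun.state_eq_opt (h : S.IsRun x0 w v x u y) {k : ℕ} {ω : Ω}
    (hu : ∀ j < k, u j ω = S.optInput x0 w v j ω) : x k ω = S.optState x0 w v k ω := by
  induction k with
  | zero => exact h.start ω
  | succ k ih =>
    rw [h.step, (S.isRun_opt x0 w v).step, ih fun j hj => hu j (by omega), hu k k.lt_succ_self]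

/-- Agreement of past inputs on this realization gives agreement of the states, and the law adds the
same gap to `L x` in both runs. -/
theorem IsRun.law_eq_optInput (h : S.IsRun x0 w v x u y) {k : ℕ} {ω : Ω}
    (hu : ∀ j < k, u j ω = S.optInput x0 w v j ω) :
    S.law u y k ω = S.optInput x0 w v k ω := by
  rw [sub_eq_iff_eq_add.1 (h.law_sub_eq_gap k ω), h.state_eq_opt hu, optInput, add_comm]

theorem IsRun.xTwo_eq_xBar_of_opt (h : S.IsRun x0 w v x u y) {k : ℕ} {ω : Ω}
    (hu : ∀ j < k, u j ω = S.optInput x0 w v j ω) : S.xTwo u y k ω = S.xBar u y k ω :=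
  xTwo_eq_xBar fun j hj => by rw [hu j hj, h.law_eq_optInput fun i hi => hu i (by omega)]

/-- An input without excess cost along a realization is the optimal input. -/
theorem IsRun.input_eq_opt_of_excess (h : S.IsRun x0 w v x u y) {ω : Ω}
    (hd : ∀ k < S.N, (u k ω - S.optInput x0 w v k ω)
      - S.L k *ᵥ (x k ω - S.optState x0 w v k ω) = 0) :
    ∀ k < S.N, u k ω = S.optInput x0 w v k ω := by
  intro k
  induction k using Nat.strong_induction_on with
  | _ k ih =>
    intro hk
    have h1 := hd k hk
    rw [h.state_eq_opt fun j hj => ih j hj (by omega), sub_self, mulVec_zero, sub_zero] at h1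
    exact sub_eq_zero.1 h1

variable [MeasurableSpace Ω] {μ : Measure Ω}

theorem ae_forall_lt {P : ℕ → Ω → Prop} {m : ℕ} (h : ∀ j < m, ∀ᵐ ω ∂μ, P j ω) :
    ∀ᵐ ω ∂μ, ∀ j < m, P j ω :=
  ae_all_iff.2 fun j => ae_all_iff.2 (h j)

theorem cost_eq_of_input_ae_eq (h : S.IsRun x0 w v x u y)
    (hu : ∀ k < S.N, ∀ᵐ ω ∂μ, u k ω = S.optInput x0 w v k ω) :
    S.cost μ x u = S.cost μ (S.optState x0 w v) (S.optInput x0 w v) := by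
  refine lintegral_congr_ae ?_
  have hall : ∀ᵐ ω ∂μ, ∀ k, k < S.N → u k ω = S.optInput x0 w v k ω :=
    ae_forall_lt fun k hk => hu k hk
  filter_upwards [hall] with ω hω
  rw [h.state_eq_opt hω]
  congr 2
  refine Finset.sum_congr rfl fun k hk => ?_
  rw [Finset.mem_range] at hk
  rw [hω k hk, h.state_eq_opt fun j hj => hω j (hj.trans hk)]

variable [IsProbabilityMeasure μ] (hn : S.IsNoise μ x0 w v)
include hn

theorem IsNoise.isOptimal_opt (hV : S.V.PosDef) (hQ0 : S.Q0.PosSemidef) (hQ : S.Q.PosSemidef)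
    (hQuu : S.Quu.PosDef) :
    S.IsOptimal μ x0 w v (S.optState x0 w v) (S.optInput x0 w v) := by
  intro x u y h
  -- The comparison by integrals needs square integrable inputs, which finite cost provides.
  rcases eq_or_ne (S.cost μ x u) ⊤ with htop | htop
  · rw [htop]
    exact le_top
  · have hu := hn.input_mem_of_cost_lt_top h hQ0 hQ hQuu htop.lt_top
    rw [cost_eq_ofReal hQ0 hQ (fun k hk => hn.state_mem_of_input h hu hk) hu, cost_eq_ofReal hQ0 hQ
      (fun k _ => hn.squareIntegrable_of_mem (S.optState_mem_noiseSpan x0 w v k))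
      (fun k _ => hn.squareIntegrable_of_mem (S.optInput_mem_noiseSpan x0 w v k))]
    refine ENNReal.ofReal_le_ofReal ?_
    rw [hn.integral_pathCost_eq h hu hV hQ0 hQ hQuu]
    exact le_add_of_nonneg_right (integral_nonneg fun ω => Finset.sum_nonneg fun k _ =>
      (S.H_posDef hQ0 hQ hQuu k).posSemidef.dotProduct_nonneg _)

/-- An optimal run has finite cost and hence no excess. As H is positive definite, the deviations
satisfy δu = L δx almost surely, and they start from zero. -/
theorem IsNoise.isOptimal_iff (h : S.IsControlled x0 w v x u y) (hV : S.V.PosDef)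
    (hQ0 : S.Q0.PosSemidef) (hQ : S.Q.PosSemidef) (hQuu : S.Quu.PosDef) :
    S.IsOptimal μ x0 w v x u ↔ ∀ k < S.N, ∀ᵐ ω ∂μ, u k ω = S.optInput x0 w v k ω := by
  constructor
  · intro hopt
    have hxs := fun k (_ : k ≤ S.N) =>
      hn.squareIntegrable_of_mem (S.optState_mem_noiseSpan x0 w v k)
    have hus := fun k (_ : k < S.N) =>
      hn.squareIntegrable_of_mem (S.optInput_mem_noiseSpan x0 w v k)
    have hle := hopt _ _ _ (S.isControlled_opt x0 w v)
    rw [cost_eq_ofReal hQ0 hQ hxs hus] at hle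
    have hu := hn.input_mem_of_cost_lt_top h hQ0 hQ hQuu
      (hle.trans_lt ENNReal.ofReal_lt_top)
    have hx := fun k (hk : k ≤ S.N) => hn.state_mem_of_input h hu hk
    rw [cost_eq_ofReal hQ0 hQ hx hu, ENNReal.ofReal_le_ofReal_iff
      (integral_nonneg (pathCost_nonneg hQ0 hQ _ _)),
      hn.integral_pathCost_eq h hu hV hQ0 hQ hQuu] at hle
    have hH := S.H_posDef hQ0 hQ hQuu
    have hpos : ∀ ω, ∀ k ∈ Finset.range S.N, 0 ≤ ((u k ω - S.optInput x0 w v k ω)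
        - S.L k *ᵥ (x k ω - S.optState x0 w v k ω)) ⬝ᵥ S.H k *ᵥ ((u k ω - S.optInput x0 w v k ω)
        - S.L k *ᵥ (x k ω - S.optState x0 w v k ω)) :=
      fun ω k _ => (hH k).posSemidef.dotProduct_nonneg _
    have hid := fun k (hk : k ∈ Finset.range S.N) =>
      ((hu k (Finset.mem_range.1 hk)).sub (hus k (Finset.mem_range.1 hk))).sub
        (((hx k (Finset.mem_range.1 hk).le).sub (hxs k (Finset.mem_range.1 hk).le)).mulVec (S.L k))
    have hint := integrable_finsetSum _ fun k (hk : k ∈ Finset.range S.N) =>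
      integrable_dotProduct (hid k hk) ((hid k hk).mulVec (S.H k))
    have hzero := (integral_eq_zero_iff_of_nonneg (fun ω => Finset.sum_nonneg (hpos ω)) hint).1
      (le_antisymm (by linarith) (integral_nonneg fun ω => Finset.sum_nonneg (hpos ω)))
    intro k hk
    filter_upwards [hzero] with ω hω
    refine h.isRun.input_eq_opt_of_excess (fun j hj => ?_) k hk
    by_contra hne
    exact absurd ((Finset.sum_eq_zero_iff_of_nonneg (hpos ω)).1 hω j (Finset.mem_range.2 hj))
      ((hH j).dotProduct_pos hne).ne'
  · intro hu x' u' y' h'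
    rw [cost_eq_of_input_ae_eq h.isRun hu]
    exact hn.isOptimal_opt hV hQ0 hQ hQuu _ _ _ h'

theorem IsNoise.integrable_of_mem {ι : Type*} [Fintype ι] {X : Ω → ι → ℝ}
    (hX : CoordsIn (noiseSpan x0 w v) X) : Integrable X μ :=
  Integrable.of_eval fun r => (hn.squareIntegrable_of_mem hX r).integrable one_le_two

/-- The two-step estimate is the conditional expectation as long as the inputs are optimal. -/
theorem IsNoise.condExp_two (h : S.IsControlled x0 w v x u y) (hV : S.V.PosDef) {k : ℕ}
    (hk : k ≤ S.N) (hu : ∀ j < k, ∀ᵐ ω ∂μ, u j ω = S.optInput x0 w v j ω) :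
    μ[x k | sigmaOf (outputsUpTo p 2 k) y] =ᵐ[μ] S.xTwo u y k := by
  have hall : ∀ᵐ ω ∂μ, ∀ j < k, u j ω = S.optInput x0 w v j ω :=
    ae_forall_lt fun j hj => hu j hj
  -- The two-step estimate itself need not be a function of y(0:k-2) for this run. Its almost sure
  -- version `xBar` is, so it serves as the conditional expectation.
  have hx : x k =ᵐ[μ] fun ω => S.xBar u y k ω + S.errTwo x0 w v k ω := by
    filter_upwards [hall] with ω hω
    rw [h.isRun.x_eq_xTwo_add, h.isRun.xTwo_eq_xBar_of_opt hω]
  have hi : Integrable (S.xBar u y k) μ := by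
    have h1 := hn.integrable_of_mem ((S.optState_mem_noiseSpan x0 w v k).sub
      (errTwo_mem_noiseSpan (S := S) k))
    refine h1.congr ?_
    filter_upwards [hall] with ω hω
    rw [← h.isRun.xTwo_eq_xBar_of_opt hω, ← h.isRun.state_eq_opt hω, h.isRun.x_eq_xTwo_add,
      add_sub_cancel_right]
  have hm := xBar_mem_measurableFun (S := S) (u := u) (y := y) (k := k)
    fun j hj s => h.input_mem_measurableFun (hj.trans_le hk) s
  refine (condExp_congr_ae hx).trans ((condExp_ae_eq_of_hasCov_zero hn.gaussian
    hn.measurable_primitive hn.mean_zero (fun _ => rfl) (errTwo_mem_noiseSpan k)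
    (observe_free_mem_noiseSpan _) (hn.cov_errTwo_free hV k)
    (h.sigmaOf_outputsUpTo_le_free 2 hk) (@measurable_pi_lambda _ _ _ (_) _ _ hm) hi).trans ?_)
  filter_upwards [hall] with ω hω
  exact (h.isRun.xTwo_eq_xBar_of_opt hω).symm

/-- Optimality is assumed only of the inputs before time k, so that the optimal input can be
recognized stage by stage. -/
theorem IsNoise.law_ae_eq (h : S.IsControlled x0 w v x u y) (hV : S.V.PosDef) {k : ℕ}
    (hk : k ≤ S.N) (hu : ∀ j < k, ∀ᵐ ω ∂μ, u j ω = S.optInput x0 w v j ω) :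
    ∀ᵐ ω ∂μ, S.F k *ᵥ (y k ω - S.C *ᵥ S.xLoc u y k ω) + S.F1 k *ᵥ S.prevInnov u y k ω
      + S.L k *ᵥ (μ[x k | sigmaOf (outputsUpTo p 2 k) y]) ω = S.optInput x0 w v k ω := by
  have hall : ∀ᵐ ω ∂μ, ∀ j < k, u j ω = S.optInput x0 w v j ω :=
    ae_forall_lt fun j hj => hu j hj
  filter_upwards [hall, hn.condExp_two h hV hk hu] with ω hω hc
  rw [hc, ← h.isRun.law_eq_optInput hω]
  rfl

theorem IsNoise.condExp_pred (h : S.IsControlled x0 w v x u y) (hV : S.V.PosDef)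
    (hu : ∀ k < S.N, ∀ᵐ ω ∂μ, u k ω = S.optInput x0 w v k ω) {k : ℕ} (hk : k ≤ S.N) :
    S.xPred u y k =ᵐ[μ] μ[x k | sigmaOf (outputsUpTo p 1 k) y] := by
  have hall : ∀ᵐ ω ∂μ, ∀ j < k, u j ω = S.optInput x0 w v j ω :=
    ae_forall_lt fun j hj => hu j (hj.trans_le hk)
  -- Integrability is inherited from the optimal run: almost surely the prediction is the optimal
  -- state minus the error, both linear in the noise.
  have hi : Integrable (S.xPred u y k) μ := by
    refine (hn.integrable_of_mem ((S.optState_mem_noiseSpan x0 w v k).sub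
      (err_mem_noiseSpan (S := S) k))).congr ?_
    filter_upwards [hall] with ω hω
    rw [← h.isRun.state_eq_opt hω, h.isRun.x_eq_xPred_add, add_sub_cancel_right]
  have hm := xPred_mem_measurableFun (S := S) (u := u) (y := y) (k := k)
    fun j hj s => h.input_mem_measurableFun (hj.trans_le hk) s
  exact (condExp_ae_eq_of_hasCov_zero hn.gaussian hn.measurable_primitive hn.mean_zero
    (h.isRun.x_eq_xPred_add k) (err_mem_noiseSpan k) (observe_free_mem_noiseSpan _)
    (hn.cov_err_free hV k) (h.sigmaOf_outputsUpTo_le_free 1 hk)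
    (@measurable_pi_lambda _ _ _ (_) _ _ hm) hi).symm

theorem IsNoise.condExp_loc (h : S.IsControlled x0 w v x u y) (hV : S.V.PosDef)
    (hu : ∀ k < S.N, ∀ᵐ ω ∂μ, u k ω = S.optInput x0 w v k ω) {k : ℕ} (hk : k ≤ S.N) (i : Fin 3) :
    (fun ω (a : Fin (n i)) => S.xLoc u y k ω ⟨i, a⟩) =ᵐ[μ]
      μ[fun ω (a : Fin (n i)) => x k ω ⟨i, a⟩ | sigmaOf (infoPast p i k) y] := by
  have hall : ∀ᵐ ω ∂μ, ∀ j < k, u j ω = S.optInput x0 w v j ω :=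
    ae_forall_lt fun j hj => hu j (hj.trans_le hk)
  have hspan : CoordsIn (noiseSpan x0 w v)
      (fun ω (a : Fin (n i)) => S.errLoc x0 w v k ω ⟨i, a⟩) := fun a => errLoc_mem_noiseSpan k _
  have hspan' : CoordsIn (noiseSpan x0 w v)
      (fun ω (a : Fin (n i)) => S.optState x0 w v k ω ⟨i, a⟩) :=
    fun a => S.optState_mem_noiseSpan x0 w v k _
  have hi : Integrable (fun ω (a : Fin (n i)) => S.xLoc u y k ω ⟨i, a⟩) μ := by
    refine (hn.integrable_of_mem (hspan'.sub hspan)).congr ?_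
    filter_upwards [hall] with ω hω
    ext a
    simp only [Pi.sub_apply]
    rw [← h.isRun.state_eq_opt hω, h.isRun.x_eq_xLoc_add, Pi.add_apply, add_sub_cancel_right]
  have hm := fun a => xLoc_mem_measurableFun (S := S) (u := u) (y := y) (k := k)
    (fun j hj s => h.input_mem_measurableFun (hj.trans_le hk) s) ⟨i, a⟩
  exact (condExp_ae_eq_of_hasCov_zero hn.gaussian hn.measurable_primitive hn.mean_zero
    (fun ω => funext fun a => congrFun (h.isRun.x_eq_xLoc_add k ω) ⟨i, a⟩) hspan
    (observe_free_mem_noiseSpan _) (hn.cov_errLoc_free hV i k) (h.sigmaOf_infoPast_le_free i hk)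
    (@measurable_pi_lambda _ _ _ (_) _ _ hm) hi).symm

end ThreePlayer

theorem theorem1 {n q p : Fin 3 → ℕ} (S : ThreePlayer n q p)
    (hV : S.V.PosDef) (hQ0 : S.Q0.PosSemidef) (hQ : S.Q.PosSemidef) (hQuu : S.Quu.PosDef)
    {Ω : Type*} [MeasurableSpace Ω] (μ : Measure Ω) [IsProbabilityMeasure μ]
    (x0 : Ω → Blk n → ℝ) (w : ℕ → Ω → Blk n → ℝ) (v : ℕ → Ω → Blk p → ℝ)
    (hnoise : S.IsNoise μ x0 w v) :
    -- the recursively implemented controller is admissible and optimal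
    (∃ x u y, S.IsControlled x0 w v x u y ∧ S.IsOptimal μ x0 w v x u ∧
      ∀ k < S.N, ∀ ω, u k ω =
        S.F k *ᵥ S.innovLoc u y k ω + S.F1 k *ᵥ S.prevInnov u y k ω
          + S.L k *ᵥ S.xTwo u y k ω) ∧
    ∀ x u y, S.IsControlled x0 w v x u y →
      -- an admissible controller is optimal if and only if it is given by the formula
      (S.IsOptimal μ x0 w v x u ↔
        ∀ k < S.N, ∀ᵐ ω ∂μ, u k ω =
          S.F k *ᵥ (y k ω - S.C *ᵥ S.xLoc u y k ω) + S.F1 k *ᵥ S.prevInnov u y k ω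
            + S.L k *ᵥ (μ[x k | sigmaOf (outputsUpTo p 2 k) y]) ω) ∧
      (S.IsOptimal μ x0 w v x u →
        -- the explicit formula for the two-step estimate
        (∀ k < S.N, ∀ᵐ ω ∂μ, (μ[x (k + 1) | sigmaOf (outputsUpTo p 2 (k + 1)) y]) ω =
          S.xLoc u y (k + 1) ω
            - (S.B * S.F k + S.K1 k) *ᵥ (y k ω - S.C *ᵥ S.xPred u y k ω)) ∧
        (∀ᵐ ω ∂μ, (μ[x 0 | sigmaOf (outputsUpTo p 2 0) y]) ω = 0) ∧
        -- the iterations compute the optimal estimates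
        (∀ k ≤ S.N, S.xPred u y k =ᵐ[μ] μ[x k | sigmaOf (outputsUpTo p 1 k) y]) ∧
        (∀ k ≤ S.N, ∀ i, (fun ω (a : Fin (n i)) => S.xLoc u y k ω ⟨i, a⟩) =ᵐ[μ]
          μ[fun ω (a : Fin (n i)) => x k ω ⟨i, a⟩ | sigmaOf (infoPast p i k) y]) ∧
        -- the matrices used in the gains are the covariances that they stand for
        (∀ k ≤ S.N,
          HasCov μ (fun ω => x k ω - S.xPred u y k ω) (fun ω => x k ω - S.xPred u y k ω) (S.P k) ∧
          HasCov μ (fun ω => x k ω - S.xLoc u y k ω) (fun ω => x k ω - S.xLoc u y k ω) (S.P1 k) ∧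
          HasCov μ (S.innov u y k) (S.innov u y k) (S.Yt k) ∧
          HasCov μ (S.innovLoc u y k) (S.innovLoc u y k) (S.Y1t k) ∧
          HasCov μ (fun ω => x k ω - S.xLoc u y k ω) (S.prevInnov u y k) (S.Pt k))) := by
  refine ⟨⟨_, _, _, S.isControlled_opt x0 w v, hnoise.isOptimal_opt hV hQ0 hQ hQuu,
    fun k _ ω => S.optInput_eq_law x0 w v k ω⟩, fun x u y h => ⟨?_, fun hopt => ?_⟩⟩
  · rw [hnoise.isOptimal_iff h hV hQ0 hQ hQuu]
    constructor
    · intro hu k hk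
      filter_upwards [hu k hk, hnoise.law_ae_eq h hV hk.le fun j hj => hu j (hj.trans hk)]
        with ω h1 h2
      rw [h1, h2]
    · intro hu k
      -- The formula contains a conditional expectation that depends on the run. Once the earlier
      -- inputs are known to be optimal, this expectation is the two-step estimate, and the formula
      -- gives the optimal input at k.
      induction k using Nat.strong_induction_on with
      | _ k ih =>
        intro hk
        filter_upwards [hu k hk, hnoise.law_ae_eq h hV hk.le fun j hj => ih j hj (hj.trans hk)]
          with ω h1 h2
        rw [h1, h2]
  · have hu := (hnoise.isOptimal_iff h hV hQ0 hQ hQuu).1 hopt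
    refine ⟨fun k hk => hnoise.condExp_two h hV hk fun j hj => hu j (by omega),
      hnoise.condExp_two h hV (Nat.zero_le _) fun j hj => absurd hj (Nat.not_lt_zero j),
      fun k hk => hnoise.condExp_pred h hV hu hk, fun k hk i => hnoise.condExp_loc h hV hu hk i,
      fun k _ => ?_⟩
    have h1 : (fun ω => x k ω - S.xPred u y k ω) = S.err x0 w v k := funext fun ω => by
      rw [h.isRun.x_eq_xPred_add, add_sub_cancel_left]
    have h2 : (fun ω => x k ω - S.xLoc u y k ω) = S.errLoc x0 w v k := funext fun ω => by
      rw [h.isRun.x_eq_xLoc_add, add_sub_cancel_left]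
    rw [h1, h2, funext (h.isRun.innov_eq k), funext (h.isRun.innovLoc_eq k),
      funext (h.isRun.prevInnov_eq k)]
    exact ⟨hnoise.cov_err_err hV k, hnoise.cov_errLoc_errLoc hV k,
      hnoise.cov_errInnov_errInnov hV k, hnoise.cov_errInnovLoc_errInnovLoc hV k,
      hnoise.cov_errLoc_errPrev hV k⟩
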